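/- \textbf{Theorem.} A noncommutative algebraic branching program (ABP) over $\mathbb{Q}$ in the variables $x_1,\dots,x_n$ with $\tilde d$ layers is a directed graph whose vertices are partitioned into layers $0,1,\dots,\tilde d$, with edges only from a layer to the next one, each edge labelled by an affine linear form $c+\sum_{i=1}^n a_i x_i$ with $c,a_i\in\mathbb{Q}$, together with a source vertex in layer $0$ and a sink vertex in layer $\tilde d$. Its width is the maximal number of vertices in a layer, and it computes the polynomial in $\mathbb{Q}\langle x_1,\dots,x_n\rangle$ that is the sum, over all source-to-sink paths, of the ordered products of the labels along the path. There are a deterministic algorithm and a constant $C$ such that the following holds for all integers $n,r,\tilde d\ge 1$. On input $(n,r,\tilde d)$ the algorithm writes down, in quasipolynomial time (at most $2^{C(\lfloor\log_2(nr\tilde d)\rfloor+1)^{C}}$ on a random access machine with logarithmic cost), an integer $\ell$, a cyclic algebra $D$ and a finite set $\mathcal{H}\subseteq D^n$ such that: (1) $D=(K/F,\sigma,z)$, where $F=\mathbb{Q}(z)$ with $z$ an indeterminate, $K=F(\omega)$ with $\omega$ a primitive root of unity of some order $m$, $K/F$ is a cyclic Galois extension of degree $\ell$, and $\sigma$, given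 by $\sigma(\omega)=\omega^g$ for some integer $g$, generates $\mathrm{Gal}(K/F)$; that is, $D=K\oplus Kx\oplus\cdots\oplus Kx^{\ell-1}$ with $x^\ell=z$ and $xb=\sigma(b)x$ for all $b\in K$. The algebra $D$ is a division algebra with centre $F$ and of dimension $\ell^2$ over $F$, i.e. of index $\ell$, and $\tilde d<\ell\le (nr\tilde d+1)^{C}$. (2) $|\mathcal{H}|\le (nr(\tilde d+1))^{C\lfloor\log_2(\tilde d+1)\rfloor}$; in particular $|\mathcal{H}|= (nr\tilde d)^{O(\log\tilde d)}$ for $\tilde d\ge 2$. (3) $\mathcal{H}$ is a hitting set: for every nonzero polynomial $f\in\mathbb{Q}\langle x_1,\dots,x_n\rangle$ computed by an ABP of width at most $r$ with $\tilde d$ layers there is $q\in\mathcal{H}$ with $f(q)\ne 0$. (4) For every such $f$ and every $q\in\mathcal{H}$ with $f(q)\neq 0$, the element $f(q)$ is invertible in $D$. Hence $\mathcal{H}$ is a strong hitting set: every nonzero such $f$ takes an invertible value at some point of $\mathcal{H}$. Here $D$ is written down as $(\ell,m,g)$, and the points of $\mathcal{H}$ as tuples of finite sums of terms $\frac{a}{b}z^i\omega^jx^k$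 with $a\in\mathbb{Z}$, $b\in\mathbb{Z}_{>0}$ and $i,j,k\in\mathbb{Z}_{\geq 0}$. -/

import Mathlib

noncomputable section

/-! ## Noncommutative algebraic branching programs over `ℚ` -/

/-- The affine `ℚ`-linear form `c + ∑ i, a i * x i` in noncommuting variables `x i`. -/
structure AffineForm (n : ℕ) where
  const : ℚ
  coeff : Fin n → ℚ

/-- The noncommutative polynomial given by an affine form. -/
def AffineForm.toPoly {n : ℕ} (L : AffineForm n) : FreeAlgebra ℚ (Fin n) :=
  algebraMap ℚ (FreeAlgebra ℚ (Fin n)) L.const + ∑ i, L.coeff i • FreeAlgebra.ι ℚ i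

/-- A noncommutative algebraic branching program in `n` variables: a directed graph whose vertices
are partitioned into layers `0, …, d` (so there are `d` layers of edges), with edges only from a
layer to the next one, each labelled by an affine form, a source in layer `0` and a sink in
layer `d`. An absent edge is an edge with label `0`. -/
structure ABP (n d : ℕ) where
  /-- `card i` is the number of vertices in layer `i`. -/
  card : Fin (d + 1) → ℕ
  source : Fin (card 0)
  sink : Fin (card (Fin.last d))
  label : ∀ i : Fin d, Fin (card i.castSucc) → Fin (card i.succ) → AffineForm n

namespace ABP

variable {n d : ℕ}

/-- The width is the maximal number of vertices in a layer. -/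
def width (B : ABP n d) : ℕ := Finset.univ.sup B.card

/-- A source-to-sink path chooses one vertex in every layer. -/
def IsPath (B : ABP n d) (p : ∀ i : Fin (d + 1), Fin (B.card i)) : Prop :=
  p 0 = B.source ∧ p (Fin.last d) = B.sink

open Classical in
/-- The polynomial computed by the program: the sum over all source-to-sink paths of the ordered
product of the labels along the path. -/
def poly (B : ABP n d) : FreeAlgebra ℚ (Fin n) :=
  ∑ p : (∀ i : Fin (d + 1), Fin (B.card i)) with B.IsPath p,
    (List.ofFn fun i : Fin d => (B.label i (p i.castSucc) (p i.succ)).toPoly).prod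

end ABP

/-- The noncommutative polynomials in `n` variables over `ℚ` that are computed by programs of width
at most `r` with `d` layers (of edges). -/
def abpClass (n r d : ℕ) : Set (FreeAlgebra ℚ (Fin n)) :=
  {f | ∃ B : ABP n d, B.width ≤ r ∧ B.poly = f}

/-- Every nonzero polynomial of the class is nonzero at some point of `H`. -/
def IsHittingSet {n : ℕ} {A : Type*} [Ring A] [Algebra ℚ A]
    (𝒞 : Set (FreeAlgebra ℚ (Fin n))) (H : Finset (Fin n → A)) : Prop :=
  ∀ f ∈ 𝒞, f ≠ 0 → ∃ q ∈ H, FreeAlgebra.lift ℚ q f ≠ 0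

/-- Every nonzero polynomial of the class is invertible at some point of `H`. -/
def IsStrongHittingSet {n : ℕ} {A : Type*} [Ring A] [Algebra ℚ A]
    (𝒞 : Set (FreeAlgebra ℚ (Fin n))) (H : Finset (Fin n → A)) : Prop :=
  ∀ f ∈ 𝒞, f ≠ 0 → ∃ q ∈ H, IsUnit (FreeAlgebra.lift ℚ q f)

/-! ## Cyclic algebras, in their matrix representation -/

section Cyclic

variable {F K : Type*} [Field F] [Field K] [Algebra F K]

/-- The matrix `M(x)` of the generator `x`: ones above the diagonal, `a` in the lower left corner. -/
def cyclicX (K : Type*) [Field K] [Algebra F K] (ℓ : ℕ) (a : F) : Matrix (Fin ℓ) (Fin ℓ) K :=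
  Matrix.of fun i j =>
    if j.val = i.val + 1 then 1
    else if i.val + 1 = ℓ ∧ j.val = 0 then algebraMap F K a
    else 0

/-- The matrix `M(b) = diag(b, σ b, …, σ^(ℓ-1) b)` of an element `b` of `K`. -/
def cyclicDiag (σ : K ≃ₐ[F] K) (ℓ : ℕ) (b : K) : Matrix (Fin ℓ) (Fin ℓ) K :=
  Matrix.diagonal fun i => (σ ^ i.val) b

/-- The cyclic algebra `(K/F, σ, a) = K ⊕ K x ⊕ ⋯ ⊕ K x^(ℓ-1)`, with `x^ℓ = a` and `x b = σ(b) x`,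
as the `F`-algebra of `ℓ × ℓ` matrices over `K` generated by `M(x)` and all `M(b)`. -/
def cyclicAlgebra (σ : K ≃ₐ[F] K) (ℓ : ℕ) (a : F) : Subalgebra F (Matrix (Fin ℓ) (Fin ℓ) K) :=
  Algebra.adjoin F (insert (cyclicX K ℓ a) (Set.range (cyclicDiag σ ℓ)))

/-- The generator `x` as an element of the cyclic algebra. -/
def cyclicAlgebra.x (σ : K ≃ₐ[F] K) (ℓ : ℕ) (a : F) : cyclicAlgebra σ ℓ a :=
  ⟨cyclicX K ℓ a, Algebra.subset_adjoin (Set.mem_insert _ _)⟩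

/-- An element `b` of `K` as an element of the cyclic algebra. -/
def cyclicAlgebra.ofK (σ : K ≃ₐ[F] K) (ℓ : ℕ) (a : F) (b : K) : cyclicAlgebra σ ℓ a :=
  ⟨cyclicDiag σ ℓ b, Algebra.subset_adjoin (Set.mem_insert_of_mem _ (Set.mem_range_self b))⟩

/-- `K/F` is a cyclic Galois extension of degree `ℓ` with generator `σ`, and `(K/F, σ, a)` is a
central division algebra over `F` of dimension `ℓ ^ 2`, i.e. of index `ℓ`. -/
structure IsCyclicDivisionAlgebra (σ : K ≃ₐ[F] K) (ℓ : ℕ) (a : F) : Prop where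
  isGalois : IsGalois F K
  finrank_field : Module.finrank F K = ℓ
  generates : ∀ τ : K ≃ₐ[F] K, τ ∈ Subgroup.zpowers σ
  isCentral : Algebra.IsCentral F (cyclicAlgebra σ ℓ a)
  finrank_algebra : Module.finrank F (cyclicAlgebra σ ℓ a) = ℓ ^ 2
  pos : 0 < ℓ
  isUnit_of_ne_zero : ∀ y : cyclicAlgebra σ ℓ a, y ≠ 0 → IsUnit y

end Cyclic

/-- The field `ℚ(z)` of rational functions in one indeterminate `z`. -/
abbrev RatZ : Type := RatFunc ℚ

/-- The field `ℚ(z)(ω) = ℚ(ω, z)` with `ω` a primitive `m`-th root of unity. -/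
abbrev RatZOmega (m : ℕ) : Type := CyclotomicField m RatZ

/-- The algebra `(K/F, σ, z)` with `F = ℚ(z)` and `K = ℚ(ω, z)`. -/
abbrev CyclicD {m : ℕ} (σ : RatZOmega m ≃ₐ[RatZ] RatZOmega m) (ℓ : ℕ) : Type :=
  cyclicAlgebra σ ℓ (RatFunc.X : RatZ)

/-- The `ℚ`-algebra structure that comes from `ℚ ⊆ ℚ(z)`. -/
instance {m : ℕ} (σ : RatZOmega m ≃ₐ[RatZ] RatZOmega m) (ℓ : ℕ) : Algebra ℚ (CyclicD σ ℓ) :=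
  Algebra.compHom (CyclicD σ ℓ) (algebraMap ℚ RatZ)

/-! ## Explicit representation of elements and points -/

/-- A term `(num / den) * z ^ zExp * ω ^ wExp * x ^ xExp`. -/
structure DTerm where
  num : ℤ
  den : ℕ+
  zExp : ℕ
  wExp : ℕ
  xExp : ℕ

/-- The element of `(K/F, σ, z)` that a term stands for. -/
def DTerm.value {m : ℕ} (σ : RatZOmega m ≃ₐ[RatZ] RatZOmega m) (ℓ : ℕ) (ω : RatZOmega m)
    (t : DTerm) : CyclicD σ ℓ :=
  algebraMap RatZ (CyclicD σ ℓ) (((t.num : RatZ) / ((t.den : ℕ) : RatZ)) * RatFunc.X ^ t.zExp) *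
    cyclicAlgebra.ofK σ ℓ RatFunc.X (ω ^ t.wExp) * cyclicAlgebra.x σ ℓ RatFunc.X ^ t.xExp

/-- The point of `D ^ n` whose coordinates are given as sums of terms. -/
def pointValue {m : ℕ} (σ : RatZOmega m ≃ₐ[RatZ] RatZOmega m) (ℓ : ℕ) (ω : RatZOmega m) {n : ℕ}
    (q : Fin n → List DTerm) : Fin n → CyclicD σ ℓ :=
  fun i => ((q i).map (DTerm.value σ ℓ ω)).sum

/-- A term is written as six natural numbers; the integer `num` as its positive and negative part. -/
def DTerm.encode (t : DTerm) : List ℕ :=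
  [t.num.toNat, (-t.num).toNat, t.den, t.zExp, t.wExp, t.xExp]

/-- A sum of terms is written as the number of terms followed by the terms. -/
def encodeElem (e : List DTerm) : List ℕ := e.length :: e.flatMap DTerm.encode

/-- The written form of an algebra (index `ℓ`, order `m` of `ω`, exponent `g` with `σ ω = ω ^ g`)
together with a list of points. -/
def encodeOutput {n : ℕ} (ℓ m g : ℕ) (pts : List (Fin n → List DTerm)) : List ℕ :=
  [ℓ, m, g, pts.length] ++ pts.flatMap fun q => (List.ofFn q).flatMap encodeElem

/-! ## Deterministic time: random access machines with logarithmic cost -/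

namespace RAM

/-- Programs over registers `R 0, R 1, …` that hold natural numbers. -/
inductive Prog : Type
  /-- `R t := k` -/
  | const (t k : ℕ)
  /-- `R t := R a + R b` -/
  | add (t a b : ℕ)
  /-- `R t := R a - R b` (truncated) -/
  | sub (t a b : ℕ)
  /-- `R t := R a * R b` -/
  | mul (t a b : ℕ)
  /-- `R t := R a / R b` (rounded down, `0` if `R b = 0`) -/
  | div (t a b : ℕ)
  /-- `R t := R (R a)` -/
  | load (t a : ℕ)
  /-- `R (R t) := R a` -/
  | store (t a : ℕ)
  /-- append `R a` to the output -/
  | emit (a : ℕ)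
  /-- `P; Q` -/
  | seq (P Q : Prog)
  /-- if `R a ≠ 0` then `P` else `Q` -/
  | cond (a : ℕ) (P Q : Prog)
  /-- while `R a ≠ 0` do `P` -/
  | loop (a : ℕ) (P : Prog)

/-- A state: the contents of the registers and the output written so far. -/
structure State where
  reg : ℕ → ℕ
  out : List ℕ

/-- Assignment to a register. -/
def State.set (s : State) (t v : ℕ) : State := ⟨Function.update s.reg t v, s.out⟩

/-- `Exec P s c s'`: started in state `s`, the program `P` halts in state `s'` at total cost `c`.
Every instruction and every test is charged one plus the bit lengths (`Nat.size`) of the numbers,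
indirect addresses included, that it reads. -/
inductive Exec : Prog → State → ℕ → State → Prop
  | const (s : State) (t k : ℕ) : Exec (.const t k) s (1 + k.size) (s.set t k)
  | add (s : State) (t a b : ℕ) :
      Exec (.add t a b) s (1 + (s.reg a).size + (s.reg b).size) (s.set t (s.reg a + s.reg b))
  | sub (s : State) (t a b : ℕ) :
      Exec (.sub t a b) s (1 + (s.reg a).size + (s.reg b).size) (s.set t (s.reg a - s.reg b))
  | mul (s : State) (t a b : ℕ) :
      Exec (.mul t a b) s (1 + (s.reg a).size + (s.reg b).size) (s.set t (s.reg a * s.reg b))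
  | div (s : State) (t a b : ℕ) :
      Exec (.div t a b) s (1 + (s.reg a).size + (s.reg b).size) (s.set t (s.reg a / s.reg b))
  | load (s : State) (t a : ℕ) :
      Exec (.load t a) s (1 + (s.reg a).size + (s.reg (s.reg a)).size)
        (s.set t (s.reg (s.reg a)))
  | store (s : State) (t a : ℕ) :
      Exec (.store t a) s (1 + (s.reg t).size + (s.reg a).size) (s.set (s.reg t) (s.reg a))
  | emit (s : State) (a : ℕ) :
      Exec (.emit a) s (1 + (s.reg a).size) ⟨s.reg, s.out ++ [s.reg a]⟩
  | seq {P Q : Prog} {s s' s'' : State} {c c' : ℕ} (hP : Exec P s c s') (hQ : Exec Q s' c' s'') :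
      Exec (.seq P Q) s (c + c') s''
  | cond_true {a : ℕ} {P Q : Prog} {s s' : State} {c : ℕ} (ha : s.reg a ≠ 0)
      (hP : Exec P s c s') : Exec (.cond a P Q) s (1 + (s.reg a).size + c) s'
  | cond_false {a : ℕ} {P Q : Prog} {s s' : State} {c : ℕ} (ha : s.reg a = 0)
      (hQ : Exec Q s c s') : Exec (.cond a P Q) s (1 + c) s'
  | loop_done {a : ℕ} {P : Prog} {s : State} (ha : s.reg a = 0) : Exec (.loop a P) s 1 s
  | loop_step {a : ℕ} {P : Prog} {s s' s'' : State} {c c' : ℕ} (ha : s.reg a ≠ 0)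
      (hP : Exec P s c s') (hL : Exec (.loop a P) s' c' s'') :
      Exec (.loop a P) s (1 + (s.reg a).size + c + c') s''

/-- The initial state: the input in the first registers, all others `0`, empty output. -/
def init (input : List ℕ) : State := ⟨fun i => input.getD i 0, []⟩

/-- On the given input, `P` halts with the given output at cost at most `T`. -/
def OutputsWithin (P : Prog) (input output : List ℕ) (T : ℕ) : Prop :=
  ∃ c s, Exec P (init input) c s ∧ s.out = output ∧ c ≤ T

end RAM

end

/-!
Let `h = ⌈log₂ d⌉`, let `ω` be a primitive root of unity of order `m = 3 ^ (h + 1)` and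
`σ ω = ω ^ 2`. As `2` is a primitive root modulo `3 ^ (h + 1)`, `σ` generates the Galois group of
`ℚ(ω, z)` over `ℚ(z)`, of order `ℓ = 2 * 3 ^ h > d`. The valuation at `z = ∞` is invariant under
`σ`, and for it the nonzero terms `b k * x ^ k` of an element of `D = (K/F, σ, z)` have values that
differ modulo `ℤ`, because `x ^ ℓ = z`; so `D` has no zero divisors, and every nonzero value in `D`
is invertible.

The coefficient of the word `w` in a polynomial computed by a branching program is a linear
functional of a product of matrices taken along `w`. If integer weights are given to the pairs
of a position and a letter, and those products have a basis of words that are isolated (each of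
the other products is a combination of basis products of smaller weight), then some total of the
coefficients over the words of one length and one weight is nonzero. Such weights are found by
merging neighbouring blocks of positions `h` times; each time it suffices to add a multiple of the
old weight to the value of an injective code modulo some number at most `N`, so the `h` moduli,
as digits in base `N`, form a seed below `N ^ h`.

At the point `q i = b i * x` the part of length `e` of a polynomial is evaluated by multiplying
`σ ^ j (b i)` over the letters `i` at positions `j`. Taking
`b i = ∑ k < d, z ^ (E * W (k, i)) * ∑ c < m, z ^ (c * (m - 2 ^ k % m)) * ω ^ c` and setting the
`z` of the inner sum to `ω`, only `k = j` survives in `σ ^ j (b i)`, by orthogonality of roots of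
unity: a letter knows its position. The two powers of `z` behave as independent variables
because `E` exceeds the degree in the inner one, so a word contributes the weight `W` of its
positioned letters as an exponent, and the weights separate a nonzero total.
-/

/-! ## Basis isolating weights -/

section IsolatingBasis

open Submodule Pointwise

theorem mem_span_image_mono {k M V : Type*} [Semiring k] [AddCommMonoid V] [Module k V]
    {f : M → V} {T U : Set M} {v : V} (hv : v ∈ span k (f '' T)) (h : T ⊆ U) :
    v ∈ span k (f '' U) :=
  span_mono (Set.image_mono h) hv

/-- A basis isolated by a weight function `wt`: the elements of `S` have distinct weights and
linearly independent values, and the value of every other element of the family `F` is a linear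
combination of values of elements of `S` of strictly smaller weight. -/
structure IsIsolatingBasis (k : Type*) {M V α : Type*} [DivisionRing k] [AddCommGroup V]
    [Module k V] [LT α] (val : M → V) (wt : M → α) (F : Set M) (S : Finset M) : Prop where
  subset : (S : Set M) ⊆ F
  injOn : Set.InjOn wt S
  linearIndepOn : LinearIndepOn k val (S : Set M)
  mem_or_mem_span : ∀ a ∈ F, a ∈ S ∨ val a ∈ span k (val '' {b | b ∈ S ∧ wt b < wt a})

namespace IsIsolatingBasis

variable {k M V α β : Type*} [DivisionRing k] [AddCommGroup V] [Module k V] [LinearOrder α]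
  [LinearOrder β] {val : M → V} {wt : M → α} {F : Set M} {S : Finset M}

theorem card_le_finrank [Module.Finite k V] (h : IsIsolatingBasis k val wt F S) :
    S.card ≤ Module.finrank k V := by
  simpa using LinearIndependent.fintype_card_le_finrank h.linearIndepOn

theorem mem_span_le (h : IsIsolatingBasis k val wt F S) {a : M} (ha : a ∈ F) :
    val a ∈ span k (val '' {b | b ∈ S ∧ wt b ≤ wt a}) := by
  rcases h.mem_or_mem_span a ha with haS | hspan
  · exact subset_span ⟨a, ⟨haS, le_rfl⟩, rfl⟩
  · exact mem_span_image_mono hspan fun c hc => ⟨hc.1, hc.2.le⟩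

theorem exists_of_finite (hF : F.Finite) (hinj : Set.InjOn wt F) :
    ∃ S, IsIsolatingBasis k val wt F S := by
  classical
  lift F to Finset M using hF
  induction F using Finset.induction_on_max_value wt with
  | empty => exact ⟨∅, by simp, by simp, by simp, by simp⟩
  | insert a F ha hmax ih =>
    obtain ⟨S, hS⟩ := ih (hinj.mono (by simp))
    have hSF : S ⊆ F := Finset.coe_subset.1 hS.subset
    have hlt : ∀ b ∈ F, wt b < wt a := fun b hb => (hmax b hb).lt_of_ne fun hab =>
      ha (hinj (by simp [hb]) (by simp) hab ▸ hb)
    by_cases hspan : val a ∈ span k (val '' (S : Set M))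
    · refine ⟨S, hS.subset.trans (by simp), hS.injOn, hS.linearIndepOn, fun b hb => ?_⟩
      rcases Finset.mem_insert.1 hb with rfl | hb
      · exact Or.inr (mem_span_image_mono hspan fun c hc => ⟨hc, hlt c (hSF hc)⟩)
      · exact hS.mem_or_mem_span b hb
    · have hinsert : insert a S ⊆ insert a F := Finset.insert_subset_insert a hSF
      refine ⟨insert a S, Finset.coe_subset.2 hinsert, hinj.mono (Finset.coe_subset.2 hinsert),
        ?_, fun b hb => ?_⟩
      · simpa using hS.linearIndepOn.insert hspan
      · rcases Finset.mem_insert.1 hb with rfl | hb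
        · exact Or.inl (Finset.mem_insert_self _ _)
        · refine (hS.mem_or_mem_span b hb).imp Finset.mem_insert_of_mem fun h => ?_
          exact mem_span_image_mono h fun c hc => ⟨Finset.mem_insert_of_mem hc.1, hc.2⟩

theorem exists_of_refine {wt' : M → β} {T : Finset M} (hTF : (T : Set M) ⊆ F)
    (hT : ∀ a ∈ F, a ∈ T ∨ val a ∈ span k (val '' {b | b ∈ T ∧ wt b < wt a}))
    (hlt : ∀ a ∈ F, ∀ b ∈ F, wt a < wt b → wt' a < wt' b) (hinj : Set.InjOn wt' T) :
    ∃ S, IsIsolatingBasis k val wt' F S := by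
  obtain ⟨S, hS⟩ := exists_of_finite (k := k) (val := val) T.finite_toSet hinj
  refine ⟨S, hS.subset.trans hTF, hS.injOn, hS.linearIndepOn, fun a ha => ?_⟩
  refine (hT a ha).elim (hS.mem_or_mem_span a) fun hspan => Or.inr (span_le.2 ?_ hspan)
  rintro _ ⟨b, ⟨hb, hba⟩, rfl⟩
  have hba' : wt' b < wt' a := hlt b (hTF hb) a ha hba
  exact mem_span_image_mono (hS.mem_span_le hb) fun c hc => ⟨hc.1, hc.2.trans_lt hba'⟩

/-- The sum over a weight class has only one nonzero term for the minimal weight of a basis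
element on which `φ` does not vanish. -/
theorem exists_sum_ne_zero {W : Type*} [AddCommGroup W] [Module k W]
    (h : IsIsolatingBasis k val wt F S) (φ : V →ₗ[k] W) {Z : Finset M} (hZF : (Z : Set M) ⊆ F)
    (hZ : ∀ a ∈ F, a ∉ Z → φ (val a) = 0) (hne : ∃ a ∈ F, φ (val a) ≠ 0) :
    ∃ w, ∑ a ∈ Z with wt a = w, φ (val a) ≠ 0 := by
  classical
  have eq_zero_of_mem_span {T : Set M} {v : V} (hT : ∀ b ∈ T, φ (val b) = 0)
      (hv : v ∈ span k (val '' T)) : φ v = 0 := by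
    have hle : span k (val '' T) ≤ LinearMap.ker φ :=
      span_le.2 (Set.forall_mem_image.2 fun b hb => hT b hb)
    exact hle hv
  have hbasis : (S.filter fun b => φ (val b) ≠ 0).Nonempty := by
    by_contra! hempty
    have hvanish : ∀ b ∈ S, φ (val b) = 0 := by
      simpa [Finset.filter_eq_empty_iff] using hempty
    obtain ⟨a, ha, hφ⟩ := hne
    exact hφ (eq_zero_of_mem_span (fun b hb => hvanish b hb.1) (h.mem_span_le ha))
  obtain ⟨b, hb, hmin⟩ := Finset.exists_min_image _ wt hbasis
  obtain ⟨hbS, hφb⟩ := Finset.mem_filter.1 hb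
  have hbZ : b ∈ Z := by
    by_contra hbZ
    exact hφb (hZ b (h.subset hbS) hbZ)
  have hsum : ∑ a ∈ Z with wt a = wt b, φ (val a) = φ (val b) := by
    refine Finset.sum_eq_single_of_mem b (Finset.mem_filter.2 ⟨hbZ, rfl⟩) fun c hc hcb => ?_
    obtain ⟨hcZ, hwt⟩ := Finset.mem_filter.1 hc
    rcases h.mem_or_mem_span c (hZF hcZ) with hcS | hspan
    · exact absurd (h.injOn hcS hbS hwt) hcb
    · refine eq_zero_of_mem_span (fun e he => ?_) hspan
      by_contra hφ
      exact (hmin e (Finset.mem_filter.2 ⟨he.1, hφ⟩)).not_gt (hwt ▸ he.2)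
  exact ⟨wt b, hsum ▸ hφb⟩

end IsIsolatingBasis

section Mul

variable {k M A α : Type*} [Field k] [Ring A] [Algebra k A] [Monoid M]

theorem mul_mem_span_image_of_mul_mem (val : M →* A) {U₁ U₂ U : Set M} {x y : A}
    (hx : x ∈ span k (val '' U₁)) (hy : y ∈ span k (val '' U₂))
    (hU : ∀ a ∈ U₁, ∀ b ∈ U₂, a * b ∈ U) : x * y ∈ span k (val '' U) := by
  have hxy := Submodule.mul_mem_mul hx hy
  rw [Submodule.span_mul_span, ← Set.image_mul] at hxy
  exact mem_span_image_mono hxy (Set.mul_subset_iff.2 hU)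

namespace IsIsolatingBasis

variable [DecidableEq M] {val : M →* A} {F₁ F₂ : Set M} {S₁ S₂ : Finset M}

theorem mul_mem_or_mem_span [AddCommMonoid α] [LinearOrder α]
    [IsOrderedCancelAddMonoid α] {wt : M → α} (hwt : ∀ a b, wt (a * b) = wt a + wt b)
    (h₁ : IsIsolatingBasis k val wt F₁ S₁) (h₂ : IsIsolatingBasis k val wt F₂ S₂) {a : M}
    (ha : a ∈ F₁ * F₂) :
    a ∈ S₁ * S₂ ∨ val a ∈ span k (val '' {b | b ∈ S₁ * S₂ ∧ wt b < wt a}) := by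
  obtain ⟨a₁, ha₁, a₂, ha₂, rfl⟩ := ha
  simp only [map_mul, hwt]
  rcases h₁.mem_or_mem_span a₁ ha₁ with hS₁ | hspan₁
  · rcases h₂.mem_or_mem_span a₂ ha₂ with hS₂ | hspan₂
    · exact Or.inl (Finset.mul_mem_mul hS₁ hS₂)
    · refine Or.inr (mul_mem_span_image_of_mul_mem val (h₁.mem_span_le ha₁) hspan₂ ?_)
      exact fun x hx y hy =>
        ⟨Finset.mul_mem_mul hx.1 hy.1, hwt x y ▸ add_lt_add_of_le_of_lt hx.2 hy.2⟩
  · refine Or.inr (mul_mem_span_image_of_mul_mem val hspan₁ (h₂.mem_span_le ha₂) ?_)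
    exact fun x hx y hy =>
      ⟨Finset.mul_mem_mul hx.1 hy.1, hwt x y ▸ add_lt_add_of_lt_of_le hx.2 hy.2⟩

theorem exists_mul {wt hash : M → ℕ} {B : ℕ} (hwt : ∀ a b, wt (a * b) = wt a + wt b)
    (h₁ : IsIsolatingBasis k val wt F₁ S₁) (h₂ : IsIsolatingBasis k val wt F₂ S₂)
    (hB : ∀ a ∈ F₁ * F₂, hash a < B) (hinj : Set.InjOn hash ((S₁ * S₂ : Finset M) : Set M)) :
    ∃ S, IsIsolatingBasis k val (fun a => B * wt a + hash a) (F₁ * F₂) S := by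
  have hsub : ((S₁ * S₂ : Finset M) : Set M) ⊆ F₁ * F₂ := by
    rw [Finset.coe_mul]
    exact Set.mul_subset_mul h₁.subset h₂.subset
  refine exists_of_refine hsub (fun a ha => mul_mem_or_mem_span hwt h₁ h₂ ha) ?_ ?_
  · intro a ha b _ hab
    have hle : B * (wt a + 1) ≤ B * wt b := Nat.mul_le_mul_left _ hab
    linarith [hB a ha]
  · intro a ha b hb hab
    refine hinj ha hb ?_
    simpa [Nat.mul_add_mod, Nat.mod_eq_of_lt (hB a (hsub ha)), Nat.mod_eq_of_lt (hB b (hsub hb))]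
      using congrArg (· % B) hab

end IsIsolatingBasis

end Mul

end IsolatingBasis

/-! ## Hashing by a small modulus -/

theorem two_pow_le_centralBinom (k : ℕ) : 2 ^ k ≤ k.centralBinom := by
  induction k with
  | zero => simp
  | succ k ih =>
    have hrec := Nat.succ_mul_centralBinom_succ k
    have hdouble : (k + 1) * (2 * k.centralBinom) ≤ (k + 1) * (k + 1).centralBinom := by
      rw [hrec]
      nlinarith [Nat.zero_le k.centralBinom, Nat.zero_le k]
    have := Nat.le_of_mul_le_mul_left hdouble k.succ_pos
    rw [pow_succ]
    lia

/-- A number divisible by everything up to `2 * L` is a multiple of `L.centralBinom ≥ 2 ^ L`, all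
of whose prime power factors are at most `2 * L`. -/
theorem exists_not_dvd_of_lt_two_pow {x L : ℕ} (hx : x ≠ 0) (hL : x < 2 ^ L) :
    ∃ q, 0 < q ∧ q ≤ 2 * L ∧ ¬ q ∣ x := by
  by_contra! hdvd
  have hcentral : L.centralBinom ∣ x := by
    rw [← Nat.factorization_prime_le_iff_dvd (Nat.centralBinom_ne_zero L) hx]
    intro p hp
    rw [← hp.pow_dvd_iff_le_factorization hx]
    rcases Nat.eq_zero_or_pos L with rfl | hpos
    · simp
    · exact hdvd _ (Nat.pow_pos hp.pos) (Nat.pow_factorization_choose_le (by lia))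
  have := Nat.le_of_dvd (Nat.pos_of_ne_zero hx) hcentral
  have := two_pow_le_centralBinom L
  lia

theorem exists_modulus_forall_not_modEq {P : Finset (ℕ × ℕ)} {L : ℕ} (hne : ∀ x ∈ P, x.1 ≠ x.2)
    (hlt : ∀ x ∈ P, x.1 < 2 ^ L ∧ x.2 < 2 ^ L) :
    ∃ q, 0 < q ∧ q ≤ 2 * (L * P.card + 1) ∧ ∀ x ∈ P, ¬ x.1 ≡ x.2 [MOD q] := by
  let diff (x : ℕ × ℕ) : ℕ := ((x.1 : ℤ) - x.2).natAbs
  have hpos : ∏ x ∈ P, diff x ≠ 0 := Finset.prod_ne_zero_iff.2 fun x hx => by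
    have := hne x hx
    simp only [diff]
    lia
  have hle : ∏ x ∈ P, diff x ≤ 2 ^ (L * P.card) := by
    rw [pow_mul]
    refine Finset.prod_le_pow_card _ _ _ fun x hx => ?_
    have := hlt x hx
    simp only [diff]
    lia
  obtain ⟨q, hq, hqL, hndvd⟩ := exists_not_dvd_of_lt_two_pow hpos
    (hle.trans_lt (Nat.pow_lt_pow_succ one_lt_two))
  refine ⟨q, hq, hqL, fun x hx hmod => hndvd ?_⟩
  exact (Int.natCast_dvd.1 (Nat.modEq_iff_dvd.1 hmod.symm)).trans (Finset.dvd_prod_of_mem diff hx)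

theorem exists_modulus_injOn {ι : Type*} (I : Finset ι) (T : ι → Finset ℕ) {D L : ℕ}
    (hcard : ∀ a ∈ I, (T a).card ≤ D) (hlt : ∀ a ∈ I, ∀ x ∈ T a, x < 2 ^ L) :
    ∃ q, 0 < q ∧ q ≤ 2 * (L * (I.card * D ^ 2) + 1) ∧ ∀ a ∈ I, Set.InjOn (· % q) (T a) := by
  classical
  obtain ⟨q, hq, hqL, hmod⟩ := exists_modulus_forall_not_modEq (L := L)
    (P := I.biUnion fun a => (T a).offDiag) (by simp +contextual) (by
      simp only [Finset.mem_biUnion, Finset.mem_offDiag]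
      rintro x ⟨a, ha, hx, hy, -⟩
      exact ⟨hlt a ha _ hx, hlt a ha _ hy⟩)
  have hle : (I.biUnion fun a => (T a).offDiag).card ≤ I.card * D ^ 2 := by
    refine Finset.card_biUnion_le_card_mul _ _ _ fun a ha => ?_
    rw [Finset.offDiag_card, pow_two]
    exact (Nat.sub_le _ _).trans (Nat.mul_le_mul (hcard a ha) (hcard a ha))
  refine ⟨q, hq, hqL.trans (by gcongr), fun a ha x hx y hy hxy => ?_⟩
  by_contra hne
  exact hmod (x, y)
    (Finset.mem_biUnion.2 ⟨a, ha, Finset.mem_offDiag.2 ⟨hx, hy, hne⟩⟩) hxy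

/-! ## Isolating weights for words -/

section LetterSum

variable {α : Type*}

/-- The sum of a letter weight over the letters of a word. -/
def letterSum (c : α → ℕ) (u : FreeMonoid α) : ℕ := (u.toList.map c).sum

theorem letterSum_one (c : α → ℕ) : letterSum c 1 = 0 := by
  simp [letterSum]

theorem letterSum_of (c : α → ℕ) (x : α) : letterSum c (FreeMonoid.of x) = c x := by
  simp [letterSum]

theorem letterSum_mul (c : α → ℕ) (u v : FreeMonoid α) :
    letterSum c (u * v) = letterSum c u + letterSum c v := by
  simp [letterSum]

theorem letterSum_mul_add (B : ℕ) (c c' : α → ℕ) (u : FreeMonoid α) :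
    letterSum (fun x => B * c x + c' x) u = B * letterSum c u + letterSum c' u := by
  simp [letterSum, List.sum_map_add, List.sum_map_mul_left]

theorem letterSum_mod_modEq (c : α → ℕ) (q : ℕ) (u : FreeMonoid α) :
    letterSum (fun x => c x % q) u ≡ letterSum c u [MOD q] := by
  unfold letterSum
  induction u.toList with
  | nil => rfl
  | cons x l ih => simpa using (Nat.mod_modEq (c x) q).add ih

theorem letterSum_le_length_mul {c : α → ℕ} {N : ℕ} (hc : ∀ x, c x ≤ N) (u : FreeMonoid α) :
    letterSum c u ≤ u.length * N := by
  have := List.sum_le_card_nsmul (u.toList.map c) N (by simpa using fun x _ => hc x)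
  simpa [letterSum, FreeMonoid.length] using this

end LetterSum

section WordBlock

open Pointwise

/-- The letter `i < n` at position `k`, as the digit `i + 1` at place `k` in base `n + 1`. -/
def letterCode (n k i : ℕ) : ℕ := (i + 1) * (n + 1) ^ k

/-- The weight of the letter `i` at position `k` after `j` rounds of hashing, the moduli being one
more than the base-`N` digits of the seed `q`; its base-`B` digits are `i + 1` and the hashes. -/
def letterWeight (n B N : ℕ) : ℕ → ℕ → ℕ → ℕ → ℕ
  | 0, _, _, i => i + 1
  | j + 1, q, k, i => B * letterWeight n B N j (q / N) k i + letterCode n k i % (q % N + 1)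

variable {n : ℕ}

/-- The number whose base-`(n + 1)` digits are given by the positioned letters of a word. -/
def wordCode (u : FreeMonoid (ℕ × Fin n)) : ℕ := letterSum (fun x => letterCode n x.1 x.2) u

/-- The weight of a word of positioned letters, additive over its letters. -/
def wordWeight (B N j q : ℕ) (u : FreeMonoid (ℕ × Fin n)) : ℕ :=
  letterSum (fun x => letterWeight n B N j q x.1 x.2) u

theorem wordWeight_mul (B N j q : ℕ) (u v : FreeMonoid (ℕ × Fin n)) :
    wordWeight B N j q (u * v) = wordWeight B N j q u + wordWeight B N j q v :=
  letterSum_mul _ u v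

theorem wordWeight_succ {B N m : ℕ} (hm : m < N) (j q : ℕ) (u : FreeMonoid (ℕ × Fin n)) :
    wordWeight B N (j + 1) (m + N * q) u =
      B * wordWeight B N j q u + letterSum (fun x => letterCode n x.1 x.2 % (m + 1)) u := by
  simp only [wordWeight, ← letterSum_mul_add, letterWeight, Nat.add_mul_mod_self_left,
    Nat.mod_eq_of_lt hm, Nat.add_mul_div_left _ _ (by lia : 0 < N), Nat.div_eq_of_lt hm, zero_add]

variable (n) in
/-- The words with exactly one letter at every position of the `a`-th dyadic block
`a * 2 ^ j, …, (a + 1) * 2 ^ j - 1` that lies below `e`. -/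
def wordBlock (e : ℕ) : ℕ → ℕ → Set (FreeMonoid (ℕ × Fin n))
  | 0, a => if a < e then Set.range fun i : Fin n => FreeMonoid.of (a, i) else {1}
  | j + 1, a => wordBlock e j (2 * a) * wordBlock e j (2 * a + 1)

theorem finite_wordBlock_zero (e a : ℕ) : (wordBlock n e 0 a).Finite := by
  rw [wordBlock]
  split_ifs
  exacts [Set.finite_range _, Set.finite_singleton _]

theorem length_le_of_mem_wordBlock {e j a : ℕ} {u : FreeMonoid (ℕ × Fin n)}
    (hu : u ∈ wordBlock n e j a) : u.length ≤ 2 ^ j := by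
  induction j generalizing a u with
  | zero =>
    rw [wordBlock] at hu
    split_ifs at hu
    · obtain ⟨i, rfl⟩ := hu
      simp
    · rw [Set.mem_singleton_iff.1 hu]
      simp
  | succ j ih =>
    obtain ⟨u₁, h₁, u₂, h₂, rfl⟩ := hu
    have := ih h₁
    have := ih h₂
    simp only [FreeMonoid.length_mul, pow_succ]
    lia

theorem exists_wordCode_eq_mul {e j a : ℕ} {u : FreeMonoid (ℕ × Fin n)}
    (hu : u ∈ wordBlock n e j a) :
    ∃ c < (n + 1) ^ 2 ^ j, wordCode u = (n + 1) ^ (a * 2 ^ j) * c := by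
  induction j generalizing a u with
  | zero =>
    rw [wordBlock] at hu
    split_ifs at hu
    · obtain ⟨i, rfl⟩ := hu
      exact ⟨i + 1, by simp, by simp [wordCode, letterSum_of, letterCode, mul_comm]⟩
    · rw [Set.mem_singleton_iff.1 hu]
      exact ⟨0, by simp, by simp [wordCode, letterSum_one]⟩
  | succ j ih =>
    obtain ⟨u₁, h₁, u₂, h₂, rfl⟩ := hu
    obtain ⟨c₁, hc₁, e₁⟩ := ih h₁
    obtain ⟨c₂, hc₂, e₂⟩ := ih h₂
    refine ⟨c₁ + (n + 1) ^ 2 ^ j * c₂, ?_, ?_⟩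
    · calc c₁ + (n + 1) ^ 2 ^ j * c₂ < (n + 1) ^ 2 ^ j * (c₂ + 1) := by linarith
        _ ≤ (n + 1) ^ 2 ^ j * (n + 1) ^ 2 ^ j := Nat.mul_le_mul_left _ hc₂
        _ = (n + 1) ^ 2 ^ (j + 1) := by ring
    · unfold wordCode at e₁ e₂ ⊢
      simp only [letterSum_mul, e₁, e₂]
      ring

theorem injOn_wordCode_wordBlock (e j a : ℕ) : Set.InjOn wordCode (wordBlock n e j a) := by
  induction j generalizing a with
  | zero =>
    rw [wordBlock]
    split_ifs
    · rintro _ ⟨i, rfl⟩ _ ⟨i', rfl⟩ hcode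
      simp only [wordCode, letterSum_of, letterCode] at hcode
      have := Nat.eq_of_mul_eq_mul_right (by positivity) hcode
      rw [show i = i' from Fin.ext (by lia)]
    · exact Set.injOn_singleton _ _
  | succ j ih =>
    rintro _ ⟨u₁, hu₁, u₂, hu₂, rfl⟩ _ ⟨v₁, hv₁, v₂, hv₂, rfl⟩ hcode
    obtain ⟨c₁, hc₁, e₁⟩ := exists_wordCode_eq_mul hu₁
    obtain ⟨c₂, -, e₂⟩ := exists_wordCode_eq_mul hu₂
    obtain ⟨d₁, hd₁, f₁⟩ := exists_wordCode_eq_mul hv₁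
    obtain ⟨d₂, -, f₂⟩ := exists_wordCode_eq_mul hv₂
    have hsum : wordCode u₁ + wordCode u₂ = wordCode v₁ + wordCode v₂ := by
      simpa only [wordCode, letterSum_mul] using hcode
    have hdigits : c₁ + (n + 1) ^ 2 ^ j * c₂ = d₁ + (n + 1) ^ 2 ^ j * d₂ := by
      refine Nat.eq_of_mul_eq_mul_left (by positivity : 0 < (n + 1) ^ (2 * a * 2 ^ j)) ?_
      rw [e₁, e₂, f₁, f₂] at hsum
      linear_combination hsum
    have hlow : c₁ = d₁ := by
      have hmod := congrArg (· % (n + 1) ^ 2 ^ j) hdigits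
      simpa only [Nat.add_mul_mod_self_left, Nat.mod_eq_of_lt hc₁, Nat.mod_eq_of_lt hd₁] using hmod
    have hhigh : c₂ = d₂ := by
      rw [hlow] at hdigits
      exact Nat.eq_of_mul_eq_mul_left (by positivity) (Nat.add_left_cancel hdigits)
    rw [ih _ hu₁ hv₁ (by rw [e₁, f₁, hlow]), ih _ hu₂ hv₂ (by rw [e₂, f₂, hhigh])]

theorem wordCode_lt_of_mem_wordBlock {e j a p : ℕ} {u : FreeMonoid (ℕ × Fin n)}
    (hu : u ∈ wordBlock n e j a) (ha : (a + 1) * 2 ^ j ≤ p) : wordCode u < 2 ^ (n * p) := by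
  obtain ⟨c, hc, he⟩ := exists_wordCode_eq_mul hu
  calc wordCode u < (n + 1) ^ (a * 2 ^ j) * (n + 1) ^ 2 ^ j :=
        he ▸ Nat.mul_lt_mul_of_pos_left hc (by positivity)
    _ = (n + 1) ^ ((a + 1) * 2 ^ j) := by ring
    _ ≤ (n + 1) ^ p := Nat.pow_le_pow_right n.succ_pos ha
    _ ≤ (2 ^ n) ^ p := Nat.pow_le_pow_left Nat.lt_two_pow_self _
    _ = 2 ^ (n * p) := (pow_mul ..).symm

theorem exists_modulus_injOn_wordCode {C p N e j : ℕ} {T : ℕ → Finset (FreeMonoid (ℕ × Fin n))}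
    (hcard : ∀ a, (a + 1) * 2 ^ j ≤ p → (T a).card ≤ C)
    (hT : ∀ a, (a + 1) * 2 ^ j ≤ p → (T a : Set _) ⊆ wordBlock n e j a)
    (hN : 2 * (n * p * (p * C ^ 2) + 1) ≤ N) :
    ∃ m, 0 < m ∧ m ≤ N ∧ ∀ a, (a + 1) * 2 ^ j ≤ p →
      Set.InjOn (fun u : FreeMonoid (ℕ × Fin n) => wordCode u % m) (T a) := by
  classical
  obtain ⟨m, hm, hmN, hinj⟩ := exists_modulus_injOn (D := C) (L := n * p)
    ((Finset.range p).filter fun a => (a + 1) * 2 ^ j ≤ p)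
    (fun a => (T a).image wordCode)
    (fun a ha => Finset.card_image_le.trans (hcard a (Finset.mem_filter.1 ha).2))
    (fun a ha => Finset.forall_mem_image.2 fun u hu =>
      wordCode_lt_of_mem_wordBlock (hT a (Finset.mem_filter.1 ha).2 hu) (Finset.mem_filter.1 ha).2)
  refine ⟨m, hm, hmN.trans (le_trans ?_ hN), fun a ha u hu v hv huv => ?_⟩
  · gcongr
    exact (Finset.card_filter_le _ _).trans (Finset.card_range p).le
  · have hap : a < p := lt_of_lt_of_le (Nat.lt_succ_self a)
      ((Nat.le_mul_of_pos_right _ (by positivity)).trans ha)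
    exact injOn_wordCode_wordBlock e j a (hT a ha hu) (hT a ha hv)
      (hinj a (by simp [hap, ha]) (Finset.mem_coe.2 (Finset.mem_image_of_mem _ hu))
        (Finset.mem_coe.2 (Finset.mem_image_of_mem _ hv)) huv)

variable {k A : Type*} [Field k] [Ring A] [Algebra k A]

theorem exists_isIsolatingBasis_wordBlock_zero (val : FreeMonoid (ℕ × Fin n) →* A)
    (e B N q a : ℕ) :
    ∃ S, IsIsolatingBasis k val (wordWeight B N 0 q) (wordBlock n e 0 a) S := by
  refine IsIsolatingBasis.exists_of_finite (finite_wordBlock_zero e a) ?_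
  rw [wordBlock]
  split_ifs
  · rintro _ ⟨i, rfl⟩ _ ⟨i', rfl⟩ hwt
    simp only [wordWeight, letterSum_of, letterWeight] at hwt
    rw [show i = i' from Fin.ext (by lia)]
  · exact Set.injOn_singleton _ _

variable [Module.Finite k A]

/-- One modulus serves all blocks: the codes of the at most `D ^ 2` products of basis elements in
each block are to be distinct modulo `m`. -/
theorem exists_modulus_isIsolatingBasis_wordBlock_succ (val : FreeMonoid (ℕ × Fin n) →* A)
    {D p N e j : ℕ} {wt : FreeMonoid (ℕ × Fin n) → ℕ} (hwt : ∀ u v, wt (u * v) = wt u + wt v)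
    (hD : Module.finrank k A ≤ D) (hN : 2 * (n * p * (p * D ^ 4) + 1) ≤ N)
    (h : ∀ a, (a + 1) * 2 ^ j ≤ p → ∃ S, IsIsolatingBasis k val wt (wordBlock n e j a) S) :
    ∃ m < N, ∀ a, (a + 1) * 2 ^ (j + 1) ≤ p → ∃ S, IsIsolatingBasis k val
      (fun u => (p * N + 1) * wt u + letterSum (fun x => letterCode n x.1 x.2 % (m + 1)) u)
      (wordBlock n e (j + 1) a) S := by
  classical
  choose! S hS using h
  have hchild (a : ℕ) (ha : (a + 1) * 2 ^ (j + 1) ≤ p) :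
      (2 * a + 1) * 2 ^ j ≤ p ∧ (2 * a + 1 + 1) * 2 ^ j ≤ p := by
    rw [pow_succ] at ha
    constructor <;> linarith [Nat.zero_le (2 ^ j)]
  obtain ⟨m, hm, hmN, hinj⟩ := exists_modulus_injOn_wordCode (C := D * D) (N := N)
    (e := e) (j := j + 1) (T := fun a => S (2 * a) * S (2 * a + 1))
    (fun a ha => Finset.card_mul_le.trans (Nat.mul_le_mul
      ((hS _ (hchild a ha).1).card_le_finrank.trans hD)
      ((hS _ (hchild a ha).2).card_le_finrank.trans hD)))
    (fun a ha => by
      rw [Finset.coe_mul]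
      exact Set.mul_subset_mul (hS _ (hchild a ha).1).subset (hS _ (hchild a ha).2).subset)
    (by rwa [show (D * D) ^ 2 = D ^ 4 by ring])
  refine ⟨m - 1, by lia, fun a ha => ?_⟩
  rw [Nat.sub_add_cancel hm]
  refine IsIsolatingBasis.exists_mul hwt (hS _ (hchild a ha).1) (hS _ (hchild a ha).2)
    (fun u hu => ?_) fun u hu v hv huv => hinj a ha hu hv ?_
  · have hlen : u.length ≤ p :=
      (length_le_of_mem_wordBlock (j := j + 1) hu).trans (le_trans (by simp) ha)
    refine Nat.lt_succ_of_le ((letterSum_le_length_mul (fun x => ?_) u).trans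
      (Nat.mul_le_mul hlen hmN))
    exact (Nat.mod_lt _ hm).le
  · exact (letterSum_mod_modEq _ m u).symm.trans
      ((congrArg (· % m) huv).trans (letterSum_mod_modEq _ m v))

theorem exists_seed_isIsolatingBasis_wordBlock (val : FreeMonoid (ℕ × Fin n) →* A) {D p N : ℕ}
    (e : ℕ) (hD : Module.finrank k A ≤ D) (hN : 2 * (n * p * (p * D ^ 4) + 1) ≤ N) (j : ℕ) :
    ∃ q < N ^ j, ∀ a, (a + 1) * 2 ^ j ≤ p →
      ∃ S, IsIsolatingBasis k val (wordWeight (p * N + 1) N j q) (wordBlock n e j a) S := by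
  induction j with
  | zero => exact ⟨0, by simp, fun a _ => exists_isIsolatingBasis_wordBlock_zero val e _ N 0 a⟩
  | succ j ih =>
    obtain ⟨q, hq, hS⟩ := ih
    obtain ⟨m, hm, hS'⟩ := exists_modulus_isIsolatingBasis_wordBlock_succ val
      (wordWeight_mul _ N j q) hD hN hS
    refine ⟨m + N * q, ?_, fun a ha => ?_⟩
    · calc m + N * q < N * (q + 1) := by linarith
        _ ≤ N ^ (j + 1) := pow_succ' N j ▸ Nat.mul_le_mul_left N hq
    · simpa only [← wordWeight_succ hm] using hS' a ha

end WordBlock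

/-! ## The structure of cyclic algebras -/

section CyclicStructure

variable {F K : Type*} [Field F] [Field K] [Algebra F K] (σ : K ≃ₐ[F] K) (ℓ : ℕ) (a : F)

/-- The matrix of `∑ k < ℓ, b k * x ^ k`, as a linear function of the coefficient sequence `b`; the
values `b k` with `ℓ ≤ k` play no role. -/
def cyclicMatrix : (ℕ → K) →ₗ[F] Matrix (Fin ℓ) (Fin ℓ) K where
  toFun b := Matrix.of fun i j =>
    if i.val ≤ j.val then (σ ^ i.val) (b (j.val - i.val))
    else algebraMap F K a * (σ ^ i.val) (b (ℓ + j.val - i.val))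
  map_add' b c := by
    ext i j
    simp only [Matrix.of_apply, Matrix.add_apply, Pi.add_apply]
    split_ifs <;> simp [mul_add]
  map_smul' r b := by
    ext i j
    simp only [Matrix.of_apply, Matrix.smul_apply, Pi.smul_apply, RingHom.id_apply]
    split_ifs <;> simp

theorem cyclicMatrix_apply (b : ℕ → K) (i j : Fin ℓ) :
    cyclicMatrix σ ℓ a b i j = if i.val ≤ j.val then (σ ^ i.val) (b (j.val - i.val))
      else algebraMap F K a * (σ ^ i.val) (b (ℓ + j.val - i.val)) := rfl

theorem cyclicMatrix_zero_apply [NeZero ℓ] (b : ℕ → K) (j : Fin ℓ) :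
    cyclicMatrix σ ℓ a b 0 j = b j := by
  simp [cyclicMatrix_apply]

theorem cyclicMatrix_congr {b b' : ℕ → K} (h : ∀ k < ℓ, b k = b' k) :
    cyclicMatrix σ ℓ a b = cyclicMatrix σ ℓ a b' := by
  ext i j
  simp only [cyclicMatrix_apply]
  split_ifs
  · rw [h _ (by lia)]
  · rw [h _ (by lia)]

theorem cyclicDiag_mul_cyclicMatrix (c : K) (b : ℕ → K) :
    cyclicDiag σ ℓ c * cyclicMatrix σ ℓ a b = cyclicMatrix σ ℓ a fun k => c * b k := by
  ext i j
  simp only [cyclicDiag, Matrix.diagonal_mul, cyclicMatrix_apply]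
  split_ifs
  · rw [map_mul]
  · rw [map_mul, mul_left_comm]

theorem cyclicX_mul_apply [NeZero ℓ] (Y : Matrix (Fin ℓ) (Fin ℓ) K) (i j : Fin ℓ) :
    (cyclicX K ℓ a * Y) i j =
      if h : i.val + 1 < ℓ then Y ⟨i.val + 1, h⟩ j else algebraMap F K a * Y 0 j := by
  rw [Matrix.mul_apply]
  split_ifs with h
  · rw [Finset.sum_eq_single_of_mem ⟨i.val + 1, h⟩ (Finset.mem_univ _)]
    · simp [cyclicX]
    · intro k _ hk
      have hval : k.val ≠ i.val + 1 := fun h' => hk (Fin.ext h')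
      simp [cyclicX, hval, h.ne]
  · have hi : i.val + 1 = ℓ := by lia
    rw [Finset.sum_eq_single_of_mem 0 (Finset.mem_univ _)]
    · simp [cyclicX, hi, NeZero.ne' ℓ]
    · intro k _ hk
      have hval : k.val ≠ i.val + 1 := by lia
      simp [cyclicX, hval, hk]

theorem mul_cyclicX_apply_of_val_eq_add_one (Y : Matrix (Fin ℓ) (Fin ℓ) K) (i : Fin ℓ)
    {j k : Fin ℓ} (hj : j.val = k.val + 1) : (Y * cyclicX K ℓ a) i j = Y i k := by
  rw [Matrix.mul_apply, Finset.sum_eq_single_of_mem k (Finset.mem_univ _)]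
  · simp [cyclicX, hj]
  · intro k' _ hk
    have h₁ : j.val ≠ k'.val + 1 := fun h' => hk (Fin.ext (by lia))
    have h₂ : ¬ (k'.val + 1 = ℓ ∧ j.val = 0) := by lia
    simp [cyclicX, h₁, h₂]

section PowEqOne

variable {σ ℓ} [NeZero ℓ] (hσ : σ ^ ℓ = 1)

include hσ

theorem cyclicX_mul_cyclicMatrix (b : ℕ → K) :
    cyclicX K ℓ a * cyclicMatrix σ ℓ a b = cyclicMatrix σ ℓ a fun k =>
      if k = 0 then algebraMap F K a * σ (b (ℓ - 1)) else σ (b (k - 1)) := by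
  have hpow (i : ℕ) (c : K) : (σ ^ i) (σ c) = (σ ^ (i + 1)) c := by
    rw [pow_succ, AlgEquiv.mul_apply]
  ext i j
  rw [cyclicX_mul_apply]
  simp only [cyclicMatrix_apply]
  split_ifs <;> first | lia | simp only [map_mul, AlgEquiv.commutes, hpow]
  · rw [show j.val - (i.val + 1) = j.val - i.val - 1 by lia]
  · rw [show ℓ + j.val - (i.val + 1) = ℓ - 1 by lia]
  · rw [show ℓ + j.val - (i.val + 1) = ℓ + j.val - i.val - 1 by lia]
  · rw [show i.val + 1 = ℓ by lia, hσ, show ℓ - 1 = j.val by lia]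
    simp
  · rw [show i.val + 1 = ℓ by lia, hσ, show ℓ + j.val - i.val - 1 = j.val by lia]
    simp

theorem cyclicX_pow_eq_cyclicMatrix {k : ℕ} (hk : k < ℓ) :
    cyclicX K ℓ a ^ k = cyclicMatrix σ ℓ a (Pi.single k 1) := by
  induction k with
  | zero =>
    ext i j
    simp only [pow_zero, Matrix.one_apply, cyclicMatrix_apply, Fin.ext_iff, Pi.single_apply]
    split_ifs <;> first | lia | simp
  | succ k ih =>
    rw [pow_succ', ih (by lia), cyclicX_mul_cyclicMatrix a hσ]
    refine cyclicMatrix_congr σ ℓ a fun i hi => ?_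
    simp only [Pi.single_apply]
    split_ifs <;> first | lia | simp

theorem cyclicMatrix_eq_sum (b : ℕ → K) :
    cyclicMatrix σ ℓ a b = ∑ k ∈ Finset.range ℓ, cyclicDiag σ ℓ (b k) * cyclicX K ℓ a ^ k := by
  have hterm : ∀ k ∈ Finset.range ℓ, cyclicDiag σ ℓ (b k) * cyclicX K ℓ a ^ k =
      cyclicMatrix σ ℓ a (Pi.single k (b k)) := by
    intro k hk
    rw [cyclicX_pow_eq_cyclicMatrix a hσ (Finset.mem_range.1 hk), cyclicDiag_mul_cyclicMatrix]
    congr 1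
    ext i
    simp [Pi.single_apply]
  rw [Finset.sum_congr rfl hterm, ← map_sum]
  refine cyclicMatrix_congr σ ℓ a fun k hk => ?_
  simp [Finset.sum_apply, hk]

theorem toSubmodule_cyclicAlgebra :
    Subalgebra.toSubmodule (cyclicAlgebra σ ℓ a) = LinearMap.range (cyclicMatrix σ ℓ a) := by
  apply le_antisymm
  · rw [cyclicAlgebra, Algebra.adjoin_eq_span, Submodule.span_le]
    intro y hy
    induction hy using Submonoid.closure_induction_left with
    | one =>
      exact ⟨_, by rw [← cyclicX_pow_eq_cyclicMatrix a hσ (NeZero.pos ℓ), pow_zero]⟩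
    | mul_left x hx y _ ih =>
      obtain ⟨b, rfl⟩ := ih
      rcases hx with rfl | ⟨c, rfl⟩
      · exact ⟨_, (cyclicX_mul_cyclicMatrix a hσ b).symm⟩
      · exact ⟨_, (cyclicDiag_mul_cyclicMatrix σ ℓ a c b).symm⟩
  · rintro _ ⟨b, rfl⟩
    rw [cyclicMatrix_eq_sum a hσ]
    exact Subalgebra.sum_mem _ fun k _ => Subalgebra.mul_mem _ (cyclicAlgebra.ofK σ ℓ a _).2
      (Subalgebra.pow_mem _ (cyclicAlgebra.x σ ℓ a).2 _)

theorem exists_eq_cyclicMatrix (y : cyclicAlgebra σ ℓ a) :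
    ∃ b : ℕ → K, (y : Matrix (Fin ℓ) (Fin ℓ) K) = cyclicMatrix σ ℓ a b := by
  have hy : (y : Matrix (Fin ℓ) (Fin ℓ) K) ∈ LinearMap.range (cyclicMatrix σ ℓ a) :=
    toSubmodule_cyclicAlgebra a hσ ▸ y.2
  obtain ⟨b, hb⟩ := hy
  exact ⟨b, hb.symm⟩

theorem finrank_cyclicAlgebra [FiniteDimensional F K] :
    Module.finrank F (cyclicAlgebra σ ℓ a) = ℓ * Module.finrank F K := by
  let firstRow : cyclicAlgebra σ ℓ a →ₗ[F] Fin ℓ → K :=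
    { toFun y := (y : Matrix (Fin ℓ) (Fin ℓ) K) 0
      map_add' _ _ := rfl
      map_smul' _ _ := rfl }
  have hrow : Function.Bijective firstRow := by
    constructor
    · intro y y' h
      obtain ⟨b, hb⟩ := exists_eq_cyclicMatrix a hσ y
      obtain ⟨b', hb'⟩ := exists_eq_cyclicMatrix a hσ y'
      refine Subtype.ext ?_
      rw [hb, hb']
      refine cyclicMatrix_congr σ ℓ a fun k hk => ?_
      have hentry : (y : Matrix (Fin ℓ) (Fin ℓ) K) 0 ⟨k, hk⟩ =
        (y' : Matrix (Fin ℓ) (Fin ℓ) K) 0 ⟨k, hk⟩ := congrFun h ⟨k, hk⟩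
      simpa only [hb, hb', cyclicMatrix_zero_apply] using hentry
    · intro c
      let b : ℕ → K := fun k => if h : k < ℓ then c ⟨k, h⟩ else 0
      have hmem : cyclicMatrix σ ℓ a b ∈ Subalgebra.toSubmodule (cyclicAlgebra σ ℓ a) :=
        toSubmodule_cyclicAlgebra a hσ ▸ LinearMap.mem_range_self _ b
      exact ⟨⟨_, hmem⟩, funext fun j => (cyclicMatrix_zero_apply σ ℓ a b j).trans (by simp [b])⟩
  rw [(LinearEquiv.ofBijective firstRow hrow).finrank_eq, Module.finrank_pi_fintype]
  simp

end PowEqOne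

section Center

variable {σ ℓ a}

theorem eq_zero_of_commute_ofK [NeZero ℓ] (hσ : orderOf σ = ℓ) {y : cyclicAlgebra σ ℓ a}
    {b : ℕ → K} (hy : (y : Matrix (Fin ℓ) (Fin ℓ) K) = cyclicMatrix σ ℓ a b)
    (hcomm : ∀ c, Commute (cyclicAlgebra.ofK σ ℓ a c) y) {j : ℕ} (hj₀ : j ≠ 0) (hj : j < ℓ) :
    b j = 0 := by
  have hne : σ ^ j ≠ 1 := pow_ne_one_of_lt_orderOf hj₀ (hσ ▸ hj)
  obtain ⟨c, hc⟩ : ∃ c, (σ ^ j) c ≠ c := by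
    by_contra! h
    exact hne (AlgEquiv.ext h)
  have hentry : c * b j = b j * (σ ^ j) c := by
    have := congrArg (fun w : cyclicAlgebra σ ℓ a =>
      (w : Matrix (Fin ℓ) (Fin ℓ) K) 0 ⟨j, hj⟩) (hcomm c)
    simpa [hy, cyclicAlgebra.ofK, cyclicDiag, Matrix.diagonal_mul, Matrix.mul_diagonal,
      cyclicMatrix_zero_apply] using this
  have hzero : b j * ((σ ^ j) c - c) = 0 := by
    rw [mul_sub, ← hentry, mul_comm, sub_self]
  exact (mul_eq_zero.1 hzero).resolve_right (sub_ne_zero.2 hc)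

theorem map_eq_self_of_commute_x [NeZero ℓ] (hσ : σ ^ ℓ = 1) {y : cyclicAlgebra σ ℓ a}
    {b : ℕ → K} (hy : (y : Matrix (Fin ℓ) (Fin ℓ) K) = cyclicMatrix σ ℓ a b)
    (hcomm : Commute (cyclicAlgebra.x σ ℓ a) y) : σ (b 0) = b 0 := by
  rcases Nat.lt_or_ge 1 ℓ with hℓ | hℓ
  · have hentry := congrArg (fun w : cyclicAlgebra σ ℓ a =>
      (w : Matrix (Fin ℓ) (Fin ℓ) K) 0 ⟨1, hℓ⟩) hcomm
    simp only [MulMemClass.coe_mul, hy, cyclicAlgebra.x, cyclicX_mul_cyclicMatrix a hσ,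
      cyclicMatrix_zero_apply, one_ne_zero, if_false, Nat.sub_self] at hentry
    rw [hentry, mul_cyclicX_apply_of_val_eq_add_one (k := 0) ℓ a _ _ rfl, cyclicMatrix_zero_apply]
    rfl
  · rw [← pow_one σ, (NeZero.one_le (n := ℓ)).antisymm hℓ, hσ, AlgEquiv.one_apply]

theorem isCentral_cyclicAlgebra [IsGalois F K] [FiniteDimensional F K] (hσ : orderOf σ = ℓ)
    (hgen : ∀ τ : K ≃ₐ[F] K, τ ∈ Subgroup.zpowers σ) :
    Algebra.IsCentral F (cyclicAlgebra σ ℓ a) := by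
  have hσℓ : σ ^ ℓ = 1 := hσ ▸ pow_orderOf_eq_one σ
  have : NeZero ℓ := ⟨hσ ▸ (orderOf_pos σ).ne'⟩
  refine ⟨fun y hy => ?_⟩
  rw [Subalgebra.mem_center_iff] at hy
  obtain ⟨b, hb⟩ := exists_eq_cyclicMatrix a hσℓ y
  have hfix (τ : K ≃ₐ[F] K) : τ • b 0 = b 0 := by
    obtain ⟨k, rfl⟩ := Subgroup.mem_zpowers_iff.1 (hgen τ)
    exact smul_eq_self_of_mem_zpowers (Subgroup.zpow_mem_zpowers σ k)
      (map_eq_self_of_commute_x hσℓ hb (hy _))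
  obtain ⟨c, hc⟩ := IntermediateField.mem_bot.1 ((IsGalois.mem_bot_iff_fixed (b 0)).2 hfix)
  refine Algebra.mem_bot.2 ⟨c, Subtype.ext ?_⟩
  have hcoeff : ∀ k < ℓ, (Pi.single 0 (algebraMap F K c) : ℕ → K) k = b k := by
    rintro (_ | k) hk
    · simpa using hc
    · simp [eq_zero_of_commute_ofK hσ hb (fun _ => hy _) k.succ_ne_zero hk]
  rw [hb, ← cyclicMatrix_congr σ ℓ a hcoeff, cyclicMatrix_eq_sum a hσℓ,
    Finset.sum_eq_single_of_mem 0 (by simp [NeZero.pos ℓ]) (by simp +contextual [cyclicDiag])]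
  simp [cyclicDiag, Matrix.algebraMap_eq_diagonal, Pi.algebraMap_def]

end Center

end CyclicStructure

/-! ## Cyclic algebras without zero divisors -/

section Division

open WithZero

variable {F K : Type*} [Field F] [Field K] [Algebra F K] {σ : K ≃ₐ[F] K} {a : F} {ℓ : ℕ}
  [NeZero ℓ] {v : Valuation K ℤᵐ⁰}

theorem eq_of_pow_mul_exp_neg_eq {x y : ℤᵐ⁰} {i j : Fin ℓ} (hx : x ≠ 0)
    (h : x ^ ℓ * exp (-i.val : ℤ) = y ^ ℓ * exp (-j.val : ℤ)) : i = j := by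
  have hy : y ≠ 0 := by
    rintro rfl
    simp [zero_pow (NeZero.ne ℓ), hx] at h
  have hlog := congrArg log h
  rw [log_mul (pow_ne_zero _ hx) exp_ne_zero, log_mul (pow_ne_zero _ hy) exp_ne_zero, log_pow,
    log_pow, log_exp, log_exp] at hlog
  have hmod : (i.val : ℤ) % ℓ = j.val % ℓ := by
    rw [show (i.val : ℤ) = j.val + ℓ * (log x - log y) by
      simp only [nsmul_eq_mul] at hlog; linarith]
    simp
  norm_cast at hmod
  rwa [Nat.mod_eq_of_lt i.isLt, Nat.mod_eq_of_lt j.isLt, Fin.val_inj] at hmod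

theorem valuation_pow_eq (hσ : ∀ b, v (σ b) = v b) (i : ℕ) (b : K) : v ((σ ^ i) b) = v b := by
  induction i with
  | zero => rfl
  | succ i ih => rw [pow_succ', AlgEquiv.mul_apply, hσ, ih]

theorem valuation_cyclicMatrix_apply_pow (hσ : ∀ b, v (σ b) = v b)
    (ha : v (algebraMap F K a) = exp 1) (b : ℕ → K) (i j : Fin ℓ) :
    v (cyclicMatrix σ ℓ a b i j) ^ ℓ =
      v (b (j - i).val) ^ ℓ * exp ((j - i).val : ℤ) * exp (-j.val : ℤ) * exp (i.val : ℤ) := by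
  rw [cyclicMatrix_apply, mul_assoc, mul_assoc, ← exp_add, ← exp_add]
  split_ifs with hij
  · have hval : (j - i).val = j.val - i.val := Fin.sub_val_of_le hij
    rw [valuation_pow_eq hσ, hval, show ((j.val - i.val : ℕ) : ℤ) + (-j.val + i.val) = 0 by lia,
      exp_zero, mul_one]
  · have hval : (j - i).val = ℓ + j.val - i.val := Fin.coe_sub_iff_lt.2 (not_le.1 hij)
    rw [map_mul, valuation_pow_eq hσ, ha, hval, mul_pow, ← exp_nsmul, mul_comm,
      show ((ℓ + j.val - i.val : ℕ) : ℤ) + (-j.val + i.val) = ℓ • 1 by simp; lia]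

/-- The valuations of the terms `b k * x ^ k` lie in different classes modulo `ℓ`, so in some row
of the product a single term dominates. -/
theorem cyclicMatrix_mulVec_ne_zero (hσ : ∀ b, v (σ b) = v b)
    (ha : v (algebraMap F K a) = exp 1) {b : ℕ → K} {u : Fin ℓ → K}
    (hb : ∃ k : Fin ℓ, b k ≠ 0) (hu : u ≠ 0) : (cyclicMatrix σ ℓ a b).mulVec u ≠ 0 := by
  let μ : Fin ℓ → ℤᵐ⁰ := fun k => v (b k) ^ ℓ * exp (k.val : ℤ)
  let ν : Fin ℓ → ℤᵐ⁰ := fun j => v (u j) ^ ℓ * exp (-j.val : ℤ)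
  obtain ⟨k₀, hμ⟩ := Finite.exists_max μ
  obtain ⟨j₀, hν⟩ := Finite.exists_max ν
  have hμ₀ : 0 < μ k₀ := by
    obtain ⟨k, hk⟩ := hb
    exact lt_of_lt_of_le (by simp [μ, zero_lt_iff, hk]) (hμ k)
  have hν₀ : 0 < ν j₀ := by
    obtain ⟨j, hj⟩ := Function.ne_iff.1 hu
    exact lt_of_lt_of_le (by simpa [ν, zero_lt_iff, NeZero.ne ℓ] using hj) (hν j)
  have hlt : ∀ j ≠ j₀, ν j < ν j₀ := fun j hj => (hν j).lt_of_ne fun h =>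
    hj (eq_of_pow_mul_exp_neg_eq (fun h₀ => hν₀.ne' (h ▸ by simp [ν, h₀, NeZero.ne ℓ])) h)
  let i := j₀ - k₀
  have hterm (j : Fin ℓ) : v (cyclicMatrix σ ℓ a b i j * u j) ^ ℓ =
      μ (j - i) * ν j * exp (i.val : ℤ) := by
    rw [map_mul, mul_pow, valuation_cyclicMatrix_apply_pow hσ ha, mul_right_comm,
      mul_assoc (_ * _) (exp _) (_ ^ ℓ), mul_comm (exp _) (_ ^ ℓ)]
  have hdom : ∀ j ≠ j₀, v (cyclicMatrix σ ℓ a b i j * u j) <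
      v (cyclicMatrix σ ℓ a b i j₀ * u j₀) := by
    intro j hj
    refine lt_of_pow_lt_pow_left₀ ℓ zero_le ?_
    rw [hterm, hterm, sub_sub_cancel]
    exact mul_lt_mul_of_pos_right
      ((mul_le_mul_left (hμ _) _).trans_lt (mul_lt_mul_of_pos_left (hlt j hj) hμ₀)) exp_pos
  intro hzero
  classical
  have hrow : ∑ j, cyclicMatrix σ ℓ a b i j * u j = 0 := congrFun hzero i
  have hv := v.map_sum_eq_of_lt (Finset.mem_univ j₀) fun j hj => hdom j (by simpa using hj)
  have hpos : v (cyclicMatrix σ ℓ a b i j₀ * u j₀) ^ ℓ ≠ 0 := by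
    rw [hterm, sub_sub_cancel]
    exact mul_ne_zero (mul_ne_zero hμ₀.ne' hν₀.ne') exp_ne_zero
  rw [hrow, map_zero] at hv
  exact hpos (by rw [← hv, zero_pow (NeZero.ne ℓ)])

theorem isDomain_cyclicAlgebra (hσℓ : σ ^ ℓ = 1) (hσ : ∀ b, v (σ b) = v b)
    (ha : v (algebraMap F K a) = exp 1) : IsDomain (cyclicAlgebra σ ℓ a) := by
  have : NoZeroDivisors (cyclicAlgebra σ ℓ a) := by
    refine ⟨fun {y w} hyw => ?_⟩
    by_contra! ⟨hy, hw⟩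
    obtain ⟨b, hb⟩ := exists_eq_cyclicMatrix a hσℓ y
    have hb₀ : ∃ k : Fin ℓ, b k ≠ 0 := by
      by_contra! hzero
      refine hy (Subtype.ext ?_)
      rw [hb, cyclicMatrix_congr σ ℓ a (b' := 0) fun k hk => hzero ⟨k, hk⟩, map_zero]
      rfl
    obtain ⟨j, hj⟩ : ∃ j, (w : Matrix (Fin ℓ) (Fin ℓ) K).col j ≠ 0 := by
      by_contra! hzero
      exact hw (Subtype.ext (Matrix.ext fun i j => congrFun (hzero j) i))
    refine cyclicMatrix_mulVec_ne_zero hσ ha hb₀ hj (funext fun i => ?_)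
    exact hb ▸ congrArg (fun y : cyclicAlgebra σ ℓ a => (y : Matrix (Fin ℓ) (Fin ℓ) K) i j) hyw
  exact NoZeroDivisors.to_isDomain _

theorem isCyclicDivisionAlgebra_of_valuation [IsGalois F K] (hσ : orderOf σ = ℓ)
    (hK : Module.finrank F K = ℓ) (hgen : ∀ τ : K ≃ₐ[F] K, τ ∈ Subgroup.zpowers σ)
    (hvσ : ∀ b, v (σ b) = v b) (hva : v (algebraMap F K a) = exp 1) :
    IsCyclicDivisionAlgebra σ ℓ a := by
  have hσℓ : σ ^ ℓ = 1 := hσ ▸ pow_orderOf_eq_one σ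
  have hℓ : 0 < ℓ := NeZero.pos ℓ
  have : FiniteDimensional F K := Module.finite_of_finrank_pos (hK ▸ hℓ)
  have hD : Module.finrank F (cyclicAlgebra σ ℓ a) = ℓ ^ 2 := by
    rw [finrank_cyclicAlgebra a hσℓ, hK, pow_two]
  have : IsDomain (cyclicAlgebra σ ℓ a) := isDomain_cyclicAlgebra hσℓ hvσ hva
  have : FiniteDimensional F (cyclicAlgebra σ ℓ a) :=
    Module.finite_of_finrank_pos (hD ▸ pow_pos hℓ 2)
  exact
    { isGalois := inferInstance
      finrank_field := hK
      generates := hgen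
      isCentral := isCentral_cyclicAlgebra hσ hgen
      finrank_algebra := hD
      pos := hℓ
      isUnit_of_ne_zero := fun y hy =>
        .of_mul_eq_one _ (FiniteDimensional.exists_mul_eq_one F hy).choose_spec }

end Division

section GenericValuation

open WithZero Polynomial IntermediateField

variable {L K : Type*} [Field L] [Field K] [Algebra L K] {z : K}

theorem exists_valuation_eq_exp_one (hz : Transcendental L z) (htop : L⟮z⟯ = ⊤) :
    ∃ v : Valuation K ℤᵐ⁰, v.IsTrivialOn L ∧ v z = exp 1 := by
  classical
  let e : RatFunc L ≃ₐ[L] K := ((RatFunc.algEquivOfTranscendental z hz).trans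
    (IntermediateField.equivOfEq htop)).trans IntermediateField.topEquiv
  have he : e.symm z = RatFunc.X := by
    rw [AlgEquiv.symm_apply_eq]
    exact (RatFunc.algEquivOfTranscendental_X z hz).symm
  refine ⟨(RatFunc.inftyValuation L).comap (e.symm : K →+* RatFunc L), ⟨fun c hc => ?_⟩, ?_⟩
  · simpa using Valuation.IsTrivialOn.eq_one (v := RatFunc.inftyValuation L) c hc
  · simp [he]

theorem valuation_eq_of_isTrivialOn {Γ : Type*} [LinearOrderedCommGroupWithZero Γ]
    {v w : Valuation K Γ} [v.IsTrivialOn L] [w.IsTrivialOn L] (htop : L⟮z⟯ = ⊤) (hz : 1 < v z)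
    (hvw : v z = w z) : v = w := by
  have hpoly (p : L[X]) : v (aeval z p) = w (aeval z p) := by
    rcases eq_or_ne p 0 with rfl | hp
    · simp
    · rw [valuation_aeval_eq_valuation_X_pow_natDegree_of_one_lt_valuation_X z hz hp,
        valuation_aeval_eq_valuation_X_pow_natDegree_of_one_lt_valuation_X z (hvw ▸ hz) hp, hvw]
  ext b
  obtain ⟨p, q, rfl⟩ := (mem_adjoin_simple_iff L b).1 (htop ▸ mem_top : b ∈ L⟮z⟯)
  rw [map_div₀, map_div₀, hpoly, hpoly]

end GenericValuation

/-! ## The cyclotomic extension of `ℚ(z)` of order `3 ^ (h + 1)` -/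

section Cyclotomic

open Polynomial IntermediateField WithZero

theorem irreducible_cyclotomic_ratZ {m : ℕ} (hm : 0 < m) : Irreducible (cyclotomic m RatZ) := by
  have hpoly : Irreducible (cyclotomic m ℚ[X]) := by
    refine (cyclotomic.monic m ℚ[X]).irreducible_of_irreducible_map (evalRingHom (0 : ℚ)) _ ?_
    rw [map_cyclotomic]
    exact cyclotomic.irreducible_rat hm
  rwa [(cyclotomic.monic m ℚ[X]).irreducible_iff_irreducible_map_fraction_map (K := RatZ),
    map_cyclotomic] at hpoly

theorem orderOf_two_zmod_three_pow (h : ℕ) : orderOf (2 : ZMod (3 ^ (h + 1))) = 2 * 3 ^ h := by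
  have hsq : orderOf ((2 : ZMod (3 ^ (h + 1))) ^ 2) = 3 ^ h := by
    rw [← ZMod.orderOf_one_add_prime Nat.prime_three (by norm_num) h]
    norm_num
  have hne : (2 : ZMod (3 ^ (h + 1))) ^ 3 ^ h ≠ 1 := by
    intro hone
    have hmod := congrArg (ZMod.castHom (dvd_pow_self 3 (Nat.succ_ne_zero h)) (ZMod 3)) hone
    rw [map_pow, map_ofNat, map_one, show (2 : ZMod 3) = -1 by decide,
      Odd.neg_one_pow (Odd.pow (by decide))] at hmod
    exact absurd hmod (by decide)
  have hdvd : orderOf (2 : ZMod (3 ^ (h + 1))) ∣ 3 ^ h * 2 := by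
    rw [orderOf_dvd_iff_pow_eq_one, mul_comm, pow_mul, ← hsq, pow_orderOf_eq_one]
  obtain ⟨c, hc⟩ : 3 ^ h ∣ orderOf (2 : ZMod (3 ^ (h + 1))) := hsq ▸ orderOf_pow_dvd 2
  rw [hc] at hdvd
  rcases (Nat.dvd_prime Nat.prime_two).1 (Nat.dvd_of_mul_dvd_mul_left (by positivity) hdvd) with
    rfl | rfl
  · rw [mul_one] at hc
    exact absurd (hc ▸ pow_orderOf_eq_one (2 : ZMod (3 ^ (h + 1)))) hne
  · rw [hc, mul_comm]

theorem finrank_ratZOmega (h : ℕ) : Module.finrank RatZ (RatZOmega (3 ^ (h + 1))) = 2 * 3 ^ h := by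
  rw [IsCyclotomicExtension.finrank (n := 3 ^ (h + 1)) (RatZOmega (3 ^ (h + 1)))
    (irreducible_cyclotomic_ratZ (by positivity)), Nat.totient_prime_pow_succ Nat.prime_three,
    mul_comm]

/-- The primitive root of unity `ω` of order `3 ^ (h + 1)` that generates `ℚ(ω, z)`. -/
noncomputable def omega (h : ℕ) : RatZOmega (3 ^ (h + 1)) :=
  IsCyclotomicExtension.zeta (3 ^ (h + 1)) RatZ (RatZOmega (3 ^ (h + 1)))

theorem isPrimitiveRoot_omega (h : ℕ) : IsPrimitiveRoot (omega h) (3 ^ (h + 1)) :=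
  IsCyclotomicExtension.zeta_spec (3 ^ (h + 1)) RatZ (RatZOmega (3 ^ (h + 1)))

theorem isPrimitiveRoot_omega_sq (h : ℕ) : IsPrimitiveRoot (omega h ^ 2) (3 ^ (h + 1)) :=
  (isPrimitiveRoot_omega h).pow_of_coprime 2 (Nat.Coprime.pow_right _ (by decide))

/-- The automorphism `σ` of `ℚ(ω, z)` over `ℚ(z)` with `σ ω = ω ^ 2`. It generates the Galois group
because `2` is a primitive root modulo `3 ^ (h + 1)`. -/
noncomputable def sigma (h : ℕ) : RatZOmega (3 ^ (h + 1)) ≃ₐ[RatZ] RatZOmega (3 ^ (h + 1)) :=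
  IsCyclotomicExtension.fromZetaAut (isPrimitiveRoot_omega_sq h)
    (irreducible_cyclotomic_ratZ (by positivity))

theorem sigma_omega (h : ℕ) : sigma h (omega h) = omega h ^ 2 :=
  IsCyclotomicExtension.fromZetaAut_spec _ _

theorem sigma_pow_omega (h j : ℕ) : (sigma h ^ j) (omega h) = omega h ^ 2 ^ j := by
  induction j with
  | zero => simp
  | succ j ih =>
    rw [pow_succ' (sigma h), AlgEquiv.mul_apply, ih, map_pow, sigma_omega, ← pow_mul,
      ← pow_succ' 2]

theorem pow_eq_pow_iff_modEq_of_isPrimitiveRoot {M : Type*} [CommMonoid M] {ζ : M} {m : ℕ}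
    (hζ : IsPrimitiveRoot ζ m) (hm : m ≠ 0) {i j : ℕ} : ζ ^ i = ζ ^ j ↔ i ≡ j [MOD m] := by
  obtain ⟨u, rfl⟩ := hζ.isUnit hm
  rw [hζ.eq_orderOf, orderOf_units, ← pow_eq_pow_iff_modEq]
  norm_cast

theorem orderOf_sigma (h : ℕ) : orderOf (sigma h) = 2 * 3 ^ h := by
  rw [← orderOf_two_zmod_three_pow]
  refine orderOf_eq_orderOf_iff.2 fun j => ?_
  have hω := isPrimitiveRoot_omega h
  calc sigma h ^ j = 1 ↔ omega h ^ 2 ^ j = omega h ^ 1 := by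
        rw [← sigma_pow_omega, pow_one]
        refine ⟨fun hone => by rw [hone, AlgEquiv.one_apply], fun hfix => ?_⟩
        exact AlgEquiv.coe_toAlgHom_injective ((hω.powerBasis RatZ).algHom_ext
          (by simpa [-AlgEquiv.coe_pow] using hfix))
    _ ↔ 2 ^ j ≡ 1 [MOD 3 ^ (h + 1)] :=
        pow_eq_pow_iff_modEq_of_isPrimitiveRoot hω (by positivity)
    _ ↔ (2 : ZMod (3 ^ (h + 1))) ^ j = 1 := by
        rw [← ZMod.natCast_eq_natCast_iff]
        push_cast
        rfl

theorem mem_zpowers_sigma (h : ℕ) (τ : RatZOmega (3 ^ (h + 1)) ≃ₐ[RatZ] RatZOmega (3 ^ (h + 1))) :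
    τ ∈ Subgroup.zpowers (sigma h) := by
  have := IsCyclotomicExtension.isGalois {3 ^ (h + 1)} RatZ (RatZOmega (3 ^ (h + 1)))
  have : FiniteDimensional RatZ (RatZOmega (3 ^ (h + 1))) :=
    IsCyclotomicExtension.finiteDimensional {3 ^ (h + 1)} _ _
  have hcard : Nat.card (Subgroup.zpowers (sigma h)) =
      Nat.card (RatZOmega (3 ^ (h + 1)) ≃ₐ[RatZ] RatZOmega (3 ^ (h + 1))) := by
    rw [Nat.card_zpowers, orderOf_sigma, IsGalois.card_aut_eq_finrank, finrank_ratZOmega]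
  exact Subgroup.eq_top_of_card_eq _ hcard ▸ Subgroup.mem_top τ

/-- The indeterminate `z` as an element of `ℚ(ω, z)`. -/
noncomputable def zElem (h : ℕ) : RatZOmega (3 ^ (h + 1)) := algebraMap RatZ _ RatFunc.X

theorem transcendental_zElem (h : ℕ) : Transcendental ℚ (zElem h) := by
  rw [zElem, transcendental_algebraMap_iff (R := ℚ) (S := RatZ) (A := RatZOmega (3 ^ (h + 1)))
    (algebraMap RatZ (RatZOmega (3 ^ (h + 1)))).injective]
  convert! RatFunc.transcendental_X (K := ℚ)
  exact Subsingleton.elim _ _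

/-- The field of constants of `ℚ(ω, z)`, over which it is the field of rational functions
in `z`. -/
noncomputable abbrev constants (h : ℕ) : IntermediateField ℚ (RatZOmega (3 ^ (h + 1))) :=
  algebraicClosure ℚ (RatZOmega (3 ^ (h + 1)))

theorem adjoin_zElem_eq_top (h : ℕ) : (constants h)⟮zElem h⟯ = ⊤ := by
  refine eq_top_iff.2 fun b _ => ?_
  have hb : b ∈ Algebra.adjoin RatZ {omega h} := by
    rw [IsCyclotomicExtension.adjoin_primitive_root_eq_top (isPrimitiveRoot_omega h)]
    exact Algebra.mem_top
  induction hb using Algebra.adjoin_induction with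
  | mem x hx =>
    rw [Set.mem_singleton_iff.1 hx]
    have halg : IsAlgebraic ℚ (omega h) :=
      .of_pow (by positivity) ((isPrimitiveRoot_omega h).pow_eq_one ▸ isAlgebraic_one)
    exact _root_.algebraMap_mem _ (⟨omega h, mem_algebraicClosure_iff.2 halg⟩ : constants h)
  | algebraMap r =>
    refine (mem_adjoin_simple_iff _ _).2
      ⟨r.num.map (algebraMap ℚ _), r.denom.map (algebraMap ℚ _), ?_⟩
    rw [aeval_map_algebraMap, aeval_map_algebraMap, zElem, ← RatFunc.algebraMap_X]
    simp only [aeval_algebraMap_apply, aeval_X_left_apply]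
    rw [← map_div₀, RatFunc.num_div_denom]
  | add x y _ _ hx hy => exact add_mem (hx trivial) (hy trivial)
  | mul x y _ _ hx hy => exact mul_mem (hx trivial) (hy trivial)

theorem exists_valuation_sigma (h : ℕ) : ∃ v : Valuation (RatZOmega (3 ^ (h + 1))) ℤᵐ⁰,
    v (zElem h) = exp 1 ∧ ∀ b, v (sigma h b) = v b := by
  obtain ⟨v, hv, hz⟩ := exists_valuation_eq_exp_one (transcendental_zElem h).algebraicClosure
    (adjoin_zElem_eq_top h)
  let σ : RatZOmega (3 ^ (h + 1)) →+* RatZOmega (3 ^ (h + 1)) := sigma h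
  have hσz : σ (zElem h) = zElem h := (sigma h).commutes _
  have hσv : (v.comap σ).IsTrivialOn (constants h) := by
    refine ⟨fun c hc => ?_⟩
    have halg : IsAlgebraic ℚ (σ c) := (mem_algebraicClosure_iff.1 c.2).algHom σ.toRatAlgHom
    refine hv.eq_one ⟨σ c, mem_algebraicClosure_iff.2 halg⟩ fun hzero => hc ?_
    exact Subtype.ext ((map_eq_zero σ).1 (congrArg Subtype.val hzero))
  have hvσ : v.comap σ = v := valuation_eq_of_isTrivialOn (adjoin_zElem_eq_top h)
    (by simpa [hσz, hz] using exp_lt_exp.2 (zero_lt_one (α := ℤ))) (by simp [hσz])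
  exact ⟨v, hz, fun b => congrArg (· b) hvσ⟩

theorem isCyclicDivisionAlgebra_sigma (h : ℕ) :
    IsCyclicDivisionAlgebra (sigma h) (2 * 3 ^ h) (RatFunc.X : RatZ) := by
  have := IsCyclotomicExtension.isGalois {3 ^ (h + 1)} RatZ (RatZOmega (3 ^ (h + 1)))
  have : NeZero (2 * 3 ^ h) := ⟨by positivity⟩
  obtain ⟨v, hz, hvσ⟩ := exists_valuation_sigma h
  exact isCyclicDivisionAlgebra_of_valuation (orderOf_sigma h) (finrank_ratZOmega h)
    (mem_zpowers_sigma h) hvσ hz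

end Cyclotomic

/-! ## Coefficients of noncommutative polynomials -/

section Words

variable {R X : Type*} [CommSemiring R]

/-- The coefficients of a noncommutative polynomial, indexed by the words. -/
noncomputable def wordCoeff : FreeAlgebra R X ≃ₗ[R] (FreeMonoid X →₀ R) :=
  FreeAlgebra.equivMonoidAlgebraFreeMonoid.toLinearEquiv.trans (MonoidAlgebra.coeffLinearEquiv R)

theorem wordCoeff_apply (f : FreeAlgebra R X) (w : FreeMonoid X) :
    wordCoeff f w = (FreeAlgebra.equivMonoidAlgebraFreeMonoid f).coeff w := rfl

theorem wordCoeff_one : wordCoeff (1 : FreeAlgebra R X) = Finsupp.single 1 1 := by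
  ext w
  rw [wordCoeff_apply, map_one, MonoidAlgebra.one_def, MonoidAlgebra.coeff_single]

open Classical in
theorem wordCoeff_ι_mul_of_mul (i j : X) (f : FreeAlgebra R X) (w : FreeMonoid X) :
    wordCoeff (FreeAlgebra.ι R i * f) (FreeMonoid.of j * w) =
      if i = j then wordCoeff f w else 0 := by
  have hι : FreeAlgebra.equivMonoidAlgebraFreeMonoid (FreeAlgebra.ι R i) =
      MonoidAlgebra.single (FreeMonoid.of i) 1 := by
    simp [FreeAlgebra.equivMonoidAlgebraFreeMonoid]
  have hcons (u : FreeMonoid X) : FreeMonoid.of i * u = FreeMonoid.of j * w ↔ i = j ∧ u = w :=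
    List.cons_eq_cons
  rw [wordCoeff_apply, map_mul FreeAlgebra.equivMonoidAlgebraFreeMonoid, hι]
  split_ifs with hij
  · rw [MonoidAlgebra.coeff_single_mul_eq_mul_coeff w fun u _ => by simp [hij], one_mul,
      wordCoeff_apply]
  · exact MonoidAlgebra.coeff_single_mul_of_forall_mul_ne _ _ fun u h => hij ((hcons u).1 h).1

theorem lift_eq_sum_wordCoeff {A : Type*} [Semiring A] [Algebra R A] (q : X → A)
    (f : FreeAlgebra R X) :
    FreeAlgebra.lift R q f =
      ∑ w ∈ (wordCoeff f).support, wordCoeff f w • FreeMonoid.lift q w := by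
  have hlift : FreeAlgebra.lift R q = (MonoidAlgebra.lift R A (FreeMonoid X)
      (FreeMonoid.lift q)).comp (FreeAlgebra.equivMonoidAlgebraFreeMonoid (R := R)).toAlgHom := by
    ext i
    simp [FreeAlgebra.equivMonoidAlgebraFreeMonoid]
  rw [hlift, AlgHom.comp_apply, MonoidAlgebra.lift_apply]
  rfl

/-- The derivative by a letter: it strips the letter from the words starting with it and kills all
other words. -/
noncomputable def leftDeriv (i : X) : FreeAlgebra R X →ₗ[R] FreeAlgebra R X :=
  wordCoeff.symm.toLinearMap ∘ₗ
    Finsupp.lcomapDomain (FreeMonoid.of i * ·) (mul_right_injective _) ∘ₗ wordCoeff.toLinearMap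

theorem wordCoeff_leftDeriv (i : X) (f : FreeAlgebra R X) (w : FreeMonoid X) :
    wordCoeff (leftDeriv i f) w = wordCoeff f (FreeMonoid.of i * w) := by
  simp [leftDeriv]

open Classical in
theorem leftDeriv_ι_mul (i j : X) (f : FreeAlgebra R X) :
    leftDeriv j (FreeAlgebra.ι R i * f) = if i = j then f else 0 := by
  refine wordCoeff.injective (Finsupp.ext fun w => ?_)
  rw [wordCoeff_leftDeriv, wordCoeff_ι_mul_of_mul]
  split_ifs <;> simp

theorem leftDeriv_toPoly_mul {n : ℕ} (L : AffineForm n) (f : FreeAlgebra ℚ (Fin n)) (i : Fin n) :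
    leftDeriv i (L.toPoly * f) = L.const • leftDeriv i f + L.coeff i • f := by
  rw [AffineForm.toPoly, add_mul, ← Algebra.smul_def, Finset.sum_mul]
  simp [leftDeriv_ι_mul]

variable {k : Type*} [Field k]

theorem exists_wordCoeff_eq_apply_lift {S : Submodule k (FreeAlgebra k X)}
    (hS : ∀ i, ∀ g ∈ S, leftDeriv i g ∈ S) {f : FreeAlgebra k X} (hf : f ∈ S) :
    ∃ (τ : X → (Module.End k S)ᵐᵒᵖ) (φ : (Module.End k S)ᵐᵒᵖ →ₗ[k] k),
      ∀ w, wordCoeff f w = φ (FreeMonoid.lift τ w) := by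
  let τ (i : X) : (Module.End k S)ᵐᵒᵖ := .op ((leftDeriv i).restrict (hS i))
  let constCoeff : S →ₗ[k] k := Finsupp.lapply 1 ∘ₗ wordCoeff.toLinearMap ∘ₗ S.subtype
  refine ⟨τ, constCoeff ∘ₗ LinearMap.applyₗ ⟨f, hf⟩ ∘ₗ
    (MulOpposite.opLinearEquiv k).symm.toLinearMap, fun w => ?_⟩
  suffices ∀ g : S, wordCoeff (g : FreeAlgebra k X) w =
      constCoeff ((FreeMonoid.lift τ w).unop g) from this ⟨f, hf⟩
  induction w using FreeMonoid.inductionOn' with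
  | one => simp [constCoeff]
  | of_mul i w ih =>
    intro g
    rw [← wordCoeff_leftDeriv, map_mul, FreeMonoid.lift_eval_of, MulOpposite.unop_mul,
      Module.End.mul_apply]
    exact ih ⟨leftDeriv i g, hS i g g.2⟩

end Words

/-! ## Derivatives of branching programs -/

namespace ABP

variable {n d : ℕ}

/-- The same program with another source. -/
def withSource (B : ABP n d) (v : Fin (B.card 0)) : ABP n d := { B with source := v }

/-- The program without its first layer, started at a vertex of the second layer. -/
def tail (B : ABP n (d + 1)) (v : Fin (B.card (Fin.succ 0))) : ABP n d where
  card i := B.card i.succ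
  source := v
  sink := B.sink
  label i := B.label i.succ

open Classical in
theorem poly_eq_sum_first_edge (B : ABP n (d + 1)) :
    B.poly = ∑ p : (∀ i : Fin (d + 1), Fin (B.card i.succ)) with p (Fin.last d) = B.sink,
      (B.label 0 B.source (p 0)).toPoly * (List.ofFn fun i : Fin d =>
        (B.label i.succ (p i.castSucc) (p i.succ)).toPoly).prod := by
  have hsource {p : ∀ i, Fin (B.card i)} (hp : p ∈ ({p | B.IsPath p} : Finset _)) :
      p 0 = B.source :=
    (Finset.mem_filter.1 hp).2.1
  refine Finset.sum_nbij' (fun p i => p i.succ)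
    (fun p => Fin.cons (α := fun i => Fin (B.card i)) B.source p) ?_ ?_ ?_ (fun p _ => rfl) ?_
  · intro p hp
    simpa using (Finset.mem_filter.1 hp).2.2
  · intro p hp
    exact Finset.mem_filter.2 ⟨Finset.mem_univ _, rfl, (Finset.mem_filter.1 hp).2⟩
  · intro p hp
    funext i
    refine Fin.cases (hsource hp).symm (fun i => rfl) i
  · intro p hp
    rw [List.ofFn_succ, List.prod_cons, ← hsource hp]
    rfl

theorem poly_succ (B : ABP n (d + 1)) :
    B.poly = ∑ v : Fin (B.card (Fin.succ 0)), (B.label 0 B.source v).toPoly * (B.tail v).poly := by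
  classical
  rw [poly_eq_sum_first_edge, ← Finset.sum_fiberwise _ (fun p => p 0)]
  refine Finset.sum_congr rfl fun v _ => ?_
  have hpath (p : ∀ i, Fin ((B.tail v).card i)) :
      p ∈ ({p | (B.tail v).IsPath p} : Finset _) ↔ p 0 = v ∧ p (Fin.last d) = B.sink :=
    Finset.mem_filter.trans (and_iff_right (Finset.mem_univ _))
  rw [poly, Finset.mul_sum, Finset.filter_filter]
  refine Finset.sum_congr (Finset.ext fun p => ?_) fun p hp => ?_
  · exact (Finset.mem_filter.trans (and_iff_right (Finset.mem_univ _))).trans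
      (and_comm.trans (hpath p).symm)
  · obtain ⟨rfl, -⟩ := (hpath p).1 hp
    rfl

theorem exists_poly_eq_smul_one (B : ABP n 0) : ∃ c : ℚ, B.poly = c • 1 := by
  simp only [poly, List.ofFn_zero, List.prod_nil, Finset.sum_const]
  exact ⟨_, (Nat.cast_smul_eq_nsmul ℚ _ _).symm⟩

theorem leftDeriv_poly_eq_zero (B : ABP n 0) (i : Fin n) : leftDeriv i B.poly = 0 := by
  obtain ⟨c, hc⟩ := B.exists_poly_eq_smul_one
  refine wordCoeff.injective (Finsupp.ext fun w => ?_)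
  rw [wordCoeff_leftDeriv, hc, map_smul, wordCoeff_one]
  simp

theorem leftDeriv_poly_succ (B : ABP n (d + 1)) (i : Fin n) :
    leftDeriv i B.poly = ∑ v, ((B.label 0 B.source v).const • leftDeriv i (B.tail v).poly +
      (B.label 0 B.source v).coeff i • (B.tail v).poly) := by
  simp only [poly_succ, map_sum, leftDeriv_toPoly_mul]

theorem length_le_of_wordCoeff_poly_ne_zero (B : ABP n d) {w : FreeMonoid (Fin n)}
    (hw : wordCoeff B.poly w ≠ 0) : w.length ≤ d := by
  contrapose! hw
  induction d generalizing w with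
  | zero =>
    cases w using FreeMonoid.casesOn with
    | one => simp at hw
    | of_mul i w =>
      rw [← wordCoeff_leftDeriv, B.leftDeriv_poly_eq_zero, map_zero, Finsupp.zero_apply]
  | succ d ih =>
    cases w using FreeMonoid.casesOn with
    | one => simp at hw
    | of_mul i w =>
      rw [FreeMonoid.length_mul, FreeMonoid.length_of] at hw
      rw [← wordCoeff_leftDeriv, leftDeriv_poly_succ, map_sum, Finsupp.finsetSum_apply]
      refine Finset.sum_eq_zero fun v _ => ?_
      have hw' : wordCoeff (leftDeriv i (B.tail v).poly) w = 0 := by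
        rw [wordCoeff_leftDeriv]
        exact ih _ (by rw [FreeMonoid.length_mul, FreeMonoid.length_of]; lia)
      simp [hw', ih (B.tail v) (w := w) (by lia)]

/-- Stripping a letter moves the source to the next layer, so the polynomials computed from all the
vertices together span a stable subspace. -/
theorem exists_stable_submodule (B : ABP n d) : ∃ S : Submodule ℚ (FreeAlgebra ℚ (Fin n)),
    FiniteDimensional ℚ S ∧ Module.finrank ℚ S ≤ ∑ i, B.card i ∧
    (∀ i, ∀ g ∈ S, leftDeriv i g ∈ S) ∧ ∀ v, (B.withSource v).poly ∈ S := by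
  let first {d} (B : ABP n d) := Submodule.span ℚ (Set.range fun v => (B.withSource v).poly)
  have hfin {d} (B : ABP n d) : FiniteDimensional ℚ (first B) :=
    FiniteDimensional.span_of_finite ℚ (Set.finite_range _)
  have hrank {d} (B : ABP n d) : Module.finrank ℚ (first B) ≤ B.card 0 :=
    (finrank_range_le_card _).trans (Fintype.card_fin _).le
  have hmem {d} (B : ABP n d) (v) : (B.withSource v).poly ∈ first B :=
    Submodule.subset_span ⟨v, rfl⟩
  induction d with
  | zero =>
    refine ⟨first B, hfin B, by simpa using hrank B, fun i => ?_, hmem B⟩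
    refine Submodule.span_le (p := (first B).comap (leftDeriv i)).2 ?_
    rintro _ ⟨v, rfl⟩
    simp [leftDeriv_poly_eq_zero]
  | succ d ih =>
    rcases isEmpty_or_nonempty (Fin (B.card (Fin.succ 0))) with hempty | ⟨⟨v₀⟩⟩
    · refine ⟨⊥, inferInstance, by simp, by simp, fun v => ?_⟩
      rw [poly_succ, Submodule.mem_bot]
      exact Finset.sum_eq_zero fun u _ => hempty.elim u
    · obtain ⟨S, hSfin, hSrank, hSder, hSmem⟩ := ih (B.tail v₀)
      refine ⟨first B ⊔ S, Submodule.finiteDimensional_sup _ S, ?_, fun i => ?_,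
        fun v => Submodule.mem_sup_left (hmem B v)⟩
      · rw [Fin.sum_univ_succ]
        exact (Submodule.finrank_add_le_finrank_add_finrank _ S).trans
          (Nat.add_le_add (hrank B) hSrank)
      · have hder : first B ⊔ S ≤ S.comap (leftDeriv i) := by
          refine sup_le (Submodule.span_le.2 ?_) fun g hg => hSder i g hg
          rintro _ ⟨v, rfl⟩
          rw [SetLike.mem_coe, Submodule.mem_comap, leftDeriv_poly_succ]
          exact Submodule.sum_mem _ fun u _ => Submodule.add_mem _
            (Submodule.smul_mem _ _ (hSder i _ (hSmem u))) (Submodule.smul_mem _ _ (hSmem u))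
        exact fun g hg => Submodule.mem_sup_right (hder hg)

end ABP

theorem exists_wordCoeff_eq_apply_lift_of_mem_abpClass {n r d : ℕ} {f : FreeAlgebra ℚ (Fin n)}
    (hf : f ∈ abpClass n r d) :
    ∃ (A : Type) (_ : Ring A) (_ : Algebra ℚ A) (_ : Module.Finite ℚ A)
      (τ : Fin n → A) (φ : A →ₗ[ℚ] ℚ), Module.finrank ℚ A ≤ (r * (d + 1)) ^ 2 ∧
      ∀ w, wordCoeff f w = φ (FreeMonoid.lift τ w) := by
  obtain ⟨B, hB, rfl⟩ := hf
  obtain ⟨S, hfin, hrank, hder, hmem⟩ := B.exists_stable_submodule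
  obtain ⟨τ, φ, hφ⟩ := exists_wordCoeff_eq_apply_lift hder (hmem B.source)
  have hEnd : Module.Finite ℚ (Module.End ℚ S) := Module.Finite.linearMap ℚ ℚ S S
  refine ⟨(Module.End ℚ S)ᵐᵒᵖ, inferInstance, inferInstance,
    Module.Finite.equiv (MulOpposite.opLinearEquiv ℚ), τ, φ, ?_, hφ⟩
  have hvertices : ∑ i, B.card i ≤ r * (d + 1) := by
    refine (Finset.sum_le_card_nsmul _ _ r fun i _ =>
      (Finset.le_sup (Finset.mem_univ i)).trans hB).trans_eq ?_
    simp [mul_comm]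
  rw [← (MulOpposite.opLinearEquiv ℚ).finrank_eq, Module.finrank_linearMap, sq]
  exact Nat.mul_le_mul (hrank.trans hvertices) (hrank.trans hvertices)

/-! ## Words with positions -/

section PosWord

variable {α : Type*}

/-- The word whose letters carry their positions, counted from `s`. -/
def posWord (s : ℕ) (w : FreeMonoid α) : FreeMonoid (ℕ × α) :=
  FreeMonoid.ofList ((w.toList.zipIdx s).map Prod.swap)

theorem posWord_one (s : ℕ) : posWord s (1 : FreeMonoid α) = 1 := rfl

theorem posWord_of (s : ℕ) (i : α) : posWord s (FreeMonoid.of i) = FreeMonoid.of (s, i) := rfl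

theorem posWord_mul (s : ℕ) (w w' : FreeMonoid α) :
    posWord s (w * w') = posWord s w * posWord (s + w.length) w' := by
  simp only [posWord, FreeMonoid.toList_mul, List.zipIdx_append, List.map_append,
    FreeMonoid.ofList_append]
  rfl

theorem length_posWord (s : ℕ) (w : FreeMonoid α) : (posWord s w).length = w.length := by
  simp [posWord, FreeMonoid.length]

theorem map_snd_posWord (s : ℕ) (w : FreeMonoid α) :
    FreeMonoid.map Prod.snd (posWord s w) = w := by
  apply FreeMonoid.toList.injective
  simp [posWord, FreeMonoid.toList_map, Function.comp_def]

theorem posWord_injective (s : ℕ) : Function.Injective (posWord s : FreeMonoid α → _) :=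
  Function.LeftInverse.injective (map_snd_posWord s)

theorem fst_lt_of_mem_posWord {w : FreeMonoid α} {x : ℕ × α} (hx : x ∈ posWord 0 w) :
    x.1 < w.length := by
  obtain ⟨⟨i, k⟩, hy, rfl⟩ := List.mem_map.1 hx
  exact (List.snd_lt_of_mem_zipIdx hy).trans_eq (add_zero _)

theorem lift_mul_eq_lift_posWord_mul_pow {F K A : Type*} [CommSemiring F] [Semiring K] [Algebra F K]
    [Monoid A] (σ : K ≃ₐ[F] K) (ι : K →* A) (x : A) (hx : ∀ c, x * ι c = ι (σ c) * x) (b : α → K)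
    (w : FreeMonoid α) : FreeMonoid.lift (fun i => ι (b i) * x) w =
      ι (FreeMonoid.lift (fun y => (σ ^ y.1) (b y.2)) (posWord 0 w)) * x ^ w.length := by
  have hpow (s : ℕ) (c : K) : x ^ s * ι c = ι ((σ ^ s) c) * x ^ s := by
    induction s generalizing c with
    | zero => simp
    | succ s ih => rw [pow_succ, mul_assoc, hx, ← mul_assoc, ih, mul_assoc, pow_succ σ]; rfl
  suffices ∀ s, x ^ s * FreeMonoid.lift (fun i => ι (b i) * x) w =
      ι (FreeMonoid.lift (fun y => (σ ^ y.1) (b y.2)) (posWord s w)) * x ^ (s + w.length) by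
    simpa using this 0
  induction w using FreeMonoid.inductionOn' with
  | one => simp [posWord_one]
  | of_mul i w ih =>
    intro s
    rw [map_mul, FreeMonoid.lift_eval_of, posWord_mul, posWord_of, map_mul, FreeMonoid.lift_eval_of,
      map_mul, FreeMonoid.length_mul, FreeMonoid.length_of, ← add_assoc, mul_assoc _ (ι _), ← ih,
      ← mul_assoc, ← mul_assoc, hpow, pow_succ]
    simp only [mul_assoc]

theorem lift_mul_pow_eq {R : Type*} [CommSemiring R] (c y : R) (wt : α → ℕ) (u : FreeMonoid α) :
    FreeMonoid.lift (fun x => c * y ^ wt x) u = c ^ u.length * y ^ letterSum wt u := by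
  induction u using FreeMonoid.inductionOn' with
  | one => simp [letterSum_one]
  | of_mul i u ih =>
    rw [map_mul, FreeMonoid.lift_eval_of, ih, letterSum_mul, letterSum_of, FreeMonoid.length_mul,
      FreeMonoid.length_of]
    ring

theorem lift_congr_of_forall_mem {M : Type*} [Monoid M] {f g : α → M} {u : FreeMonoid α}
    (h : ∀ x ∈ u, f x = g x) : FreeMonoid.lift f u = FreeMonoid.lift g u := by
  rw [FreeMonoid.lift_apply, FreeMonoid.lift_apply]
  exact congrArg List.prod (List.map_congr_left h)

theorem map_lift {M N G : Type*} [Monoid M] [Monoid N] [FunLike G M N] [MonoidHomClass G M N]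
    (g : G) (f : α → M) (u : FreeMonoid α) :
    g (FreeMonoid.lift f u) = FreeMonoid.lift (fun x => g (f x)) u :=
  FreeMonoid.hom_map_lift (g : M →* N) f u

end PosWord

section PosWordBlock

open scoped Pointwise

variable {n : ℕ}

theorem exists_eq_mul_of_length_eq_add {α : Type*} {w : FreeMonoid α} {a b : ℕ}
    (hw : w.length = a + b) : ∃ u v : FreeMonoid α, u.length = a ∧ v.length = b ∧ w = u * v :=
  ⟨.ofList (w.toList.take a), .ofList (w.toList.drop a),
    List.length_take_of_le (le_of_le_of_eq (Nat.le_add_right a b) hw.symm),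
    (List.length_drop ..).trans (Nat.sub_eq_of_eq_add' hw), (List.take_append_drop ..).symm⟩

theorem posWord_image_mul (α : Type*) (s a b : ℕ) :
    posWord s '' {w : FreeMonoid α | w.length = a} *
      posWord (s + a) '' {w : FreeMonoid α | w.length = b} =
    posWord s '' {w : FreeMonoid α | w.length = a + b} := by
  ext u
  constructor
  · rintro ⟨_, ⟨w, rfl, rfl⟩, _, ⟨w', rfl, rfl⟩, rfl⟩
    exact ⟨w * w', FreeMonoid.length_mul w w', posWord_mul s w w'⟩
  · rintro ⟨_, hw, rfl⟩
    obtain ⟨w, w', rfl, rfl, rfl⟩ := exists_eq_mul_of_length_eq_add hw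
    exact ⟨_, ⟨w, rfl, rfl⟩, _, ⟨w', rfl, rfl⟩, (posWord_mul s w w').symm⟩

theorem posWord_image_length_eq_zero (α : Type*) (s : ℕ) :
    posWord s '' {w : FreeMonoid α | w.length = 0} = {1} := by
  simp [FreeMonoid.length_eq_zero, posWord_one]

theorem wordBlock_eq_image_posWord (e j a : ℕ) :
    wordBlock n e j a =
      posWord (a * 2 ^ j) '' {w | w.length = min e ((a + 1) * 2 ^ j) - a * 2 ^ j} := by
  induction j generalizing a with
  | zero =>
    simp only [wordBlock, pow_zero, mul_one]
    split_ifs with hae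
    · rw [show min e (a + 1) - a = 1 by lia]
      ext u
      simp [FreeMonoid.length_eq_one, posWord_of, eq_comm]
    · rw [show min e (a + 1) - a = 0 by lia, posWord_image_length_eq_zero]
  | succ j ih =>
    have hleft : 2 * a * 2 ^ j = a * 2 ^ (j + 1) := by ring
    have hmid : (2 * a + 1) * 2 ^ j = a * 2 ^ (j + 1) + 2 ^ j := by ring
    have hright : (2 * a + 1 + 1) * 2 ^ j = a * 2 ^ (j + 1) + 2 * 2 ^ j := by ring
    have hend : (a + 1) * 2 ^ (j + 1) = a * 2 ^ (j + 1) + 2 * 2 ^ j := by ring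
    rw [wordBlock, ih, ih, hleft, hmid, hright, hend]
    generalize a * 2 ^ (j + 1) = s
    by_cases hfull : s + 2 ^ j ≤ e
    · rw [show min e (s + 2 ^ j) - s = 2 ^ j by lia, posWord_image_mul]
      congr! 4
      lia
    · rw [show min e (s + 2 * 2 ^ j) - (s + 2 ^ j) = 0 by lia, posWord_image_length_eq_zero,
        Set.singleton_one, mul_one]
      congr! 4
      lia

theorem wordBlock_zero_eq_image_posWord {e h : ℕ} (he : e ≤ 2 ^ h) :
    wordBlock n e h 0 = posWord 0 '' {w | w.length = e} := by
  simp [wordBlock_eq_image_posWord, he]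

end PosWordBlock

/-! ## Kronecker substitution and interpolation at roots of unity -/

section Kronecker

open Polynomial

theorem coeff_eval_X_pow {R : Type*} [CommSemiring R] {p : R[X][X]} {E i j : ℕ} (hj : j < E)
    (hE : ∀ l, (p.coeff l).natDegree < E) :
    (p.eval (X ^ E)).coeff (E * i + j) = (p.coeff i).coeff j := by
  rw [eval_eq_sum_range' (n := max (p.natDegree + 1) (i + 1)) (by lia), finsetSum_coeff]
  simp only [← pow_mul, coeff_mul_X_pow']
  rw [Finset.sum_eq_single i]
  · simp
  · intro l _ hl
    split_ifs with hle
    · have hli : l + 1 ≤ i := by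
        refine lt_of_le_of_ne (Nat.lt_succ_iff.1 ?_) hl
        by_contra! hgt
        nlinarith
      refine coeff_eq_zero_of_natDegree_lt ((hE l).trans_le (Nat.le_sub_of_add_le ?_))
      nlinarith
    · rfl
  · simp

theorem aeval_eval_X_pow_ne_zero {L K : Type*} [Field L] [Field K] [Algebra L K] {z : K}
    (hz : Transcendental L z) {p : L[X][X]} {E : ℕ} (hp : p ≠ 0)
    (hE : ∀ i, (p.coeff i).natDegree < E) : aeval z (p.eval (X ^ E)) ≠ 0 := by
  refine fun hzero => hp (Polynomial.ext fun i => Polynomial.ext fun j => ?_)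
  have heval := transcendental_iff.1 hz _ hzero
  rcases lt_or_ge j E with hj | hj
  · rw [← coeff_eval_X_pow hj hE, heval, coeff_zero, coeff_zero, coeff_zero]
  · rw [coeff_eq_zero_of_natDegree_lt ((hE i).trans_le hj), coeff_zero, coeff_zero]

theorem natDegree_coeff_mul_le {R : Type*} [CommSemiring R] {p q : R[X][X]} {a b : ℕ}
    (hp : ∀ i, (p.coeff i).natDegree ≤ a) (hq : ∀ i, (q.coeff i).natDegree ≤ b) (i : ℕ) :
    ((p * q).coeff i).natDegree ≤ a + b := by
  rw [coeff_mul]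
  exact natDegree_sum_le_of_forall_le _ _ fun x _ =>
    natDegree_mul_le.trans (Nat.add_le_add (hp _) (hq _))

theorem natDegree_coeff_lift_le {R α : Type*} [CommSemiring R] {a : ℕ} {f : α → R[X][X]}
    (hf : ∀ x j, ((f x).coeff j).natDegree ≤ a) (u : FreeMonoid α) (j : ℕ) :
    ((FreeMonoid.lift f u).coeff j).natDegree ≤ u.length * a := by
  induction u using FreeMonoid.inductionOn' generalizing j with
  | one => rw [map_one, coeff_one]; split_ifs <;> simp
  | of_mul x u ih =>
    rw [map_mul, FreeMonoid.lift_eval_of, FreeMonoid.length_mul, FreeMonoid.length_of, add_mul,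
      one_mul]
    exact natDegree_coeff_mul_le (hf x) ih j

theorem sum_pow_mul_pow_of_isPrimitiveRoot {R : Type*} [CommRing R] [IsDomain R] {ω : R} {m : ℕ}
    (hω : IsPrimitiveRoot ω m) (hm : m ≠ 0) (s t : ℕ) :
    ∑ c ∈ Finset.range m, ω ^ (c * (m - t % m)) * (ω ^ s) ^ c =
      if s ≡ t [MOD m] then (m : R) else 0 := by
  set ζ := ω ^ (m - t % m + s) with hζ
  have hneg : m - t % m + t ≡ 0 [MOD m] := by
    have ht := Nat.mod_lt t (Nat.pos_of_ne_zero hm)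
    refine Nat.modEq_zero_iff_dvd.2 ⟨t / m + 1, ?_⟩
    rw [mul_add]
    have := Nat.div_add_mod t m
    lia
  have hζ_one : ζ = 1 ↔ s ≡ t [MOD m] := by
    rw [hζ, ← pow_zero ω, pow_eq_pow_iff_modEq_of_isPrimitiveRoot hω hm]
    exact ⟨fun h => (h.trans hneg.symm).add_left_cancel' _, fun h => (h.add_left _).trans hneg⟩
  calc ∑ c ∈ Finset.range m, ω ^ (c * (m - t % m)) * (ω ^ s) ^ c = ∑ c ∈ Finset.range m, ζ ^ c :=
        Finset.sum_congr rfl fun c _ => by ring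
    _ = if s ≡ t [MOD m] then (m : R) else 0 := by
        split_ifs with hst
        · simp [hζ_one.2 hst]
        · refine eq_zero_of_ne_zero_of_mul_right_eq_zero
            (sub_ne_zero.2 fun hone => hst (hζ_one.1 hone)) ?_
          rw [geom_sum_mul, hζ, ← pow_mul, mul_comm, pow_mul, hω.pow_eq_one, one_pow, sub_self]

end Kronecker

section PointSum

open Polynomial

variable {α : Type*} (m d g : ℕ) (W : ℕ × α → ℕ)

/-- The `i`-th coordinate of a point of the hitting set, divided by `x`: for `z` and `ζ` an
indeterminate and a root of unity, and `y` a high power of `z`. The inner sum is arranged so that at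
`z = ω`, `ζ = ω ^ g ^ j` it vanishes unless `k = j`. -/
def pointSum {R : Type*} [CommSemiring R] (z y ζ : R) (i : α) : R :=
  ∑ k ∈ Finset.range d, y ^ W (k, i) * ∑ c ∈ Finset.range m, z ^ (c * (m - g ^ k % m)) * ζ ^ c

theorem map_pointSum {R S G : Type*} [CommSemiring R] [CommSemiring S] [FunLike G R S]
    [RingHomClass G R S] (f : G) (z y ζ : R) (i : α) :
    f (pointSum m d g W z y ζ i) = pointSum m d g W (f z) (f y) (f ζ) i := by
  simp only [pointSum, map_sum, map_mul, map_pow]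

variable {m d g}

theorem pointSum_of_isPrimitiveRoot {R : Type*} [CommRing R] [IsDomain R] {ω : R}
    (hω : IsPrimitiveRoot ω m) (hm : m ≠ 0)
    (hg : ∀ j < d, ∀ k < d, g ^ j ≡ g ^ k [MOD m] → j = k) (y : R) {j : ℕ} (hj : j < d) (i : α) :
    pointSum m d g W ω y (ω ^ g ^ j) i = m * y ^ W (j, i) := by
  simp only [pointSum, sum_pow_mul_pow_of_isPrimitiveRoot hω hm]
  rw [Finset.sum_eq_single_of_mem j (Finset.mem_range.2 hj), if_pos (Nat.ModEq.refl _), mul_comm]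
  intro k hk hkj
  rw [if_neg fun h => hkj (hg j hj k (Finset.mem_range.1 hk) h).symm, mul_zero]

theorem map_evalRingHom_pointSum {R : Type*} [CommRing R] [IsDomain R] {ω : R}
    (hω : IsPrimitiveRoot ω m) (hm : m ≠ 0)
    (hg : ∀ j < d, ∀ k < d, g ^ j ≡ g ^ k [MOD m] → j = k) {j : ℕ} (hj : j < d) (i : α) :
    mapRingHom (evalRingHom ω) (pointSum m d g W (C X) X (C (C (ω ^ g ^ j))) i) =
      C (m : R) * X ^ W (j, i) := by
  rw [map_pointSum]
  simp only [coe_mapRingHom, map_C, map_X, coe_evalRingHom, eval_X, eval_C, map_pow]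
  rw [pointSum_of_isPrimitiveRoot W (hω.map_of_injective C_injective) hm hg _ hj, map_natCast]

theorem natDegree_coeff_pointSum_le {R : Type*} [CommSemiring R] (ζ : R) (i : α) (l : ℕ) :
    ((pointSum m d g W (C X : R[X][X]) X (C (C ζ)) i).coeff l).natDegree ≤ m * m := by
  simp only [pointSum, finsetSum_coeff, ← map_pow, ← map_mul, ← map_sum, coeff_mul_C, coeff_X_pow,
    ite_mul, one_mul, zero_mul]
  refine natDegree_sum_le_of_forall_le _ _ fun k _ => ?_
  split_ifs
  · refine natDegree_sum_le_of_forall_le _ _ fun c hc => (natDegree_mul_C_le _ _).trans ?_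
    exact (natDegree_X_pow_le _).trans
      (Nat.mul_le_mul (Finset.mem_range.1 hc).le (Nat.sub_le _ _))
  · simp

/-- The sum is a polynomial in `z` and `z ^ E`. Replacing these by independent indeterminates loses
nothing since `E` exceeds the degree in `z`, and specialising the first one to `ω` turns the value
of a word into a multiple of the monomial whose degree is the weight of the word. -/
theorem sum_mul_lift_pointSum_ne_zero {L K : Type*} [Field L] [Field K] [Algebra L K] {z : K}
    (hz : Transcendental L z) {ω : L} (hω : IsPrimitiveRoot ω m) (hm : (m : L) ≠ 0)
    (hg : ∀ j < d, ∀ k < d, g ^ j ≡ g ^ k [MOD m] → j = k) {e E : ℕ} (he : e ≤ d)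
    (hE : e * (m * m) < E) {U : Finset (FreeMonoid α)} (hlen : ∀ w ∈ U, w.length = e)
    (c : FreeMonoid α → L) {t : ℕ} (ht : ∑ w ∈ U with letterSum W (posWord 0 w) = t, c w ≠ 0) :
    ∑ w ∈ U, algebraMap L K (c w) * FreeMonoid.lift
      (fun x => pointSum m d g W z (z ^ E) (algebraMap L K ω ^ g ^ x.1) x.2)
      (posWord 0 w) ≠ 0 := by
  set P : L[X][X] := ∑ w ∈ U, C (C (c w)) * FreeMonoid.lift
    (fun x => pointSum m d g W (C X) X (C (C (ω ^ g ^ x.1))) x.2) (posWord 0 w) with hP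
  have hm0 : m ≠ 0 := by rintro rfl; simp at hm
  have hcoeff : (P.map (evalRingHom ω)).coeff t =
      m ^ e * ∑ w ∈ U with letterSum W (posWord 0 w) = t, c w := by
    rw [← coe_mapRingHom, hP, map_sum, finsetSum_coeff, Finset.sum_filter, Finset.mul_sum]
    refine Finset.sum_congr rfl fun w hw => ?_
    rw [map_mul, map_lift, lift_congr_of_forall_mem fun x hx => map_evalRingHom_pointSum W hω hm0
      hg ((fst_lt_of_mem_posWord hx).trans_le ((hlen w hw).trans_le he)) x.2, lift_mul_pow_eq,
      length_posWord, hlen w hw, coe_mapRingHom, map_C, coe_evalRingHom, eval_C, ← map_pow,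
      coeff_C_mul, coeff_C_mul, coeff_X_pow]
    simp only [eq_comm (a := t)]
    split_ifs <;> ring
  have hP0 : P ≠ 0 := by
    rintro h
    rw [h, Polynomial.map_zero, coeff_zero] at hcoeff
    exact mul_ne_zero (pow_ne_zero e hm) ht hcoeff.symm
  have hdeg (i : ℕ) : (P.coeff i).natDegree < E := by
    refine hE.trans_le' ?_
    simp only [hP, finsetSum_coeff, coeff_C_mul]
    refine natDegree_sum_le_of_forall_le _ _ fun w hw => (natDegree_C_mul_le _ _).trans ?_
    rw [← hlen w hw, ← length_posWord 0 w]
    exact natDegree_coeff_lift_le (fun x => natDegree_coeff_pointSum_le W _ _) _ i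
  convert aeval_eval_X_pow_ne_zero hz hP0 hdeg
  set φ : L[X][X] →+* K := (aeval z).toRingHom.comp (evalRingHom (X ^ E)) with hφ
  change _ = φ P
  rw [hP, map_sum]
  refine Finset.sum_congr rfl fun w _ => ?_
  rw [map_mul, map_lift]
  simp only [map_pointSum]
  simp [hφ]

end PointSum

/-! ## Values of noncommutative polynomials in a cyclic algebra -/

section CyclicValues

variable {F K : Type*} [Field F] [Field K] [Algebra F K] (σ : K ≃ₐ[F] K) (ℓ : ℕ) (a : F)

/-- The embedding `cyclicAlgebra.ofK` of the field `K` into the cyclic algebra as a ring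
homomorphism. -/
def cyclicAlgebra.ofKHom : K →+* cyclicAlgebra σ ℓ a where
  toFun := cyclicAlgebra.ofK σ ℓ a
  map_one' := Subtype.ext (by simp [cyclicAlgebra.ofK, cyclicDiag])
  map_mul' b c := Subtype.ext (by simp [cyclicAlgebra.ofK, cyclicDiag])
  map_zero' := Subtype.ext (by simp [cyclicAlgebra.ofK, cyclicDiag])
  map_add' b c := Subtype.ext (by simp [cyclicAlgebra.ofK, cyclicDiag, Matrix.diagonal_add])

theorem cyclicAlgebra.algebraMap_eq_ofKHom (c : F) :
    algebraMap F (cyclicAlgebra σ ℓ a) c = cyclicAlgebra.ofKHom σ ℓ a (algebraMap F K c) := by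
  apply Subtype.ext
  change algebraMap F (Matrix (Fin ℓ) (Fin ℓ) K) c = cyclicDiag σ ℓ (algebraMap F K c)
  simp only [cyclicDiag, Matrix.algebraMap_eq_diagonal, AlgEquiv.commutes]
  rfl

variable {σ ℓ} (hσ : σ ^ ℓ = 1)

include hσ

theorem cyclicAlgebra.x_mul_ofKHom (c : K) :
    cyclicAlgebra.x σ ℓ a * cyclicAlgebra.ofKHom σ ℓ a c =
      cyclicAlgebra.ofKHom σ ℓ a (σ c) * cyclicAlgebra.x σ ℓ a := by
  apply Subtype.ext
  change cyclicX K ℓ a * cyclicDiag σ ℓ c = cyclicDiag σ ℓ (σ c) * cyclicX K ℓ a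
  ext i j
  rw [cyclicDiag, cyclicDiag, Matrix.mul_diagonal, Matrix.diagonal_mul, mul_comm]
  simp only [cyclicX, Matrix.of_apply]
  split_ifs with hij hij
  · rw [hij, pow_succ, AlgEquiv.mul_apply]
  · rw [hij.2, pow_zero, ← AlgEquiv.mul_apply, ← pow_succ, hij.1, hσ]
  · rw [mul_zero, mul_zero]

variable [NeZero ℓ]

theorem cyclicAlgebra.lift_ofKHom_mul_x_apply_zero {α : Type*} (b : α → K) {w : FreeMonoid α}
    (hw : w.length < ℓ) (e : Fin ℓ) :
    (FreeMonoid.lift (fun i => cyclicAlgebra.ofKHom σ ℓ a (b i) * cyclicAlgebra.x σ ℓ a) w :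
      Matrix (Fin ℓ) (Fin ℓ) K) 0 e =
    if w.length = e then FreeMonoid.lift (fun y => (σ ^ y.1) (b y.2)) (posWord 0 w) else 0 := by
  have hword := lift_mul_eq_lift_posWord_mul_pow σ (cyclicAlgebra.ofKHom σ ℓ a : K →* _)
    (cyclicAlgebra.x σ ℓ a) (cyclicAlgebra.x_mul_ofKHom a hσ) b w
  rw [MonoidHom.coe_coe] at hword
  rw [hword]
  change (cyclicDiag σ ℓ _ * cyclicX K ℓ a ^ w.length) 0 e = _
  rw [cyclicX_pow_eq_cyclicMatrix a hσ hw, cyclicDiag_mul_cyclicMatrix, cyclicMatrix_zero_apply]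
  simp [Pi.single_apply, eq_comm]

theorem cyclicAlgebra.freeAlgebraLift_apply_zero {k α : Type*} [Field k] [Algebra k F]
    [Algebra k (cyclicAlgebra σ ℓ a)] [IsScalarTower k F (cyclicAlgebra σ ℓ a)] (b : α → K)
    {f : FreeAlgebra k α} (hf : ∀ w, wordCoeff f w ≠ 0 → w.length < ℓ) (e : Fin ℓ) :
    (FreeAlgebra.lift k (fun i => cyclicAlgebra.ofKHom σ ℓ a (b i) * cyclicAlgebra.x σ ℓ a) f :
      Matrix (Fin ℓ) (Fin ℓ) K) 0 e =
    ∑ w ∈ (wordCoeff f).support with w.length = (e : ℕ),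
      algebraMap F K (algebraMap k F (wordCoeff f w)) *
        FreeMonoid.lift (fun y => (σ ^ y.1) (b y.2)) (posWord 0 w) := by
  rw [lift_eq_sum_wordCoeff, Finset.sum_filter]
  simp only [AddSubmonoidClass.coe_finsetSum, Matrix.sum_apply]
  refine Finset.sum_congr rfl fun w hw => ?_
  rw [← algebraMap_smul F, Subalgebra.coe_smul, Matrix.smul_apply,
    cyclicAlgebra.lift_ofKHom_mul_x_apply_zero a hσ b (hf w (Finsupp.mem_support_iff.1 hw)),
    smul_ite, smul_zero, Algebra.smul_def]

end CyclicValues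

section PointCoeff

variable {α : Type*} (h d : ℕ) (W : ℕ × α → ℕ)

theorem two_pow_modEq_two_pow_iff {j k : ℕ} (hj : j < 2 * 3 ^ h) (hk : k < 2 * 3 ^ h) :
    2 ^ j ≡ 2 ^ k [MOD 3 ^ (h + 1)] ↔ j = k := by
  refine ⟨fun hjk => ?_, fun hjk => by rw [hjk]⟩
  rw [← orderOf_two_zmod_three_pow] at hj hk
  exact pow_injOn_Iio_orderOf hj hk
    (by simpa using (ZMod.natCast_eq_natCast_iff (2 ^ j) (2 ^ k) _).2 hjk)

/-- The power of `z` that plays the role of an independent indeterminate. -/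
def pointScale : ℕ := d * (3 ^ (h + 1) * 3 ^ (h + 1)) + 1

/-- The `i`-th coordinate of the point with letter weights `W`, divided by `x`. -/
noncomputable def pointCoeff (i : α) : RatZOmega (3 ^ (h + 1)) :=
  pointSum (3 ^ (h + 1)) d 2 W (zElem h) (zElem h ^ pointScale h d) (omega h) i

theorem sigma_pow_pointCoeff (j : ℕ) (i : α) : (sigma h ^ j) (pointCoeff h d W i) =
    pointSum (3 ^ (h + 1)) d 2 W (zElem h) (zElem h ^ pointScale h d) (omega h ^ 2 ^ j) i := by
  have hz : (sigma h ^ j) (zElem h) = zElem h := AlgEquiv.commutes _ _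
  rw [pointCoeff, map_pointSum, map_pow, hz, sigma_pow_omega]

theorem sum_mul_lift_pointCoeff_ne_zero {h d e : ℕ} (he : e ≤ d) (hd : d ≤ 2 * 3 ^ h)
    {U : Finset (FreeMonoid α)} (hlen : ∀ w ∈ U, w.length = e) (c : FreeMonoid α → ℚ) {t : ℕ}
    (ht : ∑ w ∈ U with letterSum W (posWord 0 w) = t, c w ≠ 0) :
    ∑ w ∈ U, (c w : RatZOmega (3 ^ (h + 1))) * FreeMonoid.lift
      (fun x => (sigma h ^ x.1) (pointCoeff h d W x.2)) (posWord 0 w) ≠ 0 := by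
  have hω := isPrimitiveRoot_omega h
  have hmem : omega h ∈ constants h :=
    mem_algebraicClosure_iff.2 (IsIntegral.of_pow (n := 3 ^ (h + 1)) (by positivity)
      (hω.pow_eq_one ▸ isIntegral_one)).isAlgebraic
  have hω' : IsPrimitiveRoot (⟨omega h, hmem⟩ : constants h) (3 ^ (h + 1)) :=
    IsPrimitiveRoot.coe_submonoidClass_iff.1 hω
  have hsum := sum_mul_lift_pointSum_ne_zero (g := 2) W (transcendental_zElem h).algebraicClosure
    hω' (by simp) (fun j hj k hk => (two_pow_modEq_two_pow_iff h (hj.trans_le hd)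
      (hk.trans_le hd)).1)
    he (E := pointScale h d) (Nat.lt_succ_of_le (Nat.mul_le_mul_right _ he)) hlen
    (fun w => (c w : constants h)) (t := t)
    (by exact_mod_cast ht)
  simp only [map_ratCast] at hsum
  simp only [sigma_pow_pointCoeff]
  exact hsum

end PointCoeff

/-! ## The hitting set -/

section HittingSet

variable (n h d N q : ℕ)

/-- The letter weights of the point with seed `q`. -/
def pointWeight : ℕ × Fin n → ℕ := fun x => letterWeight n (2 ^ h * N + 1) N h q x.1 x.2

/-- The number `N` of values of a digit of the seed, if `d ≤ 2 ^ h` and the programs have width at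
most `r`: the coefficients live in an algebra of dimension at most `D = (r * (d + 1)) ^ 2`. -/
def pointModulus (n r d h : ℕ) : ℕ := 2 * (n * 2 ^ h * (2 ^ h * ((r * (d + 1)) ^ 2) ^ 4) + 1)

/-- The term `z ^ (E * W + c * (m - 2 ^ k % m)) * ω ^ c * x` of `pointCoeff`, times `x`, where
`m = 3 ^ (h + 1)`, `E` is the scale and `W` the weight of the letter `i` at position `k`. -/
def pointTerm (i : Fin n) (k c : ℕ) : DTerm where
  num := 1
  den := 1
  zExp := pointScale h d * pointWeight n h N q (k, i) + c * (3 ^ (h + 1) - 2 ^ k % 3 ^ (h + 1))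
  wExp := c
  xExp := 1

/-- The written form of the point with seed `q`. -/
def pointTerms (i : Fin n) : List DTerm :=
  (List.range d).flatMap fun k => (List.range (3 ^ (h + 1))).map (pointTerm n h d N q i k)

theorem value_pointTerm (i : Fin n) (k c : ℕ) :
    (pointTerm n h d N q i k c).value (sigma h) (2 * 3 ^ h) (omega h) =
      cyclicAlgebra.ofKHom (sigma h) (2 * 3 ^ h) RatFunc.X
        ((zElem h ^ pointScale h d) ^ pointWeight n h N q (k, i) *
          (zElem h ^ (c * (3 ^ (h + 1) - 2 ^ k % 3 ^ (h + 1))) * omega h ^ c)) *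
        cyclicAlgebra.x (sigma h) (2 * 3 ^ h) RatFunc.X := by
  rw [DTerm.value, cyclicAlgebra.algebraMap_eq_ofKHom]
  change cyclicAlgebra.ofKHom _ _ _ _ * cyclicAlgebra.ofKHom _ _ _ _ * _ = _
  simp only [pointTerm, Int.cast_one, PNat.val_ofNat, Nat.cast_one, div_one, one_mul, pow_one,
    ← map_mul]
  congr 2
  rw [map_pow, zElem]
  ring

theorem pointValue_pointTerms (i : Fin n) :
    pointValue (sigma h) (2 * 3 ^ h) (omega h) (pointTerms n h d N q) i =
      cyclicAlgebra.ofKHom (sigma h) (2 * 3 ^ h) RatFunc.X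
        (pointCoeff h d (pointWeight n h N q) i) *
        cyclicAlgebra.x (sigma h) (2 * 3 ^ h) RatFunc.X := by
  have hsum : pointValue (sigma h) (2 * 3 ^ h) (omega h) (pointTerms n h d N q) i =
      ∑ k ∈ Finset.range d, ∑ c ∈ Finset.range (3 ^ (h + 1)),
        (pointTerm n h d N q i k c).value (sigma h) (2 * 3 ^ h) (omega h) := by
    rw [pointValue, pointTerms, List.flatMap_def, List.map_flatten, List.sum_flatten]
    simp only [List.map_map, Function.comp_def]
    rfl
  rw [hsum]
  simp only [value_pointTerm, ← Finset.sum_mul, ← map_sum, ← Finset.mul_sum]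
  rfl

variable {n h d N q}

theorem lt_two_mul_three_pow (hd : d ≤ 2 ^ h) : d < 2 * 3 ^ h := by
  have h_le : 2 ^ h ≤ 3 ^ h := Nat.pow_le_pow_left (by norm_num) h
  have h_pos : 0 < 3 ^ h := by positivity
  lia

theorem exists_seed_sum_wordCoeff_ne_zero {k A : Type*} [Field k] [Ring A] [Algebra k A]
    [Module.Finite k A] {D : ℕ} (hD : Module.finrank k A ≤ D)
    (hN : 2 * (n * 2 ^ h * (2 ^ h * D ^ 4) + 1) ≤ N) {f : FreeAlgebra k (Fin n)} {τ : Fin n → A}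
    {φ : A →ₗ[k] k} (hf : ∀ w, wordCoeff f w = φ (FreeMonoid.lift τ w)) {e : ℕ} (he : e ≤ 2 ^ h)
    (hfe : ∃ w, w.length = e ∧ wordCoeff f w ≠ 0) :
    ∃ q < N ^ h, ∃ t, ∑ w ∈ ((wordCoeff f).support.filter fun w => w.length = e) with
      letterSum (pointWeight n h N q) (posWord 0 w) = t, wordCoeff f w ≠ 0 := by
  have hval (w : FreeMonoid (Fin n)) :
      FreeMonoid.lift (fun x : ℕ × Fin n => τ x.2) (posWord 0 w) = FreeMonoid.lift τ w := by
    conv_rhs => rw [← map_snd_posWord 0 w]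
    simp [FreeMonoid.lift_apply, FreeMonoid.toList_map, Function.comp_def]
  obtain ⟨q, hq, hS⟩ := exists_seed_isIsolatingBasis_wordBlock
    (FreeMonoid.lift fun x : ℕ × Fin n => τ x.2) e hD hN h
  obtain ⟨S, hS⟩ := hS 0 (by simp)
  change IsIsolatingBasis k _ (letterSum (pointWeight n h N q)) _ S at hS
  rw [wordBlock_zero_eq_image_posWord he] at hS
  obtain ⟨t, ht⟩ := hS.exists_sum_ne_zero φ
    (Z := ((wordCoeff f).support.filter fun w => w.length = e).map
      ⟨posWord 0, posWord_injective 0⟩)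
    (by
      intro u hu
      obtain ⟨w, hw, rfl⟩ := Finset.mem_map.1 hu
      exact ⟨w, (Finset.mem_filter.1 hw).2, rfl⟩)
    (by
      rintro _ ⟨w, hw, rfl⟩ hwU
      rw [hval, ← hf]
      by_contra hne
      exact hwU (Finset.mem_map_of_mem _ (Finset.mem_filter.2 ⟨Finsupp.mem_support_iff.2 hne, hw⟩)))
    (by
      obtain ⟨w, hw, hne⟩ := hfe
      exact ⟨_, ⟨w, hw, rfl⟩, by rwa [hval, ← hf]⟩)
  refine ⟨q, hq, t, ?_⟩
  rw [Finset.filter_map, Finset.sum_map] at ht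
  simpa only [Function.Embedding.coeFn_mk, hval, ← hf, Function.comp_def] using ht

theorem exists_lift_pointValue_ne_zero {r : ℕ} (hd : d ≤ 2 ^ h)
    (hN : pointModulus n r d h ≤ N) {f : FreeAlgebra ℚ (Fin n)}
    (hf : f ∈ abpClass n r d) (hf0 : f ≠ 0) :
    ∃ q < N ^ h, FreeAlgebra.lift ℚ
      (pointValue (sigma h) (2 * 3 ^ h) (omega h) (pointTerms n h d N q)) f ≠ 0 := by
  have hlen {w} (hw : wordCoeff f w ≠ 0) : w.length ≤ d := by
    obtain ⟨B, -, rfl⟩ := hf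
    exact B.length_le_of_wordCoeff_poly_ne_zero hw
  obtain ⟨w₀, hw₀⟩ : ∃ w, wordCoeff f w ≠ 0 :=
    Finsupp.ne_iff.1 ((LinearEquiv.map_ne_zero_iff _).2 hf0)
  obtain ⟨A, _, _, _, τ, φ, hA, hτ⟩ := exists_wordCoeff_eq_apply_lift_of_mem_abpClass hf
  obtain ⟨q, hq, t, ht⟩ := exists_seed_sum_wordCoeff_ne_zero hA hN hτ ((hlen hw₀).trans hd)
    ⟨w₀, rfl, hw₀⟩
  refine ⟨q, hq, fun hzero => ?_⟩
  have hdℓ := lt_two_mul_three_pow hd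
  have : NeZero (2 * 3 ^ h) := ⟨by positivity⟩
  have : @IsScalarTower ℚ RatZ (CyclicD (sigma h) (2 * 3 ^ h)) Algebra.toSMul _ _ :=
    .of_algebraMap_smul fun _ _ => rfl
  have hentry := cyclicAlgebra.freeAlgebraLift_apply_zero (RatFunc.X : RatZ)
    (orderOf_dvd_iff_pow_eq_one.1 (orderOf_sigma h).dvd) (pointCoeff h d (pointWeight n h N q))
    (fun w hw => (hlen hw).trans_lt hdℓ) ⟨w₀.length, (hlen hw₀).trans_lt hdℓ⟩
  rw [← funext (pointValue_pointTerms n h d N q), hzero] at hentry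
  refine sum_mul_lift_pointCoeff_ne_zero (pointWeight n h N q) (hlen hw₀) hdℓ.le
    (fun w hw => (Finset.mem_filter.1 hw).2) (wordCoeff f) ht ?_
  simpa using hentry.symm

end HittingSet

/-! ## Verifying programs of the random access machine -/

namespace RAM

/-- The arithmetic instructions of the machine. -/
inductive Op : Type
  | add
  | sub
  | mul
  | div

namespace Op

/-- The operation on numbers that an arithmetic instruction performs. -/
def eval : Op → ℕ → ℕ → ℕ
  | add => (· + ·)
  | sub => (· - ·)
  | mul => (· * ·)
  | div => (· / ·)

/-- The instruction itself. -/
def instr : Op → ℕ → ℕ → ℕ → Prog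
  | add => .add
  | sub => .sub
  | mul => .mul
  | div => .div

theorem exec_instr (op : Op) (s : State) (t a b : ℕ) :
    Exec (op.instr t a b) s (1 + (s.reg a).size + (s.reg b).size)
      (s.set t (op.eval (s.reg a) (s.reg b))) := by
  cases op <;> constructor

theorem size_eval_le (op : Op) {a b x y : ℕ} (ha : a.size ≤ x) (hb : b.size ≤ y) (hx : 1 ≤ x)
    (hy : 1 ≤ y) : (op.eval a b).size ≤ x + y := by
  have of_le {c : ℕ} (hc : c ≤ a) : c.size ≤ x + y :=
    (Nat.size_le_size hc).trans (ha.trans (Nat.le_add_right x y))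
  cases op with
  | sub => exact of_le (Nat.sub_le a b)
  | div => exact of_le (Nat.div_le_self a b)
  | mul =>
    rw [Nat.size_le, pow_add]
    exact Nat.mul_lt_mul'' (Nat.size_le.1 ha) (Nat.size_le.1 hb)
  | add =>
    have ha' : a + 1 ≤ 2 ^ x := Nat.size_le.1 ha
    have hb' : b + 1 ≤ 2 ^ y := Nat.size_le.1 hb
    have hx' : 2 ≤ 2 ^ x := Nat.le_self_pow (by lia) 2
    have hy' : 2 ≤ 2 ^ y := Nat.le_self_pow (by lia) 2
    rw [Nat.size_le, pow_add]
    change a + b < _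
    nlinarith

end Op

/-- Arithmetic expressions over registers. -/
inductive RegExpr : Type
  | var (r : ℕ)
  | lit (k : ℕ)
  | bin (op : Op) (a b : RegExpr)

namespace RegExpr

instance : Add RegExpr := ⟨bin .add⟩
instance : Sub RegExpr := ⟨bin .sub⟩
instance : Mul RegExpr := ⟨bin .mul⟩
instance : Div RegExpr := ⟨bin .div⟩
instance : Mod RegExpr := ⟨fun a b => a - b * (a / b)⟩
instance (k : ℕ) : OfNat RegExpr k := ⟨lit k⟩

/-- The value of an expression, given the contents of the first registers. -/
def eval (l : List ℕ) : RegExpr → ℕ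
  | var r => l.getD r 0
  | lit k => k
  | bin op a b => op.eval (a.eval l) (b.eval l)

/-- The program that computes an expression into register `t`, with scratch registers above `t`. -/
def compile : RegExpr → ℕ → Prog
  | var r, t => .seq (.const t 0) (.add t r t)
  | lit k, t => .const t k
  | bin op a b, t => .seq (a.compile t) (.seq (b.compile (t + 1)) (op.instr t t (t + 1)))

/-- All registers of the expression lie below `k`. -/
def varsLt (k : ℕ) : RegExpr → Bool
  | var r => decide (r < k)
  | lit _ => true
  | bin _ a b => a.varsLt k && b.varsLt k

/-- A bound for the bit length of the value, in units of the bit lengths of the registers. -/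
def width : RegExpr → ℕ
  | var _ => 1
  | lit k => k + 1
  | bin _ a b => a.width + b.width

/-- A bound for the cost of the evaluation, in units of the bit lengths of the registers. -/
def cost : RegExpr → ℕ
  | var _ => 3
  | lit k => k + 1
  | bin _ a b => a.cost + b.cost + a.width + b.width + 1

theorem one_le_width (e : RegExpr) : 1 ≤ e.width := by
  induction e with
  | var => exact le_rfl
  | lit k => exact Nat.succ_le_succ (Nat.zero_le k)
  | bin _ _ _ ha => exact ha.trans (Nat.le_add_right _ _)

theorem size_le_self (k : ℕ) : k.size ≤ k := Nat.size_le.2 Nat.lt_two_pow_self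

theorem size_eval_le (e : RegExpr) {l : List ℕ} {u : ℕ} (hl : ∀ a ∈ l, a.size + 1 ≤ u)
    (hu : 1 ≤ u) : (e.eval l).size ≤ e.width * u := by
  have hwidth (a : RegExpr) : 1 ≤ a.width * u := Nat.mul_pos a.one_le_width hu
  induction e with
  | var r =>
    simp only [eval, width, one_mul]
    rcases lt_or_ge r l.length with hr | hr
    · rw [List.getD_eq_getElem _ _ hr]
      exact (Nat.le_succ _).trans (hl _ (List.getElem_mem hr))
    · rw [List.getD_eq_default _ _ hr, Nat.size_zero]
      exact Nat.zero_le u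
  | lit k => exact (size_le_self k).trans ((Nat.le_succ k).trans (Nat.le_mul_of_pos_right _ hu))
  | bin op a b ha hb =>
    rw [eval, width, add_mul]
    exact op.size_eval_le ha hb (hwidth a) (hwidth b)

end RegExpr

/-- The first registers of the state hold the entries of the list. -/
def Agrees (l : List ℕ) (s : State) : Prop := ∀ i < l.length, s.reg i = l.getD i 0

theorem Agrees.of_eq {l : List ℕ} {s s' : State} (h : Agrees l s) {t : ℕ} (ht : l.length ≤ t)
    (hs : ∀ r < t, s'.reg r = s.reg r) : Agrees l s' :=
  fun i hi => (hs i (by lia)).trans (h i hi)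

theorem RegExpr.exec_compile (e : RegExpr) {l : List ℕ} {u : ℕ} (hl : ∀ x ∈ l, x.size + 1 ≤ u)
    (hu : 1 ≤ u) (he : e.varsLt l.length = true) (t : ℕ) (s : State) (ht : l.length ≤ t)
    (hs : Agrees l s) : ∃ c s', Exec (e.compile t) s c s' ∧ c ≤ e.cost * u ∧
      s'.reg t = e.eval l ∧ (∀ r < t, s'.reg r = s.reg r) ∧ s'.out = s.out := by
  induction e generalizing t s with
  | var r =>
    have hr : r < l.length := of_decide_eq_true he
    have hrt : r ≠ t := by lia
    have hsize : (s.reg r).size + 1 ≤ u := by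
      rw [hs r hr, List.getD_eq_getElem _ _ hr]
      exact hl _ (List.getElem_mem hr)
    refine ⟨_, _, .seq (.const s t 0) (.add _ t r t), ?_, ?_, fun r' hr' => ?_, rfl⟩
    · simp only [State.set, Function.update_self, Function.update_of_ne hrt, cost, Nat.size_zero]
      lia
    · simp [State.set, hrt, hs r hr, eval]
    · simp [State.set, hr'.ne]
  | lit k =>
    refine ⟨_, _, .const s t k, ?_, by simp [State.set, eval], fun r hr => ?_, rfl⟩
    · have hsize := size_le_self k
      exact (by lia : 1 + k.size ≤ k + 1).trans (Nat.le_mul_of_pos_right _ hu)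
    · simp [State.set, hr.ne]
  | bin op a b ha hb =>
    rw [varsLt, Bool.and_eq_true] at he
    obtain ⟨c₁, s₁, exec₁, hc₁, val₁, reg₁, out₁⟩ := ha he.1 t s ht hs
    obtain ⟨c₂, s₂, exec₂, hc₂, val₂, reg₂, out₂⟩ := hb he.2 (t + 1) s₁ (by lia) (hs.of_eq ht reg₁)
    have hval : s₂.reg t = a.eval l := (reg₂ t (Nat.lt_succ_self t)).trans val₁
    refine ⟨_, _, .seq exec₁ (.seq exec₂ (op.exec_instr s₂ t t (t + 1))), ?_, ?_, fun r hr => ?_,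
      out₂.trans out₁⟩
    · have hsize_a := a.size_eval_le hl hu
      have hsize_b := b.size_eval_le hl hu
      rw [hval, val₂]
      simp only [cost, add_mul, one_mul]
      lia
    · simp [State.set, hval, val₂, eval]
    · simp only [State.set, Function.update_of_ne hr.ne]
      rw [reg₂ r (by lia), reg₁ r hr]

/-- The registers of the program below: the input `n`, `r`, `d`, the parameters of the hitting set,
the seed `q`, the letter `i`, the powers `(n + 1) ^ k` and `2 ^ k` for the position `k`, the weight
of the letter and the power of `N` that extracts a digit of the seed. The registers `gap`, `qCtr`,
`iCtr`, `kCtr` and `ctr` count down the remaining rounds of a loop. -/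
inductive Reg : Type
  | n | r | d
  | two | three | h | gap | u | N | m | B | E | Q
  | q | qCtr | i | iCtr | code | conj | kCtr | weight | digit | ctr

/-- The number of a register. -/
def Reg.index (x : Reg) : ℕ := x.ctorIdx

instance : Coe Reg RegExpr := ⟨fun x => .var x.index⟩

/-- The first scratch register. -/
def scratch : ℕ := 40

/-- The assignment `x := e`. -/
def assign (x : Reg) (e : RegExpr) : Prog :=
  .seq (e.compile scratch) (.seq (.const (scratch + 1) 0) (.add x.index scratch (scratch + 1)))

/-- Appends the value of `e` to the output. -/
def write (e : RegExpr) : Prog := .seq (e.compile scratch) (.emit scratch)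

/-- Repeats `P` as often as the value of `e` says; `x` counts the remaining rounds. -/
def times (x : Reg) (e : RegExpr) (P : Prog) : Prog :=
  .seq (assign x e) (.loop x.index (.seq P (assign x (x - 1))))

infix:60 "≔" => assign
infixr:55 ";;" => Prog.seq

/-- Replaces the entry at position `x`, or appends an entry if the list is too short. -/
def put : List ℕ → ℕ → ℕ → List ℕ
  | [], _, v => [v]
  | _ :: l, 0, v => v :: l
  | a :: l, x + 1, v => a :: put l x v

theorem mem_put {l : List ℕ} {x v a : ℕ} (ha : a ∈ put l x v) : a = v ∨ a ∈ l := by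
  fun_induction put l x v with grind

theorem getD_put {l : List ℕ} {x : ℕ} (hx : x ≤ l.length) (v : ℕ) {i : ℕ}
    (hi : i < (put l x v).length) : i = x ∧ (put l x v).getD i 0 = v ∨
      i ≠ x ∧ i < l.length ∧ (put l x v).getD i 0 = l.getD i 0 := by
  fun_induction put l x v generalizing i with
  | case1 => simp_all
  | case2 => cases i <;> simp_all
  | case3 a l x v ih => cases i <;> simp_all

theorem put_length (l : List ℕ) (v : ℕ) : put l l.length v = l ++ [v] := by
  induction l with
  | nil => rfl
  | cons a l ih => exact congrArg (a :: ·) ih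

theorem put_append_length (l : List ℕ) (a v : ℕ) : put (l ++ [a]) l.length v = l ++ [v] := by
  induction l with
  | nil => rfl
  | cons b l ih => exact congrArg (b :: ·) ih

/-- The expression is cheap and reads none but the first `k` registers. -/
def RegExpr.admissible (k : ℕ) (e : RegExpr) : Bool :=
  decide (k ≤ scratch) && decide (e.cost + e.width + 2 ≤ 500) && e.varsLt k

/-- The cost of an assignment or an output, for registers bounded by `V`. -/
def unitCost (V : ℕ) : ℕ := 500 * (V.size + 1)

/-- Started with registers `l`, all bounded by `V`, and output `o`, the program halts with
registers `l'`, bounded by `V`, and output `o'`, at a cost of at most `t` units. -/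
def Runs (V : ℕ) (P : Prog) (l o : List ℕ) (t : ℕ) (l' o' : List ℕ) : Prop :=
  (∀ a ∈ l, a ≤ V) → (∀ a ∈ l', a ≤ V) ∧ ∀ s : State, Agrees l s → s.out = o →
    ∃ c s', Exec P s c s' ∧ c ≤ t * unitCost V ∧ Agrees l' s' ∧ s'.out = o'

theorem RegExpr.exec_compile_scratch {V : ℕ} {e : RegExpr} {l : List ℕ}
    (he : e.admissible l.length = true) (hl : ∀ a ∈ l, a ≤ V) {s : State} (hs : Agrees l s) :
    ∃ c s', Exec (e.compile scratch) s c s' ∧ c + (e.eval l).size + 2 ≤ unitCost V ∧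
      s'.reg scratch = e.eval l ∧ (∀ r < scratch, s'.reg r = s.reg r) ∧ s'.out = s.out := by
  obtain ⟨⟨hlen, hcost⟩, hvars⟩ :
      (l.length ≤ scratch ∧ e.cost + e.width + 2 ≤ 500) ∧ e.varsLt l.length = true := by
    simpa [admissible] using he
  have hsize : ∀ a ∈ l, a.size + 1 ≤ V.size + 1 := fun a ha =>
    Nat.succ_le_succ (Nat.size_le_size (hl a ha))
  obtain ⟨c, s', hexec, hc, h⟩ := e.exec_compile hsize (by lia) hvars scratch s hlen hs
  refine ⟨c, s', hexec, ?_, h⟩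
  have hval := e.size_eval_le hsize (by lia)
  calc c + (e.eval l).size + 2 ≤ (e.cost + e.width + 2) * (V.size + 1) := by
        rw [add_mul, add_mul]
        lia
    _ ≤ unitCost V := Nat.mul_le_mul_right _ hcost

namespace Runs

variable {V : ℕ} {P Q : Prog} {l o l' o' l'' o'' : List ℕ} {t t' : ℕ}

theorem seq (hP : Runs V P l o t l' o') (hQ : Runs V Q l' o' t' l'' o'') :
    Runs V (P ;; Q) l o (t + t') l'' o'' := by
  intro hl
  obtain ⟨hl', hP⟩ := hP hl
  obtain ⟨hl'', hQ⟩ := hQ hl'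
  refine ⟨hl'', fun s hs ho => ?_⟩
  obtain ⟨c, s', e, hc, hs', ho'⟩ := hP s hs ho
  obtain ⟨c', s'', e', hc', hs'', ho''⟩ := hQ s' hs' ho'
  exact ⟨_, s'', .seq e e', by rw [add_mul]; exact add_le_add hc hc', hs'', ho''⟩

theorem cast (h : Runs V P l o t l' o') (ht : t ≤ t') (hl : l' = l'') (ho : o' = o'') :
    Runs V P l o t' l'' o'' := by
  subst hl ho
  intro hb
  obtain ⟨hl', h⟩ := h hb
  refine ⟨hl', fun s hs hso => ?_⟩
  obtain ⟨c, s', e, hc, hagree, hout⟩ := h s hs hso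
  exact ⟨c, s', e, hc.trans (Nat.mul_le_mul_right _ ht), hagree, hout⟩

theorem forget (m : List ℕ) (h : Runs V P l o t (l' ++ m) o') : Runs V P l o t l' o' := by
  intro hl
  obtain ⟨hl', h⟩ := h hl
  refine ⟨fun a ha => hl' a (List.mem_append_left _ ha), fun s hs ho => ?_⟩
  obtain ⟨c, s', e, hc, hs', ho'⟩ := h s hs ho
  refine ⟨c, s', e, hc, fun i hi => ?_, ho'⟩
  rw [hs' i (by rw [List.length_append]; lia), List.getD_append _ _ _ _ hi]

theorem assign (x : Reg) (e : RegExpr) (v : ℕ) (hv : e.eval l = v) (hvV : v ≤ V)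
    (hx : (decide (x.index ≤ l.length) && decide (x.index < scratch)) = true := by rfl)
    (he : e.admissible l.length = true := by rfl) :
    Runs V (x ≔ e) l o 1 (put l x.index v) o := by
  have hx : x.index ≤ l.length := by simp_all
  intro hl
  refine ⟨fun a ha => (mem_put ha).elim (fun h => h ▸ hvV) (hl a), fun s hs ho => ?_⟩
  obtain ⟨c, s', hexec, hc, hval, hreg, hout⟩ := RegExpr.exec_compile_scratch he hl hs
  refine ⟨_, _, .seq hexec (.seq (.const s' (scratch + 1) 0)
    (.add _ x.index scratch (scratch + 1))), ?_, fun i hi => ?_, hout.trans ho⟩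
  · have hne : scratch ≠ scratch + 1 := by simp
    simp only [State.set, Function.update_self, Function.update_of_ne hne, hval, Nat.size_zero]
    lia
  · have hlen : l.length ≤ scratch := by simp_all [RegExpr.admissible]
    rcases getD_put hx v hi with ⟨rfl, hi⟩ | ⟨hne, hil, hi⟩
    · simpa [State.set, hval, hv] using hi.symm
    · have hscratch : i < scratch := hil.trans_le hlen
      simp only [State.set, Function.update_of_ne hne, hi]
      rw [Function.update_of_ne (hscratch.trans (Nat.lt_succ_self _)).ne, hreg i hscratch, hs i hil]

theorem write (e : RegExpr) (v : ℕ) (hv : e.eval l = v)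
    (he : e.admissible l.length = true := by rfl) :
    Runs V (write e) l o 1 l (o ++ [v]) := by
  intro hl
  refine ⟨hl, fun s hs ho => ?_⟩
  obtain ⟨c, s', hexec, hc, hval, hreg, hout⟩ := RegExpr.exec_compile_scratch he hl hs
  have hlen : l.length ≤ scratch := by simp_all [RegExpr.admissible]
  refine ⟨_, _, .seq hexec (.emit s' scratch), ?_, hs.of_eq hlen hreg, by simp [hout, ho, hval, hv]⟩
  rw [hval]
  lia

theorem loop {x : ℕ} (k : ℕ) (inv g : ℕ → List ℕ) (o : List ℕ)
    (hx : ∀ j ≤ k, x < (inv j).length) (hne : ∀ j < k, (inv j).getD x 0 ≠ 0)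
    (hzero : (inv k).getD x 0 = 0)
    (hbody : ∀ j < k, ∀ o, Runs V P (inv j) o t (inv (j + 1)) (o ++ g j)) :
    Runs V (.loop x P) (inv 0) o (k * (t + 1) + 1) (inv k) (o ++ (List.range k).flatMap g) := by
  have hunit : V.size + 1 ≤ unitCost V := Nat.le_mul_of_pos_left _ (by norm_num)
  induction k generalizing inv g o with
  | zero =>
    intro hl
    refine ⟨hl, fun s hs ho => ⟨1, s, .loop_done ?_, by lia, hs, by simpa using ho⟩⟩
    rw [hs x (hx 0 le_rfl), hzero]
  | succ k ih =>
    intro hl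
    obtain ⟨hl₁, hfirst⟩ := hbody 0 (by lia) o hl
    obtain ⟨hl', hrest⟩ := ih (fun j => inv (j + 1)) (fun j => g (j + 1)) (o ++ g 0)
      (fun j hj => hx (j + 1) (by lia)) (fun j hj => hne (j + 1) (by lia)) hzero
      (fun j hj => hbody (j + 1) (by lia)) hl₁
    refine ⟨hl', fun s hs ho => ?_⟩
    obtain ⟨c, s', e, hc, hs', ho'⟩ := hfirst s hs ho
    obtain ⟨c', s'', e', hc', hs'', ho''⟩ := hrest s' hs' ho'
    have hreg : s.reg x = (inv 0).getD x 0 := hs x (hx 0 (by lia))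
    refine ⟨_, s'', .loop_step (by rw [hreg]; exact hne 0 (by lia)) e e', ?_, hs'', ?_⟩
    · have hsize : (s.reg x).size ≤ V.size := by
        rw [hreg, List.getD_eq_getElem _ _ (hx 0 (by lia))]
        exact Nat.size_le_size (hl _ (List.getElem_mem _))
      rw [show ((k + 1) * (t + 1) + 1) * unitCost V =
        unitCost V + t * unitCost V + (k * (t + 1) + 1) * unitCost V by ring]
      lia
    · rw [ho'', List.range_succ_eq_map, List.flatMap_cons, List.flatMap_map, List.append_assoc]

theorem times {x : Reg} (e : RegExpr) (k : ℕ) (inv g : ℕ → List ℕ) (o : List ℕ)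
    (he : e.eval (inv 0) = k) (hk : k ≤ V)
    (hbody : ∀ j < k, ∀ o, Runs V P (inv j ++ [k - j]) o t (inv (j + 1) ++ [k - j]) (o ++ g j))
    (hinv : ∀ j, (inv j).length = x.index := by intro; rfl)
    (hx : decide (x.index < scratch) = true := by rfl)
    (hok : e.admissible (inv 0).length = true := by rfl) :
    Runs V (times x e P) (inv 0) o (k * (t + 2) + 2) (inv k) (o ++ (List.range k).flatMap g) := by
  have hlt : x.index < scratch := of_decide_eq_true hx
  have hget (j : ℕ) : (inv j ++ [k - j]).getD x.index 0 = k - j := by simp [← hinv j]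
  have hround : ∀ j < k, ∀ o, Runs V (P ;; x ≔ x - 1) (inv j ++ [k - j]) o (t + 1)
      (inv (j + 1) ++ [k - (j + 1)]) (o ++ g j) := fun j hj o => by
    have hlen : (inv (j + 1) ++ [k - j]).length = x.index + 1 := by
      rw [List.length_append, hinv, List.length_singleton]
    refine ((hbody j hj o).seq (Runs.assign x (x - 1) (k - (j + 1)) ?_
      ((Nat.sub_le _ _).trans hk) ?_ ?_)).cast le_rfl ?_ rfl
    · change (inv (j + 1) ++ [k - j]).getD x.index 0 - 1 = _
      rw [← hinv (j + 1), List.getD_append_right _ _ _ _ le_rfl, Nat.sub_self]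
      rfl
    · simpa [hlen] using hlt
    · change RegExpr.admissible _ (.bin .sub (.var x.index) (.lit 1)) = true
      have hle : x.index + 1 ≤ scratch := hlt
      simp [RegExpr.admissible, RegExpr.varsLt, RegExpr.cost, RegExpr.width, hlen, hle]
    · rw [← hinv (j + 1), put_append_length]
  refine Runs.forget [k - k] ((Runs.seq (Runs.assign x e (k - 0) he hk ?_ hok) ?_).cast
    (t := 1 + (k * (t + 1 + 1) + 1)) (by lia) rfl rfl)
  · simpa [hinv] using hlt
  · rw [← hinv 0, put_length, hinv 0]
    exact Runs.loop k (fun j => inv j ++ [k - j]) g o (fun j _ => by simp [hinv])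
      (fun j hj => by rw [hget]; lia) (by rw [hget, Nat.sub_self]) hround

theorem outputsWithin (h : Runs V P l [] t l' o') (hl : ∀ a ∈ l, a ≤ V) :
    OutputsWithin P l o' (t * unitCost V) := by
  obtain ⟨c, s, hexec, hc, -, ho⟩ := (h hl).2 (init l) (fun _ _ => rfl) rfl
  exact ⟨c, s, hexec, ho, hc⟩

end Runs

end RAM

/-! ## The program that writes down the hitting set -/

namespace RAM

section Program

open Reg

/-- Computes `h = Nat.clog 2 d`, `2 ^ h` and `3 ^ h`. -/
def computeHeight : Prog :=
  two ≔ 1 ;; three ≔ 1 ;; h ≔ 0 ;; gap ≔ d - two ;;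
    .loop gap.index (two ≔ 2 * two ;; three ≔ 3 * three ;; h ≔ h + 1 ;; gap ≔ d - two)

/-- Computes `u = (r * (d + 1)) ^ 8`. -/
def computePower : Prog := u ≔ r * (d + 1) ;; u ≔ u * u ;; u ≔ u * u ;; u ≔ u * u

/-- Computes the parameters of the hitting set. -/
def computeParameters : Prog :=
  computePower ;; N ≔ 2 * (n * two * (two * u) + 1) ;; m ≔ 3 * three ;; B ≔ two * N + 1 ;;
    E ≔ d * (m * m) + 1 ;; Q ≔ 1 ;; times q h (Q ≔ Q * N)

/-- Computes the weight of the letter `i` at the current position. The digits of the seed are read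
from the most significant one on, as the recursion of `letterWeight` unwinds. -/
def computeWeight : Prog :=
  weight ≔ i + 1 ;; digit ≔ Q ;;
    times ctr h (digit ≔ digit / N ;;
      weight ≔ B * weight + (i + 1) * code % (q / digit % N + 1))

/-- Writes the term for the current position with `c = m - ctr`. -/
def writeTerm : Prog :=
  write 1 ;; write 0 ;; write 1 ;; write (E * weight + (m - ctr) * (m - conj % m)) ;;
    write (m - ctr) ;; write 1

/-- Writes the terms for the current position and moves on to the next one. -/
def writePosition : Prog :=
  computeWeight ;; times ctr m writeTerm ;; code ≔ code * (n + 1) ;; conj ≔ 2 * conj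

/-- Writes the coordinate `i` of the point with seed `q`, and increments `i`. -/
def writeCoordinate : Prog :=
  write (d * m) ;; code ≔ 1 ;; conj ≔ 1 ;; times kCtr d writePosition ;; i ≔ i + 1

/-- Writes the point with seed `q`, and increments `q`. -/
def writePoint : Prog :=
  i ≔ 0 ;; times iCtr n writeCoordinate ;; q ≔ q + 1

/-- Writes the division algebra and the hitting set. -/
def writeHittingSet : Prog :=
  computeHeight ;; computeParameters ;; write (2 * three) ;; write m ;; write 2 ;; write Q ;;
    q ≔ 0 ;; times qCtr Q writePoint

end Program

/-- The contents of the registers that stay constant while the points are written. -/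
def parameters (n r d h N : ℕ) : List ℕ :=
  [n, r, d, 2 ^ h, 3 ^ h, h, 0, ((r * (d + 1)) ^ 2) ^ 4, N, 3 ^ (h + 1), 2 ^ h * N + 1,
    pointScale h d, N ^ h]

/-- The number `V` bounds all register contents. -/
structure RegisterBound (V n r d h N : ℕ) : Prop where
  parameter_le : ∀ a ∈ parameters n r d h N, a ≤ V
  code_le : (n + 1) ^ d ≤ V
  conj_le : 2 ^ d ≤ V
  weight_le : (n + 1) * (2 ^ h * N + 1) ^ h ≤ V

/-- The written form of `pointTerm`. -/
def termCode (n h d N q i k c : ℕ) : List ℕ :=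
  [1, 0, 1, pointScale h d * letterWeight n (2 ^ h * N + 1) N h q k i +
    c * (3 ^ (h + 1) - 2 ^ k % 3 ^ (h + 1)), c, 1]

/-- The written form of a coordinate of a point. -/
def coordinateCode (n h d N q i : ℕ) : List ℕ :=
  (d * 3 ^ (h + 1)) :: (List.range d).flatMap fun k =>
    (List.range (3 ^ (h + 1))).flatMap (termCode n h d N q i k)

section Points

variable {V n r d h N q i k b b' b'' : ℕ} {o : List ℕ}

theorem letterWeight_add_one_le (B : ℕ) (hN : 0 < N) (hB : N ≤ B) (j : ℕ) :
    letterWeight n B N j q k i + 1 ≤ (i + 2) * B ^ j := by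
  induction j generalizing q with
  | zero => simp [letterWeight]
  | succ j ih =>
    have hdigit := Nat.mod_lt q hN
    have hmod := Nat.mod_lt (letterCode n k i) (q % N).succ_pos
    calc letterWeight n B N (j + 1) q k i + 1 ≤ B * letterWeight n B N j (q / N) k i + B := by
          rw [letterWeight]
          lia
      _ = B * (letterWeight n B N j (q / N) k i + 1) := (Nat.mul_succ _ _).symm
      _ ≤ B * ((i + 2) * B ^ j) := Nat.mul_le_mul_left B ih
      _ = (i + 2) * B ^ (j + 1) := by ring

theorem RegisterBound.letterWeight_le (hV : RegisterBound V n r d h N) (hN : 0 < N) (hi : i < n)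
    {j : ℕ} (hj : j ≤ h) : letterWeight n (2 ^ h * N + 1) N j q k i ≤ V := by
  have hB : N ≤ 2 ^ h * N + 1 := (Nat.le_mul_of_pos_left N (by positivity)).trans (Nat.le_succ _)
  calc letterWeight n (2 ^ h * N + 1) N j q k i ≤ (i + 2) * (2 ^ h * N + 1) ^ j :=
        (Nat.le_succ _).trans (letterWeight_add_one_le _ hN hB j)
    _ ≤ (n + 1) * (2 ^ h * N + 1) ^ h :=
        Nat.mul_le_mul (by lia) (Nat.pow_le_pow_right (Nat.succ_pos _) hj)
    _ ≤ V := hV.weight_le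

theorem runs_computeWeight (hV : RegisterBound V n r d h N) (hN : 0 < N) (hi : i < n) :
    Runs V computeWeight (parameters n r d h N ++ [q, b, i, b', (n + 1) ^ k, 2 ^ k, b'']) o
      (h * 4 + 4) (parameters n r d h N ++ [q, b, i, b', (n + 1) ^ k, 2 ^ k, b'',
        letterWeight n (2 ^ h * N + 1) N h q k i, 1]) o := by
  have hpow {j : ℕ} (hj : j ≤ h) : N ^ j ≤ V :=
    (Nat.pow_le_pow_right hN hj).trans (hV.parameter_le _ (by simp [parameters]))
  have hround (j : ℕ) (hj : j < h) : N ^ (h - j) / N = N ^ (h - (j + 1)) := by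
    rw [show h - j = h - (j + 1) + 1 by lia, pow_succ, Nat.mul_div_cancel _ hN]
  have hdigit (j : ℕ) (hj : j < h) : q / N ^ (h - (j + 1)) / N = q / N ^ (h - j) := by
    rw [Nat.div_div_eq_div_mul, ← pow_succ, show h - (j + 1) + 1 = h - j by lia]
  refine ((Runs.assign .weight _ (letterWeight n (2 ^ h * N + 1) N 0 (q / N ^ (h - 0)) k i) rfl
    (hV.letterWeight_le hN hi (Nat.zero_le h))).seq ((Runs.assign .digit _ (N ^ (h - 0)) rfl
    (hpow le_rfl)).seq (Runs.times _ h (fun j => parameters n r d h N ++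
      [q, b, i, b', (n + 1) ^ k, 2 ^ k, b'',
        letterWeight n (2 ^ h * N + 1) N j (q / N ^ (h - j)) k i, N ^ (h - j)])
      (fun _ => []) _ rfl (hV.parameter_le _ (by simp [parameters])) fun j hj o => ?_))).cast
    (t := 1 + (1 + (h * (2 + 2) + 2))) (by lia) (by simp) (by simp)
  refine ((Runs.assign .digit _ (N ^ (h - (j + 1))) ?_ (hpow (Nat.sub_le _ _))).seq
    (Runs.assign .weight _ (letterWeight n (2 ^ h * N + 1) N (j + 1) (q / N ^ (h - (j + 1))) k i)
      ?_ (hV.letterWeight_le hN hi hj))).cast le_rfl rfl (by simp)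
  · exact hround j hj
  rw [letterWeight, hdigit j hj, Nat.mod_eq_sub, Nat.mod_eq_sub]
  rfl

theorem runs_writeTerm {c : ℕ} (hc : c ≤ 3 ^ (h + 1)) :
    Runs V writeTerm (parameters n r d h N ++ [q, b, i, b', (n + 1) ^ k, 2 ^ k, b'',
        letterWeight n (2 ^ h * N + 1) N h q k i, 1] ++ [3 ^ (h + 1) - c]) o
      6 (parameters n r d h N ++ [q, b, i, b', (n + 1) ^ k, 2 ^ k, b'',
        letterWeight n (2 ^ h * N + 1) N h q k i, 1] ++ [3 ^ (h + 1) - c])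
      (o ++ termCode n h d N q i k c) := by
  have hctr : 3 ^ (h + 1) - (3 ^ (h + 1) - c) = c := Nat.sub_sub_self hc
  refine ((Runs.write 1 1 rfl).seq ((Runs.write 0 0 rfl).seq ((Runs.write 1 1 rfl).seq
    ((Runs.write _ (pointScale h d * letterWeight n (2 ^ h * N + 1) N h q k i +
      c * (3 ^ (h + 1) - 2 ^ k % 3 ^ (h + 1))) ?_).seq ((Runs.write _ c ?_).seq
        (Runs.write 1 1 rfl)))))).cast le_rfl rfl (by simp [termCode])
  · conv_rhs => rw [← hctr, Nat.mod_eq_sub]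
    rfl
  · exact hctr

theorem runs_writePosition (hV : RegisterBound V n r d h N) (hN : 0 < N) (hi : i < n)
    (hk : k < d) :
    Runs V writePosition (parameters n r d h N ++ [q, b, i, b', (n + 1) ^ k, 2 ^ k, b'']) o
      (4 * h + 8 * 3 ^ (h + 1) + 8)
      (parameters n r d h N ++ [q, b, i, b', (n + 1) ^ (k + 1), 2 ^ (k + 1), b''])
      (o ++ (List.range (3 ^ (h + 1))).flatMap (termCode n h d N q i k)) := by
  refine Runs.forget [letterWeight n (2 ^ h * N + 1) N h q k i, 1]
    (((runs_computeWeight hV hN hi).seq ((Runs.times _ (3 ^ (h + 1)) (fun _ => _) _ o rfl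
      (hV.parameter_le _ (by simp [parameters]))
      fun c hc o => runs_writeTerm hc.le).seq ((Runs.assign .code _ ((n + 1) ^ (k + 1)) rfl
        ((Nat.pow_le_pow_right (Nat.succ_pos n) hk).trans hV.code_le)).seq
          (Runs.assign .conj _ (2 ^ (k + 1)) ?_
            ((Nat.pow_le_pow_right two_pos hk).trans hV.conj_le))))).cast
    (t := h * 4 + 4 + (3 ^ (h + 1) * (6 + 2) + 2 + (1 + 1))) (by lia) rfl rfl)
  exact (pow_succ' 2 k).symm

theorem runs_writeCoordinate (hV : RegisterBound V n r d h N) (hN : 0 < N) (hi : i < n) :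
    Runs V writeCoordinate (parameters n r d h N ++ [q, b, i, b']) o
      (d * (4 * h + 8 * 3 ^ (h + 1) + 10) + 6) (parameters n r d h N ++ [q, b, i + 1, b'])
      (o ++ coordinateCode n h d N q i) := by
  have hn : n ≤ V := hV.parameter_le _ (by simp [parameters])
  have hd : d ≤ V := hV.parameter_le _ (by simp [parameters])
  have hone : 1 ≤ V := Nat.one_le_two_pow.trans hV.conj_le
  exact Runs.forget [(n + 1) ^ d, 2 ^ d]
    (((Runs.write _ (d * 3 ^ (h + 1)) rfl).seq ((Runs.assign .code 1 ((n + 1) ^ 0) rfl hone).seq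
      ((Runs.assign .conj 1 (2 ^ 0) rfl hone).seq ((Runs.times _ d
        (fun k => parameters n r d h N ++ [q, b, i, b', (n + 1) ^ k, 2 ^ k]) _ _ rfl hd
        fun k hk o => runs_writePosition hV hN hi hk).seq
          (Runs.assign .i _ (i + 1) rfl (hi.trans_le hn)))))).cast
      (t := 1 + (1 + (1 + (d * (4 * h + 8 * 3 ^ (h + 1) + 8 + 2) + 2 + 1)))) (by lia) rfl
      (by simp [coordinateCode]))

theorem runs_writePoint (hV : RegisterBound V n r d h N) (hN : 0 < N) (hq : q < N ^ h) :
    Runs V writePoint (parameters n r d h N ++ [q, b]) o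
      (n * (d * (4 * h + 8 * 3 ^ (h + 1) + 10) + 8) + 4) (parameters n r d h N ++ [q + 1, b])
      (o ++ (List.range n).flatMap (coordinateCode n h d N q)) := by
  have hn : n ≤ V := hV.parameter_le _ (by simp [parameters])
  have hQ : N ^ h ≤ V := hV.parameter_le _ (by simp [parameters])
  exact Runs.forget [n] (((Runs.assign .i 0 0 rfl (Nat.zero_le V)).seq ((Runs.times _ n
    (fun i => parameters n r d h N ++ [q, b, i]) _ o rfl hn
    fun i hi o => runs_writeCoordinate hV hN hi).seq
      (Runs.assign .q _ (q + 1) rfl (hq.trans_le hQ)))).cast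
    (t := 1 + (n * (d * (4 * h + 8 * 3 ^ (h + 1) + 10) + 6 + 2) + 2 + 1)) (by lia) rfl rfl)

end Points

section Main

variable {V n r d h N : ℕ} {o : List ℕ}

theorem runs_computeHeight (hh : Nat.clog 2 d = h) (hV : RegisterBound V n r d h N) :
    Runs V computeHeight [n, r, d] o (h * 5 + 5) [n, r, d, 2 ^ h, 3 ^ h, h, 0] o := by
  have hd : d ≤ V := hV.parameter_le _ (by simp [parameters])
  have two_le {j : ℕ} (hj : j ≤ h) : 2 ^ j ≤ V :=
    (Nat.pow_le_pow_right two_pos hj).trans (hV.parameter_le _ (by simp [parameters]))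
  have three_le {j : ℕ} (hj : j ≤ h) : 3 ^ j ≤ V :=
    (Nat.pow_le_pow_right three_pos hj).trans (hV.parameter_le _ (by simp [parameters]))
  have le_V {j : ℕ} (hj : j ≤ h) : j ≤ V := hj.trans (hV.parameter_le _ (by simp [parameters]))
  have hgap (j : ℕ) : d - 2 ^ j ≤ V := (Nat.sub_le _ _).trans hd
  have hlt (j : ℕ) (hj : j < h) : 2 ^ j < d :=
    Nat.pow_lt_of_lt_clog (hj.trans_eq hh.symm)
  have hzero : d - 2 ^ h = 0 := Nat.sub_eq_zero_of_le (hh ▸ Nat.le_pow_clog one_lt_two d)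
  refine ((Runs.assign .two 1 (2 ^ 0) rfl (two_le (Nat.zero_le h))).seq
    ((Runs.assign .three 1 (3 ^ 0) rfl (three_le (Nat.zero_le h))).seq
      ((Runs.assign .h 0 0 rfl (Nat.zero_le V)).seq ((Runs.assign .gap _ (d - 2 ^ 0) rfl
        (hgap 0)).seq (Runs.loop (x := Reg.gap.index) h
          (fun j => [n, r, d, 2 ^ j, 3 ^ j, j, d - 2 ^ j]) (fun _ => []) o
          (fun _ _ => Nat.lt_succ_self 6) (fun j hj => Nat.sub_ne_zero_of_lt (hlt j hj)) hzero
          fun j hj o => ?_))))).cast (t := 1 + (1 + (1 + (1 + (h * (4 + 1) + 1))))) (by lia)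
    (by rw [hzero]) (by simp)
  have htwo : 2 * 2 ^ j = 2 ^ (j + 1) := (pow_succ' 2 j).symm
  have hthree : 3 * 3 ^ j = 3 ^ (j + 1) := (pow_succ' 3 j).symm
  refine ((Runs.assign .two _ (2 ^ (j + 1)) ?_ (two_le hj)).seq ((Runs.assign .three _
    (3 ^ (j + 1)) ?_ (three_le hj)).seq ((Runs.assign .h _ (j + 1) rfl (le_V hj)).seq
      (Runs.assign .gap _ (d - 2 ^ (j + 1)) rfl (hgap _))))).cast le_rfl rfl (by simp)
  · exact htwo
  · exact hthree

theorem runs_computePower (hV : ((r * (d + 1)) ^ 2) ^ 4 ≤ V) :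
    Runs V computePower [n, r, d, 2 ^ h, 3 ^ h, h, 0] o 4
      [n, r, d, 2 ^ h, 3 ^ h, h, 0, ((r * (d + 1)) ^ 2) ^ 4] o := by
  have hsq {a : ℕ} : a ≤ a * a := Nat.le_mul_self a
  obtain ⟨x, hx⟩ : ∃ x, r * (d + 1) = x := ⟨_, rfl⟩
  rw [hx, show (x ^ 2) ^ 4 = x * x * (x * x) * (x * x * (x * x)) by ring] at hV ⊢
  refine ((Runs.assign .u _ x ?_ (hsq.trans (hsq.trans (hsq.trans hV)))).seq
    ((Runs.assign .u _ (x * x) rfl (hsq.trans (hsq.trans hV))).seq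
      ((Runs.assign .u _ (x * x * (x * x)) rfl (hsq.trans hV)).seq
        (Runs.assign .u _ (x * x * (x * x) * (x * x * (x * x))) rfl hV)))).cast
    (t := 1 + (1 + (1 + 1))) le_rfl rfl rfl
  exact hx

theorem runs_computeParameters (hN : pointModulus n r d h = N) (hV : RegisterBound V n r d h N) :
    Runs V computeParameters [n, r, d, 2 ^ h, 3 ^ h, h, 0] o (h * 3 + 11)
      (parameters n r d h N) o := by
  have hN_le : N ≤ V := hV.parameter_le _ (by simp [parameters])
  have hm_le : 3 ^ (h + 1) ≤ V := hV.parameter_le _ (by simp [parameters])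
  have hB_le : 2 ^ h * N + 1 ≤ V := hV.parameter_le _ (by simp [parameters])
  have hE_le : pointScale h d ≤ V := hV.parameter_le _ (by simp [parameters])
  have hpow_le {j : ℕ} (hj : j ≤ h) : N ^ j ≤ V :=
    (Nat.pow_le_pow_right (hN ▸ Nat.succ_pos _) hj).trans
      (hV.parameter_le _ (by simp [parameters]))
  have hm : 3 * 3 ^ h = 3 ^ (h + 1) := (pow_succ' 3 h).symm
  refine ((runs_computePower (hV.parameter_le _ (by simp [parameters]))).seq
    ((Runs.assign .N _ N ?_ hN_le).seq ((Runs.assign .m _ (3 ^ (h + 1)) ?_ hm_le).seq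
    ((Runs.assign .B _ (2 ^ h * N + 1) rfl hB_le).seq
    ((Runs.assign .E _ (pointScale h d) rfl hE_le).seq
    ((Runs.assign .Q 1 (N ^ 0) rfl (hpow_le (Nat.zero_le h))).seq (Runs.times _ h
      (fun j => [n, r, d, 2 ^ h, 3 ^ h, h, 0, ((r * (d + 1)) ^ 2) ^ 4, N, 3 ^ (h + 1),
        2 ^ h * N + 1, pointScale h d, N ^ j]) (fun _ => []) o rfl
      (hV.parameter_le _ (by simp [parameters])) fun j hj o =>
        (Runs.assign .Q _ (N ^ (j + 1)) rfl (hpow_le hj)).cast le_rfl rfl (by simp)))))))).cast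
    (t := 4 + (1 + (1 + (1 + (1 + (1 + (h * (1 + 2) + 2))))))) (by lia) rfl (by simp)
  · exact hN
  · exact hm

theorem runs_writeHittingSet (hh : Nat.clog 2 d = h) (hN : pointModulus n r d h = N)
    (hV : RegisterBound V n r d h N) :
    Runs V writeHittingSet [n, r, d] [] (N ^ h *
        (n * (d * (4 * h + 8 * 3 ^ (h + 1) + 10) + 8) + 6) + 8 * h + 23) (parameters n r d h N)
      ([2 * 3 ^ h, 3 ^ (h + 1), 2, N ^ h] ++ (List.range (N ^ h)).flatMap fun q =>
        (List.range n).flatMap (coordinateCode n h d N q)) := by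
  have hN0 : 0 < N := hN ▸ Nat.succ_pos _
  have hQ : N ^ h ≤ V := hV.parameter_le _ (by simp [parameters])
  refine Runs.forget [N ^ h] (((runs_computeHeight hh hV).seq
    ((runs_computeParameters hN hV).seq ((Runs.write _ (2 * 3 ^ h) rfl).seq
      ((Runs.write _ (3 ^ (h + 1)) rfl).seq ((Runs.write _ 2 rfl).seq
        ((Runs.write _ (N ^ h) rfl).seq ((Runs.assign .q 0 0 rfl (Nat.zero_le V)).seq
          (Runs.times _ (N ^ h) (fun q => parameters n r d h N ++ [q])
            _ _ rfl hQ fun q hq o => runs_writePoint hV hN0 hq)))))))).cast ?_ rfl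
              (by simp))
  lia

end Main

end RAM

/-! ## The written form of the hitting set -/

theorem encodeElem_pointTerms (n h d N q : ℕ) (i : Fin n) :
    encodeElem (pointTerms n h d N q i) = RAM.coordinateCode n h d N q i := by
  have hlen : (pointTerms n h d N q i).length = d * 3 ^ (h + 1) := by
    simp [pointTerms, List.length_flatMap]
  rw [encodeElem, hlen, RAM.coordinateCode, pointTerms, List.flatMap_assoc]
  simp only [List.flatMap_map]
  rfl

/-- The points of the hitting set as lists of terms, in the order in which they are written. -/
def hittingPoints (n h d N : ℕ) : List (Fin n → List DTerm) :=
  (List.range (N ^ h)).map (pointTerms n h d N)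

theorem encodeOutput_hittingPoints (n h d N : ℕ) :
    encodeOutput (2 * 3 ^ h) (3 ^ (h + 1)) 2 (hittingPoints n h d N) =
      [2 * 3 ^ h, 3 ^ (h + 1), 2, N ^ h] ++ (List.range (N ^ h)).flatMap fun q =>
        (List.range n).flatMap (RAM.coordinateCode n h d N q) := by
  have hpoint (q : ℕ) : (List.ofFn (pointTerms n h d N q)).flatMap encodeElem =
      (List.range n).flatMap (RAM.coordinateCode n h d N q) := by
    rw [List.ofFn_eq_map, List.flatMap_map, ← List.map_coe_finRange_eq_range, List.flatMap_map]
    simp only [encodeElem_pointTerms]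
  simp [encodeOutput, hittingPoints, List.flatMap_map, hpoint]

open Classical in
/-- The hitting set: one point of `D ^ n` for every seed `q < N ^ h`. -/
noncomputable def hittingSet (n h d N : ℕ) : Finset (Fin n → CyclicD (sigma h) (2 * 3 ^ h)) :=
  (Finset.range (N ^ h)).image fun q =>
    pointValue (sigma h) (2 * 3 ^ h) (omega h) (pointTerms n h d N q)

theorem mem_hittingSet {n h d N : ℕ} {q : Fin n → CyclicD (sigma h) (2 * 3 ^ h)} :
    q ∈ hittingSet n h d N ↔
      ∃ p ∈ hittingPoints n h d N, pointValue (sigma h) (2 * 3 ^ h) (omega h) p = q := by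
  simp [hittingSet, hittingPoints]

open Classical in
theorem card_hittingSet_le (n h d N : ℕ) : (hittingSet n h d N).card ≤ N ^ h :=
  Finset.card_image_le.trans (Finset.card_range _).le

theorem isHittingSet_hittingSet {n r d h N : ℕ} (hd : d ≤ 2 ^ h)
    (hN : pointModulus n r d h ≤ N) : IsHittingSet (abpClass n r d) (hittingSet n h d N) := by
  intro f hf hf0
  obtain ⟨q, hq, hne⟩ := exists_lift_pointValue_ne_zero hd hN hf hf0
  exact ⟨_, mem_hittingSet.2 ⟨_, List.mem_map_of_mem (List.mem_range.2 hq), rfl⟩, hne⟩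

/-! ## Size and running time -/

theorem three_pow_le (h : ℕ) : 3 ^ h ≤ (2 ^ h) ^ 2 := by
  rw [← pow_mul, mul_comm, pow_mul]
  exact Nat.pow_le_pow_left (by norm_num) h

section Size

variable {n r d : ℕ}

theorem two_pow_clog_le (hd : 1 ≤ d) : 2 ^ Nat.clog 2 d ≤ 2 * d := by
  have hclog : Nat.clog 2 d ≤ Nat.log 2 d + 1 :=
    Nat.clog_le_of_le_pow (Nat.lt_pow_succ_log_self one_lt_two d).le
  calc 2 ^ Nat.clog 2 d ≤ 2 ^ (Nat.log 2 d + 1) := Nat.pow_le_pow_right two_pos hclog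
    _ = 2 * 2 ^ Nat.log 2 d := pow_succ' 2 _
    _ ≤ 2 * d := Nat.mul_le_mul_left 2 (Nat.pow_log_le_self 2 (by lia))

theorem clog_le_two_mul_log_succ (hd : 1 ≤ d) : Nat.clog 2 d ≤ 2 * Nat.log 2 (d + 1) := by
  have hlog : 1 ≤ Nat.log 2 (d + 1) := Nat.log_pos one_lt_two (by lia)
  refine Nat.clog_le_of_le_pow ((Nat.le_succ d).trans ?_)
  exact (Nat.lt_pow_succ_log_self one_lt_two (d + 1)).le.trans
    (Nat.pow_le_pow_right two_pos (by lia))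

theorem index_le (hn : 1 ≤ n) (hr : 1 ≤ r) (hd : 1 ≤ d) :
    2 * 3 ^ Nat.clog 2 d ≤ (n * r * d + 1) ^ 5 := by
  set x := n * r * d + 1
  have hdx : d + 1 ≤ x := Nat.succ_le_succ (Nat.le_mul_of_pos_left d (Nat.mul_pos hn hr))
  have htwo : 2 ^ Nat.clog 2 d ≤ x ^ 2 := (two_pow_clog_le hd).trans (by nlinarith)
  calc 2 * 3 ^ Nat.clog 2 d ≤ x * (x ^ 2) ^ 2 :=
        Nat.mul_le_mul (by lia) ((three_pow_le _).trans (Nat.pow_le_pow_left htwo 2))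
    _ = x ^ 5 := by ring

theorem pointModulus_le (hn : 1 ≤ n) (hr : 1 ≤ r) (hd : 1 ≤ d) :
    pointModulus n r d (Nat.clog 2 d) ≤ (n * r * (d + 1)) ^ 15 := by
  set b := n * r * (d + 1) with hb
  have hdb : d + 1 ≤ b := Nat.le_mul_of_pos_left _ (Nat.mul_pos hn hr)
  have hrb : r * (d + 1) ≤ b := by
    rw [hb, mul_assoc]
    exact Nat.le_mul_of_pos_left _ hn
  have hnb : n ≤ b := by
    rw [hb, mul_assoc]
    exact Nat.le_mul_of_pos_right _ (Nat.mul_pos hr d.succ_pos)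
  have htwo : 2 ^ Nat.clog 2 d ≤ b ^ 2 := (two_pow_clog_le hd).trans (by nlinarith)
  have hone : 1 ≤ b ^ 13 := Nat.one_le_pow _ _ (by lia)
  have hfour : 2 * 2 ≤ b * b := Nat.mul_le_mul (by lia) (by lia)
  calc pointModulus n r d (Nat.clog 2 d)
      ≤ 2 * (b * b ^ 2 * (b ^ 2 * (b ^ 2) ^ 4) + 1) := by
        unfold pointModulus
        gcongr
    _ = 2 * (b ^ 13 + 1) := by ring
    _ ≤ 2 * 2 * b ^ 13 := by lia
    _ ≤ b * b * b ^ 13 := Nat.mul_le_mul_right _ hfour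
    _ = b ^ 15 := by ring

theorem pointModulus_pow_le (hn : 1 ≤ n) (hr : 1 ≤ r) (hd : 1 ≤ d) :
    pointModulus n r d (Nat.clog 2 d) ^ Nat.clog 2 d ≤
      (n * r * (d + 1)) ^ (30 * Nat.log 2 (d + 1)) := by
  have hclog := clog_le_two_mul_log_succ hd
  calc pointModulus n r d (Nat.clog 2 d) ^ Nat.clog 2 d
      ≤ ((n * r * (d + 1)) ^ 15) ^ Nat.clog 2 d :=
        Nat.pow_le_pow_left (pointModulus_le hn hr hd) _
    _ = (n * r * (d + 1)) ^ (15 * Nat.clog 2 d) := (pow_mul _ _ _).symm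
    _ ≤ (n * r * (d + 1)) ^ (30 * Nat.log 2 (d + 1)) :=
        Nat.pow_le_pow_right (Nat.mul_pos (Nat.mul_pos hn hr) d.succ_pos) (by lia)

end Size

theorem add_le_two_pow {a b x y : ℕ} (ha : a ≤ 2 ^ x) (hb : b ≤ 2 ^ x) (hy : x + 1 ≤ y) :
    a + b ≤ 2 ^ y := by
  have hpow : 2 ^ (x + 1) ≤ 2 ^ y := Nat.pow_le_pow_right two_pos hy
  rw [pow_succ] at hpow
  lia

theorem mul_le_two_pow {a b x y z : ℕ} (ha : a ≤ 2 ^ x) (hb : b ≤ 2 ^ y) (hz : x + y ≤ z) :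
    a * b ≤ 2 ^ z :=
  (Nat.mul_le_mul ha hb).trans ((pow_add 2 x y).symm.trans_le (Nat.pow_le_pow_right two_pos hz))

theorem pow_le_two_pow {a k x z : ℕ} (ha : a ≤ 2 ^ x) (hz : x * k ≤ z) : a ^ k ≤ 2 ^ z :=
  (Nat.pow_le_pow_left ha k).trans
    ((pow_mul 2 x k).symm.trans_le (Nat.pow_le_pow_right two_pos hz))

theorem le_two_pow_of_le {a x z : ℕ} (ha : a ≤ 2 ^ x) (hz : x ≤ z) : a ≤ 2 ^ z :=
  ha.trans (Nat.pow_le_pow_right two_pos hz)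

section Time

variable {n r d h t : ℕ}

theorem three_pow_succ_le_two_pow (ht : 1 ≤ t) (hh : h ≤ t) : 3 ^ (h + 1) ≤ 2 ^ (4 * t) :=
  (three_pow_le _).trans ((pow_mul 2 _ 2).symm.trans_le (Nat.pow_le_pow_right two_pos (by lia)))

theorem pointScale_le_two_pow (ht : 1 ≤ t) (hd : d ≤ 2 ^ t) (hh : h ≤ t) :
    pointScale h d ≤ 2 ^ (10 * t) := by
  have hm := three_pow_succ_le_two_pow ht hh
  exact add_le_two_pow (mul_le_two_pow hd (mul_le_two_pow hm hm le_rfl) le_rfl)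
    Nat.one_le_two_pow (by lia)

theorem pointModulus_le_two_pow (ht : 1 ≤ t) (hn : n ≤ 2 ^ t) (hr : r ≤ 2 ^ t)
    (hd : d + 1 ≤ 2 ^ t) (hh : h ≤ t) : pointModulus n r d h ≤ 2 ^ (21 * t) := by
  have htwo : 2 ^ h ≤ 2 ^ t := Nat.pow_le_pow_right two_pos hh
  have hpow : ((r * (d + 1)) ^ 2) ^ 4 ≤ 2 ^ (16 * t) :=
    pow_le_two_pow (pow_le_two_pow (mul_le_two_pow hr hd le_rfl) le_rfl) (by lia)
  exact mul_le_two_pow (x := 1) le_rfl (add_le_two_pow (x := 19 * t)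
    (mul_le_two_pow (mul_le_two_pow hn htwo le_rfl) (mul_le_two_pow htwo hpow le_rfl) (by lia))
    Nat.one_le_two_pow le_rfl) (by lia)

theorem pow_le_two_pow_sq {a x : ℕ} (ha : a ≤ 2 ^ (x * t)) (hh : h ≤ t) :
    a ^ h ≤ 2 ^ (x * t ^ 2) :=
  pow_le_two_pow ha (by rw [pow_two, ← mul_assoc]; exact Nat.mul_le_mul_left _ hh)

theorem registerBound (ht : 1 ≤ t) (hn : n + 1 ≤ 2 ^ t) (hr : r ≤ 2 ^ t) (hd : d + 1 ≤ 2 ^ t)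
    (hh : h ≤ t) : RAM.RegisterBound (2 ^ (50 * t * 2 ^ t)) n r d h (pointModulus n r d h) := by
  set A := 50 * t * 2 ^ t with hA
  have hsq : t ≤ t ^ 2 := Nat.le_self_pow two_ne_zero t
  have hA_sq : 50 * t ^ 2 ≤ A := by
    rw [hA, pow_two, ← mul_assoc]
    exact Nat.mul_le_mul_left _ Nat.lt_two_pow_self.le
  have hA_d : t * d ≤ A := Nat.mul_le_mul (by lia) (by lia)
  have hd_A : d ≤ A := (Nat.le_mul_of_pos_left d ht).trans hA_d
  have hN := pointModulus_le_two_pow ht (Nat.le_of_succ_le hn) hr hd hh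
  have htwo : 2 ^ h ≤ 2 ^ t := Nat.pow_le_pow_right two_pos hh
  have hB : 2 ^ h * pointModulus n r d h + 1 ≤ 2 ^ (23 * t) :=
    add_le_two_pow (mul_le_two_pow htwo hN le_rfl) Nat.one_le_two_pow (by lia)
  refine ⟨?_, pow_le_two_pow hn hA_d, Nat.pow_le_pow_right two_pos hd_A,
    mul_le_two_pow hn (pow_le_two_pow_sq hB hh) (by lia)⟩
  have hm := three_pow_succ_le_two_pow ht hh
  have hthree : 3 ^ h ≤ 2 ^ (4 * t) := (Nat.pow_le_pow_right three_pos h.le_succ).trans hm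
  have hpow : ((r * (d + 1)) ^ 2) ^ 4 ≤ 2 ^ (16 * t) :=
    pow_le_two_pow (pow_le_two_pow (mul_le_two_pow hr hd le_rfl) le_rfl) (by lia)
  have hh' : h ≤ 2 ^ t := hh.trans Nat.lt_two_pow_self.le
  simp only [RAM.parameters, List.forall_mem_cons, List.not_mem_nil, IsEmpty.forall_iff,
    implies_true, and_true]
  exact ⟨le_two_pow_of_le (Nat.le_of_succ_le hn) (by lia), le_two_pow_of_le hr (by lia),
    le_two_pow_of_le (Nat.le_of_succ_le hd) (by lia), le_two_pow_of_le htwo (by lia),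
    le_two_pow_of_le hthree (by lia), le_two_pow_of_le hh' (by lia), Nat.zero_le _,
    le_two_pow_of_le hpow (by lia), le_two_pow_of_le hN (by lia), le_two_pow_of_le hm (by lia),
    le_two_pow_of_le hB (by lia),
    le_two_pow_of_le (pointScale_le_two_pow ht (Nat.le_of_succ_le hd) hh) (by lia),
    le_two_pow_of_le (pow_le_two_pow_sq hN hh) (by lia)⟩

theorem unitCost_le (ht : 1 ≤ t) : RAM.unitCost (2 ^ (50 * t * 2 ^ t)) ≤ 2 ^ (19 * t) := by
  rw [RAM.unitCost, Nat.size_pow]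
  have hlength : 50 * t * 2 ^ t ≤ 2 ^ (8 * t) :=
    mul_le_two_pow (x := 7 * t) (mul_le_two_pow (x := 6) (by norm_num) Nat.lt_two_pow_self.le
      (by lia)) le_rfl (by lia)
  exact mul_le_two_pow (x := 9) (by norm_num) (add_le_two_pow (x := 9 * t)
    (add_le_two_pow hlength Nat.one_le_two_pow (by lia)) Nat.one_le_two_pow le_rfl) (by lia)

theorem steps_le {N : ℕ} (ht : 1 ≤ t) (hn : n ≤ 2 ^ t) (hd : d ≤ 2 ^ t) (hh : h ≤ t)
    (hN : N ≤ 2 ^ (21 * t)) :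
    N ^ h * (n * (d * (4 * h + 8 * 3 ^ (h + 1) + 10) + 8) + 6) + 8 * h + 23 ≤
      2 ^ (40 * t ^ 2) := by
  have hsq : t ≤ t ^ 2 := Nat.le_self_pow two_ne_zero t
  have hh' : h ≤ 2 ^ t := hh.trans Nat.lt_two_pow_self.le
  have const_le {k : ℕ} (x : ℕ) (hk : k ≤ 2 ^ 5) (hx : 5 ≤ x) : k ≤ 2 ^ x :=
    le_two_pow_of_le hk hx
  have hposition : 4 * h + 8 * 3 ^ (h + 1) + 10 ≤ 2 ^ (9 * t) :=
    add_le_two_pow (x := 8 * t) (add_le_two_pow (x := 7 * t)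
      (mul_le_two_pow (x := 2) le_rfl hh' (by lia))
      (mul_le_two_pow (x := 3) le_rfl (three_pow_succ_le_two_pow ht hh) (by lia)) (by lia))
      (const_le _ (by norm_num) (by lia)) (by lia)
  have hcoordinate : d * (4 * h + 8 * 3 ^ (h + 1) + 10) + 8 ≤ 2 ^ (11 * t) :=
    add_le_two_pow (x := 10 * t) (mul_le_two_pow hd hposition (by lia))
      (const_le _ (by norm_num) (by lia)) (by lia)
  have hpoint : n * (d * (4 * h + 8 * 3 ^ (h + 1) + 10) + 8) + 6 ≤ 2 ^ (13 * t) :=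
    add_le_two_pow (x := 12 * t) (mul_le_two_pow hn hcoordinate (by lia))
      (const_le _ (by norm_num) (by lia)) (by lia)
  exact add_le_two_pow (x := 35 * t ^ 2) (add_le_two_pow (x := 34 * t ^ 2)
    (mul_le_two_pow (pow_le_two_pow_sq hN hh) hpoint (by lia))
    (mul_le_two_pow (x := 3) le_rfl hh' (by lia)) (by lia))
    (const_le _ (by norm_num) (by lia)) (by lia)

end Time

theorem outputsWithin_writeHittingSet {n r d : ℕ} (hn : 1 ≤ n) (hr : 1 ≤ r) (hd : 1 ≤ d) :
    RAM.OutputsWithin RAM.writeHittingSet [n, r, d]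
      (encodeOutput (2 * 3 ^ Nat.clog 2 d) (3 ^ (Nat.clog 2 d + 1)) 2
        (hittingPoints n (Nat.clog 2 d) d (pointModulus n r d (Nat.clog 2 d))))
      (2 ^ (60 * (Nat.log 2 (n * r * d) + 1) ^ 2)) := by
  set t := Nat.log 2 (n * r * d) + 1
  have ht : 1 ≤ t := Nat.succ_pos _
  have hlt : n * r * d < 2 ^ t := Nat.lt_pow_succ_log_self one_lt_two _
  have hn_t : n + 1 ≤ 2 ^ t :=
    (Nat.succ_le_succ
      (by rw [mul_assoc]; exact Nat.le_mul_of_pos_right n (by positivity))).trans hlt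
  have hr_t : r ≤ 2 ^ t :=
    ((Nat.le_mul_of_pos_left r hn).trans (Nat.le_mul_of_pos_right _ hd)).trans hlt.le
  have hd_t : d + 1 ≤ 2 ^ t :=
    (Nat.succ_le_succ (Nat.le_mul_of_pos_left d (Nat.mul_pos hn hr))).trans hlt
  have hh : Nat.clog 2 d ≤ t := Nat.clog_le_of_le_pow (Nat.le_of_succ_le hd_t)
  have hV := registerBound ht hn_t hr_t hd_t hh
  rw [encodeOutput_hittingPoints]
  obtain ⟨c, s, hexec, ho, hc⟩ := (RAM.runs_writeHittingSet rfl rfl hV).outputsWithin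
    fun a ha => hV.parameter_le a (List.mem_append_left _ ha)
  refine ⟨c, s, hexec, ho, hc.trans (mul_le_two_pow (steps_le ht (Nat.le_of_succ_le hn_t)
    (Nat.le_of_succ_le hd_t) hh (pointModulus_le_two_pow ht (Nat.le_of_succ_le hn_t) hr_t hd_t hh))
    (unitCost_le ht) (by nlinarith))⟩

theorem mainTheorem3 :
    ∃ (P : RAM.Prog) (C : ℕ), ∀ n r d : ℕ, 1 ≤ n → 1 ≤ r → 1 ≤ d →
      ∃ (ℓ m g : ℕ) (ω : RatZOmega m) (σ : RatZOmega m ≃ₐ[RatZ] RatZOmega m)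
        (pts : List (Fin n → List DTerm)) (H : Finset (Fin n → CyclicD σ ℓ)),
        -- the algebra `D = (K/F, σ, z)`, `F = ℚ(z)`, `K = F(ω)`, and its index `ℓ`
        IsPrimitiveRoot ω m ∧ σ ω = ω ^ g ∧
        IsCyclicDivisionAlgebra σ ℓ (RatFunc.X : RatZ) ∧
        d < ℓ ∧ ℓ ≤ (n * r * d + 1) ^ C ∧
        -- the set `H` in `D ^ n` and its size
        (∀ q, q ∈ H ↔ ∃ p ∈ pts, pointValue σ ℓ ω p = q) ∧
        H.card ≤ (n * r * (d + 1)) ^ (C * Nat.log 2 (d + 1)) ∧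
        -- it hits, nonzero values are invertible, and so it hits strongly
        IsHittingSet (abpClass n r d) H ∧
        (∀ f ∈ abpClass n r d, ∀ q ∈ H,
          FreeAlgebra.lift ℚ q f ≠ 0 → IsUnit (FreeAlgebra.lift ℚ q f)) ∧
        IsStrongHittingSet (abpClass n r d) H ∧
        -- the one program `P` writes down the algebra and the points in quasipolynomial time
        RAM.OutputsWithin P [n, r, d] (encodeOutput ℓ m g pts)
          (2 ^ (C * (Nat.log 2 (n * r * d) + 1) ^ C)) := by
  refine ⟨RAM.writeHittingSet, 60, fun n r d hn hr hd => ?_⟩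
  set h := Nat.clog 2 d
  set N := pointModulus n r d h
  have hlayers : d ≤ 2 ^ h := Nat.le_pow_clog one_lt_two d
  have hdivision := isCyclicDivisionAlgebra_sigma h
  have hhits : IsHittingSet (abpClass n r d) (hittingSet n h d N) :=
    isHittingSet_hittingSet hlayers le_rfl
  refine ⟨2 * 3 ^ h, 3 ^ (h + 1), 2, omega h, sigma h, hittingPoints n h d N, hittingSet n h d N,
    isPrimitiveRoot_omega h, sigma_omega h, hdivision, lt_two_mul_three_pow hlayers,
    (index_le hn hr hd).trans (Nat.pow_le_pow_right (Nat.succ_pos _) (by norm_num)),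
    fun q => mem_hittingSet, ?_, hhits, fun f _ q _ hne => hdivision.isUnit_of_ne_zero _ hne,
    fun f hf hf0 => ?_, ?_⟩
  · exact (card_hittingSet_le n h d N).trans ((pointModulus_pow_le hn hr hd).trans
      (Nat.pow_le_pow_right (by positivity) (Nat.mul_le_mul_right _ (by norm_num))))
  · obtain ⟨q, hq, hne⟩ := hhits f hf hf0
    exact ⟨q, hq, hdivision.isUnit_of_ne_zero _ hne⟩
  · obtain ⟨c, s, hexec, hout, hc⟩ := outputsWithin_writeHittingSet hn hr hd
    exact ⟨c, s, hexec, hout, hc.trans (Nat.pow_le_pow_right two_pos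
      (Nat.mul_le_mul_left _ (Nat.pow_le_pow_right (Nat.succ_pos _) (by norm_num))))⟩
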